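/- Let $p$ be a prime. Let $|\cdot|_p$ be the $p$-adic absolute value on $\mathbb{Q}_p$, $B(x,r)=\{y\in\mathbb{Q}_p : |x-y|_p\le r\}$, $\mathbb{Z}_p=B(0,1)$, and let $dx$ be the Haar measure on $\mathbb{Q}_p$ with $\int_{\mathbb{Z}_p}dx=1$. Write $\{x\}_p\in[0,1)$ for the $p$-adic fractional part of $x\in\mathbb{Q}_p$ and $e(t)=e^{2\pi i t}$, and put $\widehat{\mu}(s)=\int e(\{xs\}_p)\,d\mu(x)$ for a finite Borel measure $\mu$ on $\mathbb{Q}_p$ and $\widehat{f}(s)=\int e(\{xs\}_p)f(x)\,dx$ for $f\in L^1(\mathbb{Q}_p)$, where $s\in\mathbb{Q}_p$. For $A\subseteq\mathbb{Q}_p$ let $\mathcal{P}(A)$ be the set of Borel probability measures on $\mathbb{Q}_p$ whose support is compact and contained in $A$, and let the Fourier dimension of $A$ be $$\dim_F(A)=\sup\Big\{0\le\beta\le 1 : \sup_{0\ne\xi\in\mathbb{Q}_p}|\widehat{\mu}(\xi)|^2|\xi|_p^{\beta}<\infty\ \text{ for some }\mu\in\mathcal{P}(A)\Big\}.$$ A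 set $A$ is a Salem set if $\dim_F(A)$ equals the Hausdorff dimension $\dim_H(A)$. For $\tau\in\mathbb{R}$ let $$W(\tau)=\big\{x\in\mathbb{Z}_p : |xq-r|_p\le\max(|q|,|r|)^{-\tau}\text{ for infinitely many }(q,r)\in\mathbb{Z}^2\big\}.$$ There is a constant $C>0$, depending only on $p$, such that the following holds for every real $\tau>2$. The set $W(\tau)$ is a Salem set, with $\dim_H W(\tau)=\dim_F W(\tau)=2/\tau$. Moreover, there is a Borel probability measure $\mu$ with compact support contained in $W(\tau)$ such that $$|\widehat{\mu}(\xi)|\le C\,|\xi|_p^{-1/\tau}\ln^2(1+|\xi|_p)\qquad\text{for all }\xi\in\mathbb{Q}_p\text{ with }|\xi|_p\ge 1,$$ $$\mu(B(x,r))\le C\,r^{2/\tau}\ln^2(1+r^{-1})\qquad\text{for all }x\in\mathbb{Q}_p,\ 0<r\le 1,$$ and, for every real $q$ with $1\le q<1+\frac{1}{2\tau-3}$, there is a constant $C'$ (which may depend on $p$, $\tau$ and $q$) such that $$\Big(\int|\widehat{f}(x)|^2\,d\mu(x)\Big)^{1/2}\le C'\,\|f\|_{L^q(\mathbb{Q}_p)}\qquad\text{for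 all }f\in L^q(\mathbb{Q}_p)\cap L^1(\mathbb{Q}_p).$$ -/

import Mathlib

open MeasureTheory
open scoped ENNReal NNReal

noncomputable section

namespace PadicSalem

variable {p : ℕ} [Fact p.Prime]

/-- `ℚ_p` carries its Borel σ-algebra. -/
instance : MeasurableSpace ℚ_[p] := borel ℚ_[p]

instance : BorelSpace ℚ_[p] := ⟨rfl⟩

/-- The number `n` of digits of `x` after the `p`-adic point: `n = -v` if the valuation `v` of `x`
is negative, and `n = 0` otherwise. -/
def fracLen (x : ℚ_[p]) : ℕ := (-x.valuation).toNat

theorem norm_mul_pow_fracLen_le_one (x : ℚ_[p]) : ‖x * (p : ℚ_[p]) ^ fracLen x‖ ≤ 1 := by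
  rcases eq_or_ne x 0 with rfl | hx
  · simp
  · have hp : (p : ℚ_[p]) ≠ 0 := by exact_mod_cast (Fact.out : p.Prime).ne_zero
    rw [Padic.norm_le_one_iff_val_nonneg, Padic.valuation_mul hx (pow_ne_zero _ hp),
      Padic.valuation_pow, Padic.valuation_p]
    unfold fracLen
    omega

/-- The `p`-adic fractional part `{x}_p ∈ [0, 1)`. If `n = fracLen x`, then `x p ^ n` is a `p`-adic
integer; its first `n` digits form the natural number `appr _ n`, and these are the digits of `x`
at the negative powers of `p`. -/
def fracPart (x : ℚ_[p]) : ℝ :=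
  (PadicInt.appr ⟨x * (p : ℚ_[p]) ^ fracLen x, norm_mul_pow_fracLen_le_one x⟩ (fracLen x) : ℝ) /
    (p : ℝ) ^ fracLen x

/-- The character `x ↦ e({x}_p)`, where `e(t) = exp(2πit)`. -/
def stdChar (x : ℚ_[p]) : ℂ := Complex.exp (2 * Real.pi * Complex.I * (fracPart x : ℂ))

/-- The closed unit ball `ℤ_p` of `ℚ_p`, as a compact set with nonempty interior. -/
def unitBall (p : ℕ) [Fact p.Prime] : TopologicalSpace.PositiveCompacts ℚ_[p] where
  carrier := Metric.closedBall 0 1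
  isCompact' := isCompact_closedBall 0 1
  interior_nonempty' :=
    ⟨0, Metric.ball_subset_interior_closedBall (Metric.mem_ball_self one_pos)⟩

/-- The Haar measure on `ℚ_p` that gives `ℤ_p` measure `1`. -/
def haar (p : ℕ) [Fact p.Prime] : Measure ℚ_[p] := Measure.addHaarMeasure (unitBall p)

/-- The Fourier transform of a finite Borel measure on `ℚ_p`. -/
def fourierMeasure (μ : Measure ℚ_[p]) (s : ℚ_[p]) : ℂ := ∫ x, stdChar (x * s) ∂μ

/-- The Fourier transform of an integrable function on `ℚ_p`. -/
def fourierFun (f : ℚ_[p] → ℂ) (s : ℚ_[p]) : ℂ := ∫ x, stdChar (x * s) * f x ∂(haar p)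

/-- The Borel probability measures on `ℚ_p` with compact support contained in `A`. -/
def probOn (A : Set ℚ_[p]) : Set (Measure ℚ_[p]) :=
  {μ | IsProbabilityMeasure μ ∧ IsCompact μ.support ∧ μ.support ⊆ A}

/-- The Fourier dimension of a subset of `ℚ_p`. -/
def fourierDim (A : Set ℚ_[p]) : ℝ :=
  sSup {β : ℝ | 0 ≤ β ∧ β ≤ 1 ∧
    ∃ μ ∈ probOn A, ∃ C : ℝ, ∀ ξ : ℚ_[p], ξ ≠ 0 → ‖fourierMeasure μ ξ‖ ^ 2 * ‖ξ‖ ^ β ≤ C}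

/-- A Salem set: the Hausdorff and Fourier dimensions coincide. -/
def IsSalem (A : Set ℚ_[p]) : Prop := dimH A = ENNReal.ofReal (fourierDim A)

/-- The set `W(τ)` of `τ`-well-approximable `p`-adic integers. -/
def wellApprox (p : ℕ) [Fact p.Prime] (τ : ℝ) : Set ℚ_[p] :=
  {x | ‖x‖ ≤ 1 ∧
    {z : ℤ × ℤ | ‖x * (z.1 : ℚ_[p]) - (z.2 : ℚ_[p])‖ ≤
      ((max |z.1| |z.2| : ℤ) : ℝ) ^ (-τ)}.Infinite}

end PadicSalem

end

/-
For `q` prime of size comparable to `p ^ N`, the uniform measure on the fractions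
`(1 + a + b) / q` with `a, b < p ^ N` has a Fourier transform which vanishes for
`1 < |ξ|_p ≤ p ^ N` and is at most about `p ^ (-N)` beyond: each `q` contributes the square of a
geometric sum, and only few `q` have a large one. These fractions are far apart in the real
absolute value, so no `p`-adic ball contains too many of them. Multiplying densities smoothed
from such measures at rapidly increasing `N`, each at the radius `p ^ (-τ N)` at which the
fractions approximate to order `τ`, gives in the limit a measure on `W(τ)` with the Fourier decay
`|ξ|_p ^ (-1 / τ)` and the ball condition `r ^ (2 / τ)` up to logarithms. The Fourier decay gives
`2 / τ ≤ dim_F`, finiteness of energy integrals gives `dim_F ≤ dim_H`, and covering by balls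
around fractions gives `dim_H ≤ 2 / τ`.

For the restriction estimate, decompose `f` dyadically by size and treat each piece by `T T*`,
with the kernel of `T T*` cut at `|ξ|_p = p ^ n`: below the cut the ball condition controls the
`L²` norm, above it the Fourier decay controls the `L¹` to `L^∞` norm, and `n` is chosen to
balance the two.
-/

namespace PadicSalem

variable {p : ℕ} [Fact p.Prime]

section Ultrametric

variable {E : Type*} [SeminormedAddCommGroup E] [IsUltrametricDist E] {x y : E} {r : ℝ}

theorem norm_add_le_of_le (hx : ‖x‖ ≤ r) (hy : ‖y‖ ≤ r) : ‖x + y‖ ≤ r :=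
  (IsUltrametricDist.norm_add_le_max x y).trans (max_le hx hy)

theorem norm_sub_le_of_le (hx : ‖x‖ ≤ r) (hy : ‖y‖ ≤ r) : ‖x - y‖ ≤ r := by
  rw [sub_eq_add_neg]
  exact norm_add_le_of_le hx (by rwa [norm_neg])

end Ultrametric

theorem one_lt_prime_real (p : ℕ) [Fact p.Prime] : (1 : ℝ) < p :=
  mod_cast (Fact.out : p.Prime).one_lt

theorem prime_real_pos (p : ℕ) [Fact p.Prime] : (0 : ℝ) < p :=
  zero_lt_one.trans (one_lt_prime_real p)

theorem prime_padic_ne_zero (p : ℕ) [Fact p.Prime] : (p : ℚ_[p]) ≠ 0 :=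
  mod_cast (Fact.out : p.Prime).ne_zero

theorem exists_nat_norm_sub_le {x : ℚ_[p]} (hx : ‖x‖ ≤ 1) (n : ℕ) :
    ∃ a < p ^ n, ‖x - a‖ ≤ (p : ℝ) ^ (-(n : ℤ)) := by
  refine ⟨PadicInt.appr ⟨x, hx⟩ n, PadicInt.appr_lt _ _, ?_⟩
  have h := (PadicInt.norm_le_pow_iff_mem_span_pow _ n).2 (PadicInt.appr_spec n ⟨x, hx⟩)
  rw [PadicInt.norm_def] at h
  exact_mod_cast h

theorem norm_mul_pow_eq (x : ℚ_[p]) (k : ℤ) : ‖x * (p : ℚ_[p]) ^ k‖ = ‖x‖ * (p : ℝ) ^ (-k) := by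
  rw [norm_mul, Padic.norm_p_zpow]

theorem norm_sub_div_pow_le_one_iff (x z : ℚ_[p]) (m : ℕ) :
    ‖x - z / (p : ℚ_[p]) ^ m‖ ≤ 1 ↔ ‖x * (p : ℚ_[p]) ^ m - z‖ ≤ (p : ℝ) ^ (-(m : ℤ)) := by
  have hp := prime_padic_ne_zero p
  have h : x * (p : ℚ_[p]) ^ m - z = (x - z / (p : ℚ_[p]) ^ m) * (p : ℚ_[p]) ^ m := by
    field_simp
  rw [h, norm_mul, Padic.norm_p_pow]
  exact (mul_le_iff_le_one_left (zpow_pos (prime_real_pos p) _)).symm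

theorem exists_nat_norm_sub_div_le {x : ℚ_[p]} {m : ℕ} (hx : ‖x‖ ≤ (p : ℝ) ^ m) :
    ∃ a < p ^ m, ‖x - a / (p : ℚ_[p]) ^ m‖ ≤ 1 := by
  have hxm : ‖x * (p : ℚ_[p]) ^ m‖ ≤ 1 := by
    rw [norm_mul, Padic.norm_p_pow, zpow_neg, zpow_natCast]
    exact mul_inv_le_one_of_le₀ hx (pow_nonneg (prime_real_pos p).le _)
  obtain ⟨a, ha, h⟩ := exists_nat_norm_sub_le hxm m
  exact ⟨a, ha, (norm_sub_div_pow_le_one_iff x a m).2 h⟩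

theorem exists_int_norm_sub_div_le (x : ℚ_[p]) :
    ∃ (z : ℤ) (m : ℕ), ‖x - z / (p : ℚ_[p]) ^ m‖ ≤ 1 := by
  obtain ⟨m, hm⟩ := pow_unbounded_of_one_lt ‖x‖ (one_lt_prime_real p)
  obtain ⟨a, -, ha⟩ := exists_nat_norm_sub_div_le hm.le
  exact ⟨a, m, by rwa [Int.cast_natCast]⟩

theorem exists_norm_eq_pow {x : ℚ_[p]} (hx : 1 ≤ ‖x‖) : ∃ m : ℕ, ‖x‖ = (p : ℝ) ^ m := by
  have hx0 : x ≠ 0 := norm_pos_iff.1 (one_pos.trans_le hx)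
  have h := Padic.norm_eq_zpow_neg_valuation hx0
  have hv : 0 ≤ -x.valuation := by
    rwa [h, one_le_zpow_iff_right₀ (one_lt_prime_real p)] at hx
  lift -x.valuation to ℕ using hv with m
  exact ⟨m, mod_cast h⟩

section Character

open scoped FourierTransform

theorem fourierChar_eq_fourierChar_iff {s t : ℝ} : 𝐞 s = 𝐞 t ↔ ∃ k : ℤ, s = t + k := by
  simp only [Real.fourierChar_apply', Circle.exp_eq_exp]
  refine exists_congr fun k => ?_
  rw [← mul_right_inj' Real.two_pi_pos.ne' (b := s), mul_add, mul_comm _ (k : ℝ)]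

theorem fourierChar_div_pow_eq {z w : ℤ} {m n : ℕ}
    (h : ‖(z / (p : ℚ_[p]) ^ m - w / (p : ℚ_[p]) ^ n : ℚ_[p])‖ ≤ 1) :
    𝐞 (z / (p : ℝ) ^ m) = 𝐞 (w / (p : ℝ) ^ n) := by
  have hp := prime_padic_ne_zero p
  have hpr := (prime_real_pos p).ne'
  have hsub : (z / (p : ℚ_[p]) ^ m - w / (p : ℚ_[p]) ^ n : ℚ_[p]) =
      0 - ((w * p ^ m - z * p ^ n : ℤ) : ℚ_[p]) / (p : ℚ_[p]) ^ (m + n) := by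
    push_cast; field_simp; ring
  rw [hsub, norm_sub_div_pow_le_one_iff, zero_mul, zero_sub, norm_neg,
    Padic.norm_int_le_pow_iff_dvd] at h
  obtain ⟨k, hk⟩ := h
  have hk' : (w : ℝ) * p ^ m - z * p ^ n = p ^ (m + n) * k := mod_cast hk
  refine fourierChar_eq_fourierChar_iff.2 ⟨-k, ?_⟩
  push_cast
  field_simp
  linear_combination -hk'

theorem stdChar_eq_fourierChar {x : ℚ_[p]} {z : ℤ} {m : ℕ}
    (h : ‖x - z / (p : ℚ_[p]) ^ m‖ ≤ 1) : stdChar x = 𝐞 (z / (p : ℝ) ^ m) := by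
  set y : ℤ_[p] := ⟨x * (p : ℚ_[p]) ^ fracLen x, norm_mul_pow_fracLen_le_one x⟩ with hy
  have happr : ‖x - (y.appr (fracLen x) : ℤ) / (p : ℚ_[p]) ^ fracLen x‖ ≤ 1 := by
    rw [norm_sub_div_pow_le_one_iff]
    have := (PadicInt.norm_le_pow_iff_mem_span_pow _ _).2 (PadicInt.appr_spec (fracLen x) y)
    rw [PadicInt.norm_def, PadicInt.coe_sub] at this
    simpa only [hy, PadicInt.coe_natCast, Int.cast_natCast] using this
  have hsub := norm_sub_le_of_le h happr
  rw [sub_sub_sub_cancel_left] at hsub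
  rw [← fourierChar_div_pow_eq hsub, Real.fourierChar_apply]
  simp only [stdChar, fracPart, hy]
  push_cast
  ring_nf

theorem stdChar_add (x y : ℚ_[p]) : stdChar (x + y) = stdChar x * stdChar y := by
  have hp := prime_padic_ne_zero p
  have hpr := (prime_real_pos p).ne'
  obtain ⟨z, m, hz⟩ := exists_int_norm_sub_div_le x
  obtain ⟨w, n, hw⟩ := exists_int_norm_sub_div_le y
  have hsum : x + y - (z * p ^ n + w * p ^ m : ℤ) / (p : ℚ_[p]) ^ (m + n) =
      (x - z / (p : ℚ_[p]) ^ m) + (y - w / (p : ℚ_[p]) ^ n) := by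
    push_cast; field_simp; ring
  have hzw := hsum ▸ norm_add_le_of_le hz hw
  have hadd : ((z * p ^ n + w * p ^ m : ℤ) : ℝ) / (p : ℝ) ^ (m + n) =
      z / (p : ℝ) ^ m + w / (p : ℝ) ^ n := by
    push_cast; field_simp; ring
  rw [stdChar_eq_fourierChar hz, stdChar_eq_fourierChar hw, stdChar_eq_fourierChar hzw, hadd,
    AddChar.map_add_eq_mul, Circle.coe_mul]

theorem norm_stdChar (x : ℚ_[p]) : ‖stdChar x‖ = 1 := by
  obtain ⟨z, m, hz⟩ := exists_int_norm_sub_div_le x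
  rw [stdChar_eq_fourierChar hz, Circle.norm_coe]

theorem stdChar_of_norm_le_one {x : ℚ_[p]} (hx : ‖x‖ ≤ 1) : stdChar x = 1 := by
  rw [stdChar_eq_fourierChar (z := 0) (m := 0) (by simpa using hx)]
  simp

@[simp] theorem stdChar_zero : stdChar (0 : ℚ_[p]) = 1 := stdChar_of_norm_le_one (by simp)

theorem stdChar_neg (x : ℚ_[p]) : stdChar (-x) = (starRingEnd ℂ) (stdChar x) := by
  rw [← Complex.inv_eq_conj (norm_stdChar x)]
  refine eq_inv_of_mul_eq_one_left ?_
  rw [← stdChar_add, neg_add_cancel, stdChar_zero]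

theorem stdChar_sub (x y : ℚ_[p]) : stdChar (x - y) = stdChar x * (starRingEnd ℂ) (stdChar y) := by
  rw [sub_eq_add_neg, stdChar_add, stdChar_neg]

theorem stdChar_inv_prime_ne_one (p : ℕ) [Fact p.Prime] : stdChar ((p : ℚ_[p])⁻¹) ≠ 1 := by
  have hp := one_lt_prime_real p
  rw [stdChar_eq_fourierChar (z := 1) (m := 1) (by simp), Ne, Circle.coe_eq_one,
    ← AddChar.map_zero_eq_one (𝐞), fourierChar_eq_fourierChar_iff]
  rintro ⟨k, hk⟩
  have hk' : (p : ℝ)⁻¹ = k := by simpa using hk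
  have hpos : (0 : ℝ) < k := hk' ▸ inv_pos.2 (zero_lt_one.trans hp)
  have hlt : (k : ℝ) < 1 := hk' ▸ inv_lt_one_of_one_lt₀ hp
  norm_cast at hpos hlt
  omega

theorem continuous_stdChar : Continuous (stdChar : ℚ_[p] → ℂ) := by
  refine IsLocallyConstant.continuous ?_
  rw [IsLocallyConstant.iff_eventually_eq]
  intro x
  filter_upwards [Metric.closedBall_mem_nhds x one_pos] with y hy
  rw [← sub_add_cancel y x, stdChar_add, stdChar_of_norm_le_one (by rwa [← dist_eq_norm]), one_mul]

end Character

section Haar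

instance : (haar p).IsAddHaarMeasure := by unfold haar; infer_instance

instance : SigmaFinite (haar p) := by unfold haar; infer_instance

theorem haar_closedBall_one (x : ℚ_[p]) : haar p (Metric.closedBall x 1) = 1 := by
  rw [Measure.addHaar_closedBall_center]
  exact Measure.addHaarMeasure_self (K₀ := unitBall p)

theorem measurePreserving_mul_right {c : ℚ_[p]} (hc : ‖c‖ = 1) :
    MeasurePreserving (· * c) (haar p) (haar p) := by
  have hc0 : c ≠ 0 := norm_ne_zero_iff.1 (by simp [hc])
  have hmeas : Measurable (· * c : ℚ_[p] → ℚ_[p]) := (continuous_mul_const c).measurable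
  have : ((haar p).map (· * c)).IsAddHaarMeasure :=
    AddEquiv.isAddHaarMeasure_map (haar p) (AddAut.mulRight (Units.mk0 c hc0))
      (continuous_mul_const c) (continuous_mul_const c⁻¹)
  refine ⟨hmeas, ?_⟩
  rw [Measure.addHaarMeasure_unique ((haar p).map (· * c)) (unitBall p)]
  have hball : (· * c) ⁻¹' (unitBall p : Set ℚ_[p]) = Metric.closedBall 0 1 := by
    ext x
    change x * c ∈ Metric.closedBall 0 1 ↔ _
    simp [hc]
  rw [Measure.map_apply hmeas (unitBall p).isCompact.measurableSet, hball, haar_closedBall_one,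
    one_smul, haar]

theorem closedBall_zpow_eq_iUnion (x : ℚ_[p]) (k : ℤ) (n : ℕ) :
    Metric.closedBall x ((p : ℝ) ^ k) = ⋃ a ∈ Finset.range (p ^ n),
      Metric.closedBall (x + a * (p : ℚ_[p]) ^ (-k)) ((p : ℝ) ^ (k - n)) := by
  have hp := prime_padic_ne_zero p
  have hpr := prime_real_pos p
  have hball (y : ℚ_[p]) (a : ℕ) :
      y ∈ Metric.closedBall (x + a * (p : ℚ_[p]) ^ (-k)) ((p : ℝ) ^ (k - n)) ↔
        ‖(y - x) * (p : ℚ_[p]) ^ k - a‖ ≤ (p : ℝ) ^ (-(n : ℤ)) := by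
    have : y - (x + a * (p : ℚ_[p]) ^ (-k)) =
        ((y - x) * (p : ℚ_[p]) ^ k - a) * (p : ℚ_[p]) ^ (-k) := by
      rw [zpow_neg]; field_simp; ring
    rw [mem_closedBall_iff_norm, this, norm_mul_pow_eq, neg_neg, sub_eq_neg_add k,
      zpow_add₀ hpr.ne', mul_le_mul_iff_left₀ (zpow_pos hpr k)]
  have hscale (y : ℚ_[p]) :
      y ∈ Metric.closedBall x ((p : ℝ) ^ k) ↔ ‖(y - x) * (p : ℚ_[p]) ^ k‖ ≤ 1 := by
    rw [mem_closedBall_iff_norm, norm_mul_pow_eq, zpow_neg, mul_inv_le_iff₀ (zpow_pos hpr k),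
      one_mul]
  ext y
  simp only [hscale, Set.mem_iUnion, Finset.mem_range, exists_prop, hball]
  refine ⟨fun hy => exists_nat_norm_sub_le hy n, ?_⟩
  rintro ⟨a, -, ha⟩
  rw [← sub_add_cancel ((y - x) * (p : ℚ_[p]) ^ k) a]
  exact norm_add_le_of_le (ha.trans (zpow_le_one_of_nonpos₀ (one_lt_prime_real p).le (by omega)))
    (IsUltrametricDist.norm_natCast_le_one ℚ_[p] a)

theorem pairwiseDisjoint_closedBall_zpow (x : ℚ_[p]) (k : ℤ) (n : ℕ) :
    (Finset.range (p ^ n) : Set ℕ).PairwiseDisjoint fun a : ℕ =>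
      Metric.closedBall (x + a * (p : ℚ_[p]) ^ (-k)) ((p : ℝ) ^ (k - n)) := by
  have hpr := prime_real_pos p
  intro a ha b hb hab
  refine (IsUltrametricDist.closedBall_eq_or_disjoint _ _ _).resolve_left fun h => hab ?_
  have hmem := Metric.mem_closedBall_self (x := x + a * (p : ℚ_[p]) ^ (-k))
    (zpow_pos hpr (k - n)).le
  rw [h, mem_closedBall_iff_norm, add_sub_add_left_eq_sub, ← sub_mul, norm_mul_pow_eq, neg_neg,
    sub_eq_neg_add k, zpow_add₀ hpr.ne', mul_le_mul_iff_left₀ (zpow_pos hpr k)] at hmem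
  have hdvd : ((p : ℤ) ^ n) ∣ a - b :=
    (Padic.norm_int_le_pow_iff_dvd _ n).1 (mod_cast hmem)
  exact (Nat.modEq_of_dvd (mod_cast dvd_sub_comm.1 hdvd)).eq_of_lt_of_lt (by simpa using ha)
    (by simpa using hb)

theorem haar_closedBall_zpow_eq_mul (x : ℚ_[p]) (k : ℤ) (n : ℕ) :
    haar p (Metric.closedBall x ((p : ℝ) ^ k)) =
      p ^ n * haar p (Metric.closedBall 0 ((p : ℝ) ^ (k - n))) := by
  rw [closedBall_zpow_eq_iUnion x k n, measure_biUnion_finset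
    (pairwiseDisjoint_closedBall_zpow x k n) fun _ _ => measurableSet_closedBall]
  simp only [Measure.addHaar_closedBall_center (haar p) (_ + _), Finset.sum_const,
    Finset.card_range, nsmul_eq_mul, Nat.cast_pow]

theorem haar_closedBall (x : ℚ_[p]) (k : ℤ) :
    haar p (Metric.closedBall x ((p : ℝ) ^ k)) = ENNReal.ofReal ((p : ℝ) ^ k) := by
  have hpr := prime_real_pos p
  obtain ⟨n, rfl | rfl⟩ := Int.eq_nat_or_neg k
  · rw [haar_closedBall_zpow_eq_mul x n n, sub_self, zpow_zero, haar_closedBall_one, mul_one,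
      zpow_natCast, ENNReal.ofReal_pow hpr.le, ENNReal.ofReal_natCast]
  · have h := haar_closedBall_zpow_eq_mul (0 : ℚ_[p]) 0 n
    rw [zpow_zero, haar_closedBall_one, zero_sub, mul_comm] at h
    rw [Measure.addHaar_closedBall_center, ENNReal.eq_inv_of_mul_eq_one_left h.symm, zpow_neg,
      zpow_natCast, ENNReal.ofReal_inv_of_pos (pow_pos hpr n), ENNReal.ofReal_pow hpr.le,
      ENNReal.ofReal_natCast]

theorem haar_real_closedBall (x : ℚ_[p]) (k : ℤ) :
    (haar p).real (Metric.closedBall x ((p : ℝ) ^ k)) = (p : ℝ) ^ k := by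
  rw [Measure.real, haar_closedBall, ENNReal.toReal_ofReal (zpow_pos (prime_real_pos p) _).le]

theorem setIntegral_closedBall_stdChar_of_le {x : ℚ_[p]} {k : ℤ} (hx : ‖x‖ ≤ (p : ℝ) ^ (-k)) :
    ∫ t in Metric.closedBall 0 ((p : ℝ) ^ k), stdChar (x * t) ∂haar p = ((p : ℝ) ^ k : ℂ) := by
  have hone : Set.EqOn (fun t => stdChar (x * t)) (fun _ => 1)
      (Metric.closedBall 0 ((p : ℝ) ^ k)) := fun t ht => by
    refine stdChar_of_norm_le_one ?_
    rw [mem_closedBall_zero_iff] at ht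
    calc ‖x * t‖ = ‖x‖ * ‖t‖ := norm_mul _ _
      _ ≤ (p : ℝ) ^ (-k) * (p : ℝ) ^ k := by gcongr
      _ = 1 := by rw [← zpow_add₀ (prime_real_pos p).ne', neg_add_cancel, zpow_zero]
  rw [setIntegral_congr_fun measurableSet_closedBall hone, setIntegral_const,
    haar_real_closedBall]
  simp

theorem setIntegral_closedBall_comp_add_mul {E : Type*} [NormedAddCommGroup E] [NormedSpace ℝ E]
    {r : ℝ} {b c : ℚ_[p]} (hb : ‖b‖ ≤ r) (hc : ‖c‖ = 1) (f : ℚ_[p] → E) :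
    ∫ t in Metric.closedBall 0 r, f ((b + t) * c) ∂haar p =
      ∫ t in Metric.closedBall 0 r, f t ∂haar p := by
  have hc0 : c ≠ 0 := norm_ne_zero_iff.1 (by simp [hc])
  have hpre : (fun t => (b + t) * c) ⁻¹' Metric.closedBall (0 : ℚ_[p]) r =
      Metric.closedBall 0 r := by
    ext t
    simp only [Set.mem_preimage, mem_closedBall_zero_iff, norm_mul, hc, mul_one]
    exact ⟨fun h => by simpa using norm_sub_le_of_le h hb, fun h => norm_add_le_of_le hb h⟩
  have hemb : MeasurableEmbedding fun t : ℚ_[p] => (b + t) * c :=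
    ((Homeomorph.addLeft b).trans (Homeomorph.mulRight₀ c hc0)).measurableEmbedding
  have h := ((measurePreserving_mul_right hc).comp
    (measurePreserving_add_left (haar p) b)).setIntegral_preimage_emb hemb f (Metric.closedBall 0 r)
  rwa [Function.comp_def, hpre] at h

theorem setIntegral_closedBall_stdChar_of_lt {x : ℚ_[p]} {k : ℤ} (hx : (p : ℝ) ^ (-k) < ‖x‖) :
    ∫ t in Metric.closedBall 0 ((p : ℝ) ^ k), stdChar (x * t) ∂haar p = 0 := by
  have hpr := prime_real_pos p
  have hx0 : x ≠ 0 := norm_pos_iff.1 ((zpow_pos hpr _).trans hx)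
  have hy : ‖x⁻¹ * (p : ℚ_[p])⁻¹‖ ≤ (p : ℝ) ^ k := by
    have hx' : (p : ℝ) ^ (-k + 1) ≤ ‖x‖ := by
      rwa [← not_le, Padic.norm_le_pow_iff_norm_lt_pow_add_one, not_lt] at hx
    rw [norm_mul, norm_inv, norm_inv, Padic.norm_p, inv_inv, inv_mul_le_iff₀ (norm_pos_iff.2 hx0)]
    calc (p : ℝ) = (p : ℝ) ^ (-k + 1) * (p : ℝ) ^ k := by
          rw [← zpow_add₀ hpr.ne']; simp
      _ ≤ ‖x‖ * (p : ℝ) ^ k := by gcongr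
  have hshift := setIntegral_closedBall_comp_add_mul hy norm_one fun t => stdChar (x * t)
  simp only [mul_one, mul_add, stdChar_add, mul_inv_cancel_left₀ hx0, integral_const_mul]
    at hshift
  by_contra hne
  exact stdChar_inv_prime_ne_one p ((mul_eq_right₀ hne).1 hshift)

end Haar

section Primes

open Filter
open scoped Nat.Prime

theorem mul_log_two_div_le_primeCounting {n : ℕ} (hn : 6 ≤ n) :
    n * Real.log 2 / (2 * Real.log n) ≤ π n := by
  have hsq : (n + 1) ^ 2 ≤ 2 ^ n := by
    induction n, hn using Nat.le_induction with
    | base => norm_num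
    | succ n hn ih => rw [pow_succ 2]; nlinarith
  have hlog : Real.log (n + 1) ≤ n * Real.log 2 / 2 := by
    have h := Real.log_le_log (by positivity) (by exact_mod_cast hsq : ((n : ℝ) + 1) ^ 2 ≤ 2 ^ n)
    rw [Real.log_pow, Real.log_pow] at h
    push_cast at h
    linarith
  have hlogn : 0 < Real.log n := Real.log_pos (by exact_mod_cast (by omega : 1 < n))
  calc n * Real.log 2 / (2 * Real.log n) = (n * Real.log 2 - n * Real.log 2 / 2) / Real.log n := by
        field_simp; ring
    _ ≤ (n * Real.log 2 - Real.log (n + 1)) / Real.log n := by gcongr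
    _ ≤ π n := Chebyshev.pi_ge n

/-- The primes in the interval `(2 p ^ N, p ^ (N + 4)]`, the denominators of the approximating
fractions at stage `N`. They are prime to `p`, and each one exceeds every numerator used at that
stage, so all these fractions are in lowest terms. -/
def window (p N : ℕ) : Finset ℕ := {q ∈ Finset.Ioc (2 * p ^ N) (p ^ (N + 4)) | q.Prime}

theorem mem_window {p N q : ℕ} :
    q ∈ window p N ↔ (2 * p ^ N < q ∧ q ≤ p ^ (N + 4)) ∧ q.Prime := by
  simp [window]

theorem primeCounting_le_add_card_window (p N : ℕ) :
    π (p ^ (N + 4)) ≤ π (2 * p ^ N) + (window p N).card := by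
  rw [← Nat.primesLE_card_eq_primeCounting, ← Nat.primesLE_card_eq_primeCounting]
  refine (Finset.card_le_card fun q hq => ?_).trans (Finset.card_union_le _ _)
  rw [Nat.mem_primesLE] at hq
  rw [Finset.mem_union, Nat.mem_primesLE, mem_window]
  have := le_or_gt q (2 * p ^ N)
  tauto

theorem eventually_primeCounting_two_mul_pow_le (p : ℕ) [Fact p.Prime] :
    ∀ᶠ N : ℕ in atTop,
      (π (2 * p ^ N) : ℝ) ≤ 5 * (Real.log 2 / Real.log p * (p : ℝ) ^ N / N) := by
  have hp := one_lt_prime_real p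
  have htends : Tendsto (fun N : ℕ => 2 * (p : ℝ) ^ N) atTop atTop :=
    (tendsto_pow_atTop_atTop_of_one_lt hp).const_mul_atTop two_pos
  filter_upwards [eventually_ge_atTop 1, htends.eventually
    (Chebyshev.eventually_primeCounting_le (half_pos (Real.log_pos one_lt_two)))] with N hN hup
  have hN0 : (0 : ℝ) < N := mod_cast hN
  have hlogp := Real.log_pos hp
  have hlog4 : Real.log 4 = 2 * Real.log 2 := by
    rw [show (4 : ℝ) = 2 ^ 2 by norm_num, Real.log_pow]; norm_num
  have hfloor : ⌊2 * (p : ℝ) ^ N⌋₊ = 2 * p ^ N := by exact_mod_cast Nat.floor_natCast (2 * p ^ N)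
  have hlog : N * Real.log p ≤ Real.log (2 * (p : ℝ) ^ N) := by
    rw [← Real.log_pow]
    exact Real.log_le_log (by positivity) (by linarith [pow_pos (prime_real_pos p) N])
  rw [hfloor, hlog4] at hup
  calc (π (2 * p ^ N) : ℝ)
      ≤ (2 * Real.log 2 + Real.log 2 / 2) * (2 * (p : ℝ) ^ N) / Real.log (2 * (p : ℝ) ^ N) := hup
    _ ≤ (2 * Real.log 2 + Real.log 2 / 2) * (2 * (p : ℝ) ^ N) / (N * Real.log p) := by
        gcongr
    _ = 5 * (Real.log 2 / Real.log p * (p : ℝ) ^ N / N) := by field_simp; ring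

theorem le_primeCounting_pow_add_four {N : ℕ} (hN : 12 ≤ N) :
    6 * (Real.log 2 / Real.log p * (p : ℝ) ^ N / N) ≤ π (p ^ (N + 4)) := by
  have hlogp := Real.log_pos (one_lt_prime_real p)
  have h2p : 2 ≤ p := (Fact.out : p.Prime).two_le
  have hlarge : 6 ≤ p ^ (N + 4) := by
    calc 6 ≤ 2 ^ 4 := by norm_num
      _ ≤ p ^ (N + 4) := (Nat.pow_le_pow_left h2p 4).trans (Nat.pow_le_pow_right (by omega)
        (by omega))
  have hp4 : (16 : ℝ) ≤ (p : ℝ) ^ 4 := by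
    exact_mod_cast (by norm_num : 16 = 2 ^ 4).trans_le (Nat.pow_le_pow_left h2p 4)
  have hN' : (12 : ℝ) ≤ N := mod_cast hN
  have hlow := mul_log_two_div_le_primeCounting hlarge
  refine le_trans ?_ hlow
  push_cast
  rw [Real.log_pow]
  calc 6 * (Real.log 2 / Real.log p * (p : ℝ) ^ N / N)
      = Real.log 2 / Real.log p * (p : ℝ) ^ N * (6 / N) := by ring
    _ ≤ Real.log 2 / Real.log p * (p : ℝ) ^ N * (16 / (2 * (N + 4))) := by
        gcongr ?_ * ?_
        rw [div_le_div_iff₀ (by positivity) (by positivity)]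
        linarith
    _ ≤ Real.log 2 / Real.log p * (p : ℝ) ^ N * ((p : ℝ) ^ 4 / (2 * (N + 4))) := by gcongr
    _ = (p : ℝ) ^ (N + 4) * Real.log 2 / (2 * ((N + 4 : ℕ) * Real.log p)) := by
        push_cast; field_simp; ring

theorem exists_le_card_window (p : ℕ) [Fact p.Prime] :
    ∃ c > 0, ∀ᶠ N : ℕ in atTop, c * (p : ℝ) ^ N / N ≤ (window p N).card := by
  refine ⟨Real.log 2 / Real.log p,
    div_pos (Real.log_pos one_lt_two) (Real.log_pos (one_lt_prime_real p)), ?_⟩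
  filter_upwards [eventually_ge_atTop 12, eventually_primeCounting_two_mul_pow_le p] with N hN hup
  have hlow := le_primeCounting_pow_add_four (p := p) hN
  have hsub : (π (p ^ (N + 4)) : ℝ) ≤ π (2 * p ^ N) + (window p N).card :=
    mod_cast primeCounting_le_add_card_window p N
  linarith

theorem norm_natCast_window {N q : ℕ} (hN : 1 ≤ N) (hq : q ∈ window p N) : ‖(q : ℚ_[p])‖ = 1 := by
  rw [mem_window] at hq
  rw [Padic.norm_natCast_eq_one_iff, Nat.coprime_primes Fact.out hq.2]
  have : p ≤ p ^ N := Nat.le_self_pow (by omega) p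
  omega

theorem natCast_window_ne_zero {N q : ℕ} (hq : q ∈ window p N) : (q : ℚ_[p]) ≠ 0 :=
  mod_cast (mem_window.1 hq).2.ne_zero

theorem card_mul_le_of_primes_dvd {b N M v : ℕ} (hb : 1 < b) {F : Finset ℕ} (hv : v ≠ 0)
    (hvM : v ≤ b ^ M) (hF : ∀ q ∈ F, q.Prime ∧ b ^ N ≤ q ∧ q ∣ v) : N * F.card ≤ M := by
  refine (Nat.pow_le_pow_iff_right hb).1 ?_
  calc b ^ (N * F.card) = (b ^ N) ^ F.card := pow_mul b N _
    _ ≤ ∏ q ∈ F, q := Finset.pow_card_le_prod _ _ _ fun q hq => (hF q hq).2.1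
    _ ≤ v := Nat.le_of_dvd (Nat.pos_of_ne_zero hv) <|
        Finset.prod_primes_dvd v (fun q hq => (hF q hq).1.prime) fun q hq => (hF q hq).2.2
    _ ≤ b ^ M := hvM

end Primes

section ApproxMeasure

/-- The rational number `(1 + a + b) / q` in `ℚ_p` attached to a triple `(q, a, b)`. -/
noncomputable def ratPoint (p : ℕ) [Fact p.Prime] (z : ℕ × ℕ × ℕ) : ℚ_[p] :=
  ((1 + z.2.1 + z.2.2 : ℕ) : ℚ_[p]) / (z.1 : ℚ_[p])

/-- The triples `(q, a, b)` with `q` a prime in the window and `a, b < p ^ N`. -/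
def triples (p N : ℕ) : Finset (ℕ × ℕ × ℕ) :=
  window p N ×ˢ (Finset.range (p ^ N) ×ˢ Finset.range (p ^ N))

theorem mem_triples {p N : ℕ} {z : ℕ × ℕ × ℕ} :
    z ∈ triples p N ↔ z.1 ∈ window p N ∧ z.2.1 < p ^ N ∧ z.2.2 < p ^ N := by
  simp [triples]

theorem card_triples (p N : ℕ) : (triples p N).card = (window p N).card * (p ^ N * p ^ N) := by
  simp [triples]

/-- The uniform distribution on the points `(1 + a + b) / q`, counted with multiplicity. Writing
the numerator as a sum of two independent terms squares the geometric sums in its Fourier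
transform. -/
noncomputable def approxMeasure (p : ℕ) [Fact p.Prime] (N : ℕ) : Measure ℚ_[p] :=
  ((triples p N).card : ℝ≥0∞)⁻¹ • ∑ z ∈ triples p N, Measure.dirac (ratPoint p z)

theorem isProbabilityMeasure_approxMeasure {N : ℕ} (h : (window p N).Nonempty) :
    IsProbabilityMeasure (approxMeasure p N) := by
  have h0 : (triples p N).card ≠ 0 := by
    rw [card_triples]
    exact mul_ne_zero h.card_pos.ne' (by simp [(Fact.out : p.Prime).ne_zero])
  refine ⟨?_⟩
  simp only [approxMeasure, Measure.smul_apply, Measure.finsetSum_apply, measure_univ,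
    Finset.sum_const, nsmul_eq_mul, mul_one, smul_eq_mul]
  exact ENNReal.inv_mul_cancel (mod_cast h0) (ENNReal.natCast_ne_top _)

variable {E : Type*} [NormedAddCommGroup E] [NormedSpace ℝ E] [CompleteSpace E]

theorem integral_approxMeasure (N : ℕ) (φ : ℚ_[p] → E) :
    ∫ x, φ x ∂approxMeasure p N =
      ((triples p N).card : ℝ)⁻¹ • ∑ z ∈ triples p N, φ (ratPoint p z) := by
  rw [approxMeasure, integral_smul_measure,
    integral_finsetSum_measure fun z _ => integrable_dirac (by simp)]
  simp

open Classical in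
theorem approxMeasure_real_apply (N : ℕ) {S : Set ℚ_[p]} (hS : MeasurableSet S) :
    (approxMeasure p N).real S =
      ((triples p N).card : ℝ)⁻¹ * {z ∈ triples p N | ratPoint p z ∈ S}.card := by
  rw [← integral_indicator_one hS, integral_approxMeasure, Finset.card_filter, smul_eq_mul]
  simp only [Set.indicator_apply, Pi.one_apply, Nat.cast_sum, Nat.cast_ite, Nat.cast_one,
    Nat.cast_zero]

/-- `φ` is constant on the balls of radius `p ^ (-n)`. -/
def ConstOnBalls {E : Type*} (n : ℕ) (φ : ℚ_[p] → E) : Prop :=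
  ∀ x y : ℚ_[p], ‖y - x‖ ≤ (p : ℝ) ^ (-(n : ℤ)) → φ y = φ x

theorem ConstOnBalls.mono {E : Type*} {m n : ℕ} {φ : ℚ_[p] → E} (h : ConstOnBalls m φ)
    (hmn : m ≤ n) : ConstOnBalls n φ := fun x y hxy =>
  h x y (hxy.trans (zpow_le_zpow_right₀ (one_lt_prime_real p).le (by omega)))

theorem ConstOnBalls.continuous {E : Type*} [TopologicalSpace E] {n : ℕ} {φ : ℚ_[p] → E}
    (h : ConstOnBalls n φ) : Continuous φ := by
  refine continuous_iff_continuousAt.2 fun x => (continuousAt_const (y := φ x)).congr ?_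
  filter_upwards [Metric.closedBall_mem_nhds x (zpow_pos (prime_real_pos p) (-(n : ℤ)))] with y hy
  exact (h x y (mem_closedBall_iff_norm.1 hy)).symm

theorem integrableOn_closedBall {E : Type*} [NormedAddCommGroup E] {φ : ℚ_[p] → E}
    (h : Continuous φ) (x : ℚ_[p]) (r : ℝ) :
    IntegrableOn φ (Metric.closedBall x r) (haar p) :=
  h.continuousOn.integrableOn_compact (isCompact_closedBall x r)

theorem ConstOnBalls.setIntegral_eq_sum {n : ℕ} {φ : ℚ_[p] → E} (h : ConstOnBalls n φ) :
    ∫ x in Metric.closedBall 0 1, φ x ∂haar p =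
      (p : ℝ) ^ (-(n : ℤ)) • ∑ a ∈ Finset.range (p ^ n), φ a := by
  have hcover := closedBall_zpow_eq_iUnion (0 : ℚ_[p]) 0 n
  have hdisj := pairwiseDisjoint_closedBall_zpow (0 : ℚ_[p]) 0 n
  simp only [zpow_zero, neg_zero, mul_one, zero_add, zero_sub] at hcover hdisj
  rw [hcover, integral_biUnion_finset _ (fun _ _ => measurableSet_closedBall) hdisj
    (fun _ _ => integrableOn_closedBall h.continuous _ _), Finset.smul_sum]
  refine Finset.sum_congr rfl fun a _ => ?_
  rw [setIntegral_congr_fun (g := fun _ => φ a) measurableSet_closedBall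
      fun x hx => h _ _ (mem_closedBall_iff_norm.1 hx),
    setIntegral_const, haar_real_closedBall]

theorem ConstOnBalls.sum_range_eq {n : ℕ} {φ : ℚ_[p] → E} (h : ConstOnBalls n φ) {b q : ℚ_[p]}
    (hb : ‖b‖ ≤ 1) (hq : ‖q‖ = 1) :
    ∑ a ∈ Finset.range (p ^ n), φ ((b + a) / q) =
      (p : ℝ) ^ n • ∫ x in Metric.closedBall 0 1, φ x ∂haar p := by
  have hq' : ‖q⁻¹‖ = 1 := by rw [norm_inv, hq, inv_one]
  have hψ : ConstOnBalls n fun x => φ ((b + x) * q⁻¹) := fun x y hxy => by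
    refine h _ _ ?_
    rwa [← sub_mul, add_sub_add_left_eq_sub, norm_mul, hq', mul_one]
  rw [← setIntegral_closedBall_comp_add_mul hb hq', hψ.setIntegral_eq_sum, smul_smul, zpow_neg,
    zpow_natCast, mul_inv_cancel₀ (pow_pos (prime_real_pos p) n).ne', one_smul]
  rfl

theorem ConstOnBalls.integral_approxMeasure_eq {N : ℕ} (hN : 1 ≤ N) (hw : (window p N).Nonempty)
    {φ : ℚ_[p] → E} (h : ConstOnBalls N φ) :
    ∫ x, φ x ∂approxMeasure p N = ∫ x in Metric.closedBall 0 1, φ x ∂haar p := by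
  have hfixed : ∀ q ∈ window p N, ∀ a ∈ Finset.range (p ^ N),
      ∑ b ∈ Finset.range (p ^ N), φ (ratPoint p (q, a, b)) =
        (p : ℝ) ^ N • ∫ x in Metric.closedBall 0 1, φ x ∂haar p := fun q hq a _ => by
    rw [← h.sum_range_eq (IsUltrametricDist.norm_natCast_le_one ℚ_[p] (1 + a))
      (norm_natCast_window hN hq)]
    exact Finset.sum_congr rfl fun b _ => by simp only [ratPoint, Nat.cast_add]
  have hcard : ((window p N).card : ℝ) ≠ 0 := mod_cast hw.card_pos.ne'
  have hp := (prime_real_pos p).ne'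
  rw [integral_approxMeasure, card_triples, triples, Finset.sum_product]
  simp only [Finset.sum_product]
  rw [Finset.sum_congr rfl fun q hq => Finset.sum_congr rfl (hfixed q hq)]
  simp only [Finset.sum_const, Finset.card_range, ← Nat.cast_smul_eq_nsmul ℝ, smul_smul]
  convert one_smul ℝ _ using 2
  push_cast
  field_simp

theorem constOnBalls_stdChar {s : ℚ_[p]} {m : ℕ} (hs : ‖s‖ ≤ (p : ℝ) ^ m) :
    ConstOnBalls m (fun x => stdChar (x * s)) := by
  intro x y hxy
  have hsmall : ‖(y - x) * s‖ ≤ 1 := by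
    calc ‖(y - x) * s‖ ≤ (p : ℝ) ^ (-(m : ℤ)) * (p : ℝ) ^ m := by rw [norm_mul]; gcongr
      _ = 1 := by rw [zpow_neg, zpow_natCast, inv_mul_cancel₀ (pow_pos (prime_real_pos p) m).ne']
  change stdChar (y * s) = stdChar (x * s)
  rw [← sub_add_cancel y x, add_mul, stdChar_add, stdChar_of_norm_le_one hsmall, one_mul]

theorem fourierMeasure_approxMeasure_eq_zero {N : ℕ} (hN : 1 ≤ N) (hw : (window p N).Nonempty)
    {s : ℚ_[p]} (h1 : 1 < ‖s‖) (hs : ‖s‖ ≤ (p : ℝ) ^ N) :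
    fourierMeasure (approxMeasure p N) s = 0 := by
  rw [fourierMeasure, (constOnBalls_stdChar hs).integral_approxMeasure_eq hN hw]
  have h := setIntegral_closedBall_stdChar_of_lt (x := s) (k := 0) (by simpa using h1)
  simpa only [zpow_zero, mul_comm] using h

end ApproxMeasure

section FourierDecay

open scoped FourierTransform

theorem norm_geom_sum_fourierChar_le {θ : ℝ} (hθ : θ ≠ 0) (hθ' : |θ| ≤ 1 / 2) (R : ℕ) :
    ‖∑ r ∈ Finset.range R, (𝐞 θ : ℂ) ^ r‖ ≤ 1 / (2 * |θ|) := by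
  have hpos : 0 < |θ| := abs_pos.2 hθ
  have hgap : 4 * |θ| ≤ ‖(𝐞 θ : ℂ) - 1‖ := by
    have hsin := Real.mul_abs_le_abs_sin (x := Real.pi * θ) (by
      rw [abs_mul, abs_of_pos Real.pi_pos]
      nlinarith [Real.pi_pos])
    rw [abs_mul, abs_of_pos Real.pi_pos] at hsin
    rw [Real.fourierChar_apply, mul_comm _ Complex.I, Complex.norm_exp_I_mul_ofReal_sub_one,
      Real.norm_eq_abs, abs_mul, abs_two, show 2 * Real.pi * θ / 2 = Real.pi * θ by ring]
    calc 4 * |θ| = 2 * (2 / Real.pi * (Real.pi * |θ|)) := by field_simp; norm_num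
      _ ≤ 2 * |Real.sin (Real.pi * θ)| := by gcongr
  have hne : (𝐞 θ : ℂ) ≠ 1 := fun h => by
    rw [h, sub_self, norm_zero] at hgap
    linarith
  have hnum : ‖(𝐞 θ : ℂ) ^ R - 1‖ ≤ 2 := by
    refine (norm_sub_le _ _).trans ?_
    rw [norm_pow, Circle.norm_coe, one_pow, norm_one, one_add_one_eq_two]
  rw [geom_sum_eq hne, norm_div]
  calc ‖(𝐞 θ : ℂ) ^ R - 1‖ / ‖(𝐞 θ : ℂ) - 1‖ ≤ 2 / (4 * |θ|) := by gcongr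
    _ = 1 / (2 * |θ|) := by field_simp; norm_num

theorem norm_sq_geom_sum_fourierChar_le {θ t K : ℝ} {R : ℕ} (hθ : |θ| ≤ 1 / 2) (hR : R ≤ K)
    (ht : |t| - 1 ≤ |θ| * K) :
    ‖∑ r ∈ Finset.range R, (𝐞 θ : ℂ) ^ r‖ ^ 2 ≤ 4 * K ^ 2 * (1 / (1 + t ^ 2)) := by
  rw [mul_one_div, le_div_iff₀ (by positivity), ← sq_abs t]
  have hK : 0 ≤ K := (Nat.cast_nonneg R).trans hR
  rcases le_or_gt |t| (3 / 2) with hsmall | hlarge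
  · have htriv : ‖∑ r ∈ Finset.range R, (𝐞 θ : ℂ) ^ r‖ ≤ K := by
      refine (norm_sum_le _ _).trans ?_
      simpa only [norm_pow, Circle.norm_coe, one_pow, Finset.sum_const, Finset.card_range,
        nsmul_eq_mul, mul_one] using hR
    calc ‖∑ r ∈ Finset.range R, (𝐞 θ : ℂ) ^ r‖ ^ 2 * (1 + |t| ^ 2) ≤ K ^ 2 * 4 := by
          gcongr
          nlinarith [abs_nonneg t]
      _ = 4 * K ^ 2 := mul_comm _ _
  · have hθ0 : 0 < |θ| := by
      by_contra! h
      linarith [mul_nonpos_of_nonpos_of_nonneg h hK]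
    have hgeom : ‖∑ r ∈ Finset.range R, (𝐞 θ : ℂ) ^ r‖ * (2 * (|t| - 1)) ≤ K := by
      calc ‖∑ r ∈ Finset.range R, (𝐞 θ : ℂ) ^ r‖ * (2 * (|t| - 1))
          ≤ 1 / (2 * |θ|) * (2 * (|θ| * K)) := by
            gcongr
            · linarith
            · exact norm_geom_sum_fourierChar_le (abs_pos.1 hθ0) hθ R
        _ = K := by field_simp
    calc ‖∑ r ∈ Finset.range R, (𝐞 θ : ℂ) ^ r‖ ^ 2 * (1 + |t| ^ 2)
        ≤ ‖∑ r ∈ Finset.range R, (𝐞 θ : ℂ) ^ r‖ ^ 2 * (4 * (2 * (|t| - 1)) ^ 2) := by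
          gcongr
          nlinarith
      _ = 4 * (‖∑ r ∈ Finset.range R, (𝐞 θ : ℂ) ^ r‖ * (2 * (|t| - 1))) ^ 2 := by ring
      _ ≤ 4 * K ^ 2 := by
          have : 0 ≤ |t| - 1 := by linarith
          gcongr

theorem stdChar_natCast_div_mul {q r m : ℕ} {s : ℚ_[p]} {a j t : ℤ} (hq : ‖(q : ℚ_[p])‖ = 1)
    (hs : ‖s - a / (p : ℚ_[p]) ^ m‖ ≤ 1) (hjt : j * q = a + p ^ m * t) :
    stdChar ((r : ℚ_[p]) / (q : ℚ_[p]) * s) = (𝐞 (j / (p : ℝ) ^ m) : ℂ) ^ r := by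
  have hp := prime_padic_ne_zero p
  have hq0 : (q : ℚ_[p]) ≠ 0 := norm_ne_zero_iff.1 (by simp [hq])
  have ha : (a : ℚ_[p]) = j * q - p ^ m * t := by
    rw [eq_sub_iff_add_eq]
    exact_mod_cast hjt.symm
  have hdiff : (r : ℚ_[p]) / q * s - (r * j : ℤ) / (p : ℚ_[p]) ^ m =
      r / q * ((s - a / (p : ℚ_[p]) ^ m) - t) := by
    rw [ha]; push_cast; field_simp; ring
  rw [stdChar_eq_fourierChar (p := p) (z := r * j) (m := m), ← Circle.coe_pow,
    ← AddChar.map_nsmul_eq_pow]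
  · simp [mul_div_assoc]
  · rw [hdiff, norm_mul, norm_div, hq, div_one]
    exact mul_le_one₀ (IsUltrametricDist.norm_natCast_le_one _ r) (norm_nonneg _)
      (norm_sub_le_of_le hs (Padic.norm_int_le_one t))

theorem exists_small_mul_eq_add {b q : ℕ} (hb : 0 < b) (hq : b.Coprime q) (a : ℤ) :
    ∃ j t : ℤ, j * q = a + b * t ∧ 2 * |j| ≤ b := by
  obtain ⟨u, v, huv⟩ := Nat.isCoprime_iff_coprime.2 hq
  obtain ⟨k, hk⟩ : (b : ℤ) ∣ Int.bmod (a * v) b - a * v := Int.dvd_bmod_sub_self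
  refine ⟨Int.bmod (a * v) b, k * q - a * u, by linear_combination (q : ℤ) * hk + a * huv, ?_⟩
  have hlow := Int.le_bmod (x := a * v) hb
  have hup := Int.bmod_le (x := a * v) hb
  rcases abs_cases (Int.bmod (a * v) b) with ⟨h, _⟩ | ⟨h, _⟩ <;> omega

theorem exists_nat_not_dvd_norm_sub_div_le {m : ℕ} (hm : m ≠ 0) {s : ℚ_[p]}
    (hs : ‖s‖ = (p : ℝ) ^ m) :
    ∃ a < p ^ m, ¬ p ∣ a ∧ ‖s - a / (p : ℚ_[p]) ^ m‖ ≤ 1 := by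
  obtain ⟨a, ha, hsa⟩ := exists_nat_norm_sub_div_le hs.le
  refine ⟨a, ha, fun hdvd => ?_, hsa⟩
  have hpow := pow_pos (prime_real_pos p) m
  have hquot : ‖(a : ℚ_[p]) / (p : ℚ_[p]) ^ m‖ < (p : ℝ) ^ m := by
    rw [norm_div, Padic.norm_p_pow, zpow_neg, zpow_natCast, div_inv_eq_mul]
    exact mul_lt_of_lt_one_left hpow (Padic.norm_natCast_lt_one_iff.2 hdvd)
  have hsmall := hsa.trans_lt (one_lt_pow₀ (one_lt_prime_real p) hm)
  have hlt := (IsUltrametricDist.norm_add_le_max _ _).trans_lt (max_lt hsmall hquot)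
  rw [sub_add_cancel, hs] at hlt
  exact lt_irrefl _ hlt

theorem mul_card_filter_window_le {N m : ℕ} (hm : m ≠ 0) {a : ℤ} (ha : ¬ (p : ℤ) ∣ a)
    {j t : ℕ → ℤ} (hjt : ∀ q ∈ window p N, j q * q = a + p ^ m * t q)
    (hj : ∀ q ∈ window p N, 2 * |j q| ≤ p ^ m) (u : ℤ) :
    N * {q ∈ window p N | t q = u}.card ≤ m + (N + 4) := by
  have hnat : ∀ q ∈ window p N, t q = u → (a + p ^ m * u).natAbs = (j q).natAbs * q :=
    fun q hq hu => by rw [← hu, ← hjt q hq, Int.natAbs_mul, Int.natAbs_natCast]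
  rcases Finset.eq_empty_or_nonempty {q ∈ window p N | t q = u} with h | ⟨q₀, hq₀⟩
  · simp [h]
  rw [Finset.mem_filter] at hq₀
  refine card_mul_le_of_primes_dvd (v := (a + p ^ m * u).natAbs) (Fact.out : p.Prime).one_lt
    ?_ ?_ fun q hq => ?_
  · rw [Int.natAbs_ne_zero]
    intro h0
    exact ha ((dvd_add_left ((dvd_pow_self _ hm).mul_right _)).1 (h0 ▸ dvd_zero _))
  · rw [hnat q₀ hq₀.1 hq₀.2, pow_add]
    refine Nat.mul_le_mul ?_ (mem_window.1 hq₀.1).1.2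
    have := hj q₀ hq₀.1
    zify
    linarith [abs_nonneg (j q₀)]
  · obtain ⟨hqw, hqu⟩ := Finset.mem_filter.1 hq
    have hq' := mem_window.1 hqw
    exact ⟨hq'.2, by omega, hnat q hqw hqu ▸ Nat.dvd_mul_left _ _⟩

theorem sum_comp_le_mul_tsum {ι κ : Type*} [DecidableEq κ] {s : Finset ι} {t : ι → κ} {w : κ → ℝ}
    {K : ℝ} (hw : Summable w) (hw0 : ∀ u, 0 ≤ w u)
    (hK : ∀ u, ({i ∈ s | t i = u}.card : ℝ) ≤ K) : ∑ i ∈ s, w (t i) ≤ K * ∑' u, w u := by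
  calc ∑ i ∈ s, w (t i) = ∑ u ∈ s.image t, {i ∈ s | t i = u}.card • w u := Finset.sum_comp w t
    _ ≤ ∑ u ∈ s.image t, K * w u := Finset.sum_le_sum fun u _ => by
        rw [nsmul_eq_mul]
        exact mul_le_mul_of_nonneg_right (hK u) (hw0 u)
    _ ≤ ∑' u, K * w u := (hw.mul_left K).sum_le_tsum _ fun u _ =>
        mul_nonneg ((Nat.cast_nonneg _).trans (hK u)) (hw0 u)
    _ = K * ∑' u, w u := tsum_mul_left

theorem summable_one_div_one_add_sq : Summable fun t : ℤ => 1 / (1 + (t : ℝ) ^ 2) := by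
  refine Summable.of_norm_bounded_eventually
    ((Real.summable_one_div_int_pow (p := 2)).2 one_lt_two) ?_
  filter_upwards [(Set.finite_singleton (0 : ℤ)).compl_mem_cofinite] with t ht
  have ht0 : (t : ℝ) ≠ 0 := Int.cast_ne_zero.2 ht
  rw [Real.norm_of_nonneg (by positivity)]
  gcongr
  linarith

theorem norm_fourierMeasure_approxMeasure_le_sum {N : ℕ} (hN : 1 ≤ N) {m : ℕ} {s : ℚ_[p]} {a : ℤ}
    (hs : ‖s - a / (p : ℚ_[p]) ^ m‖ ≤ 1) {j t : ℕ → ℤ}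
    (hjt : ∀ q ∈ window p N, j q * q = a + p ^ m * t q) :
    ‖fourierMeasure (approxMeasure p N) s‖ ≤ ((triples p N).card : ℝ)⁻¹ *
      ∑ q ∈ window p N, ‖∑ r ∈ Finset.range (p ^ N), (𝐞 (j q / (p : ℝ) ^ m) : ℂ) ^ r‖ ^ 2 := by
  rw [fourierMeasure, integral_approxMeasure, norm_smul, Real.norm_of_nonneg (by positivity),
    triples, Finset.sum_product]
  gcongr
  refine (norm_sum_le _ _).trans (Finset.sum_le_sum fun q hq => ?_)
  set ω : ℂ := ↑(𝐞 (j q / (p : ℝ) ^ m))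
  have hfactor : ∑ y ∈ Finset.range (p ^ N) ×ˢ Finset.range (p ^ N),
      stdChar (ratPoint p (q, y) * s) = ω * (∑ r ∈ Finset.range (p ^ N), ω ^ r) ^ 2 := by
    rw [sq, Finset.sum_mul_sum, ← Finset.sum_product', Finset.mul_sum]
    refine Finset.sum_congr rfl fun y _ => ?_
    rw [ratPoint, stdChar_natCast_div_mul (norm_natCast_window hN hq) hs (hjt q hq), pow_add,
      pow_add, pow_one, mul_assoc]
  rw [hfactor, norm_mul, Circle.norm_coe, one_mul, norm_pow]

theorem abs_sub_one_le_of_mul_eq_add {j q a b t Q : ℝ} (hb : 0 < b) (hq : |q| ≤ Q) (ha : |a| ≤ b)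
    (h : j * q = a + b * t) : |t| - 1 ≤ |j / b| * Q := by
  have htri : b * |t| ≤ |j| * |q| + |a| := by
    calc b * |t| = |j * q - a| := by rw [h, add_sub_cancel_left, abs_mul, abs_of_pos hb]
      _ ≤ |j| * |q| + |a| := (abs_sub _ _).trans_eq (by rw [abs_mul])
  rw [abs_div, abs_of_pos hb, div_mul_eq_mul_div, le_div_iff₀ hb]
  nlinarith [mul_le_mul_of_nonneg_left hq (abs_nonneg j)]

theorem exists_window_inverse {N : ℕ} (hN : 1 ≤ N) (a : ℤ) (m : ℕ) :
    ∃ j t : ℕ → ℤ, ∀ q ∈ window p N, j q * q = a + p ^ m * t q ∧ 2 * |j q| ≤ p ^ m := by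
  have hjt : ∀ q : ℕ, ∃ j t : ℤ, q ∈ window p N →
      j * q = a + p ^ m * t ∧ 2 * |j| ≤ p ^ m := fun q => by
    by_cases hq : q ∈ window p N
    · have hpq := (Padic.norm_natCast_eq_one_iff.1 (norm_natCast_window hN hq)).pow_left m
      obtain ⟨j, t, h⟩ := exists_small_mul_eq_add (pow_pos (Fact.out : p.Prime).pos m) hpq a
      exact ⟨j, t, fun _ => mod_cast h⟩
    · exact ⟨0, 0, fun h => absurd h hq⟩
  choose j t hjt using hjt
  exact ⟨j, t, hjt⟩

-- The geometric sum for `q` is controlled by `t q`, and few `q` share a value of `t q`, because all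
-- of them divide the nonzero integer `a + p ^ m * t q`.
theorem sum_window_norm_sq_geom_sum_le {N m : ℕ} (hN : 1 ≤ N) (hm : N < m) {a : ℤ}
    (ha : |a| ≤ p ^ m) (hpa : ¬ (p : ℤ) ∣ a) {j t : ℕ → ℤ}
    (hjt : ∀ q ∈ window p N, j q * q = a + p ^ m * t q)
    (hj : ∀ q ∈ window p N, 2 * |j q| ≤ p ^ m) :
    ∑ q ∈ window p N, ‖∑ r ∈ Finset.range (p ^ N), (𝐞 (j q / (p : ℝ) ^ m) : ℂ) ^ r‖ ^ 2 ≤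
      4 * ((p : ℝ) ^ (N + 4)) ^ 2 * (6 * m / N * ∑' u : ℤ, 1 / (1 + (u : ℝ) ^ 2)) := by
  have hpm : 0 < (p : ℝ) ^ m := pow_pos (prime_real_pos p) m
  have hfibre (u : ℤ) : ({q ∈ window p N | t q = u}.card : ℝ) ≤ 6 * m / N := by
    have h := mul_card_filter_window_le (by omega) hpa hjt hj u
    rw [le_div_iff₀ (mod_cast hN), mul_comm]
    exact_mod_cast h.trans (by omega : m + (N + 4) ≤ 6 * m)
  have hterm : ∀ q ∈ window p N,
      ‖∑ r ∈ Finset.range (p ^ N), (𝐞 (j q / (p : ℝ) ^ m) : ℂ) ^ r‖ ^ 2 ≤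
        4 * ((p : ℝ) ^ (N + 4)) ^ 2 * (1 / (1 + (t q : ℝ) ^ 2)) := fun q hq => by
    refine norm_sq_geom_sum_fourierChar_le ?_ ?_ (abs_sub_one_le_of_mul_eq_add (q := q) (a := a)
      hpm ?_ ?_ (mod_cast hjt q hq))
    · rw [abs_div, abs_of_pos hpm, div_le_iff₀ hpm]
      have : 2 * |(j q : ℝ)| ≤ (p : ℝ) ^ m := mod_cast hj q hq
      linarith
    · exact_mod_cast Nat.pow_le_pow_right (Fact.out : p.Prime).pos (Nat.le_add_right N 4)
    · exact_mod_cast (mem_window.1 hq).1.2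
    · exact_mod_cast ha
  refine (Finset.sum_le_sum hterm).trans ?_
  rw [← Finset.mul_sum]
  gcongr
  exact sum_comp_le_mul_tsum (w := fun u : ℤ => 1 / (1 + (u : ℝ) ^ 2)) summable_one_div_one_add_sq
    (fun u => by positivity) hfibre

/-- The constant in the Fourier decay of `approxMeasure`, when the window contains at least
`c p ^ N / N` primes. -/
noncomputable def decayConst (p : ℕ) (c : ℝ) : ℝ :=
  24 * (p : ℝ) ^ 8 * (∑' t : ℤ, 1 / (1 + (t : ℝ) ^ 2)) / c

theorem norm_fourierMeasure_approxMeasure_le {N : ℕ} (hN : 1 ≤ N) {c : ℝ} (hc : 0 < c)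
    (hw : c * (p : ℝ) ^ N / N ≤ (window p N).card) {m : ℕ} (hm : N < m) {s : ℚ_[p]}
    (hs : ‖s‖ = (p : ℝ) ^ m) :
    ‖fourierMeasure (approxMeasure p N) s‖ ≤ decayConst p c * m * (p : ℝ) ^ (-(N : ℤ)) := by
  have hpp := prime_real_pos p
  obtain ⟨a, ha, hpa, hsa⟩ := exists_nat_not_dvd_norm_sub_div_le (by omega) hs
  obtain ⟨j, t, hjt⟩ := exists_window_inverse (p := p) hN a m
  have : (0 : ℝ) < N := mod_cast hN
  set S := ∑' u : ℤ, 1 / (1 + (u : ℝ) ^ 2) with hS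
  have : 0 ≤ S := tsum_nonneg fun u => by positivity
  calc ‖fourierMeasure (approxMeasure p N) s‖
      ≤ ((triples p N).card : ℝ)⁻¹ * ∑ q ∈ window p N,
          ‖∑ r ∈ Finset.range (p ^ N), (𝐞 (j q / (p : ℝ) ^ m) : ℂ) ^ r‖ ^ 2 :=
        norm_fourierMeasure_approxMeasure_le_sum hN (by rwa [Int.cast_natCast])
          fun q hq => (hjt q hq).1
    _ ≤ (c * (p : ℝ) ^ N / N * ((p : ℝ) ^ N * (p : ℝ) ^ N))⁻¹ *
          (4 * ((p : ℝ) ^ (N + 4)) ^ 2 * (6 * m / N * S)) := by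
        rw [card_triples]
        push_cast
        gcongr
        exact sum_window_norm_sq_geom_sum_le hN hm (by rw [Nat.abs_cast]; exact_mod_cast ha.le)
          (mod_cast hpa) (fun q hq => (hjt q hq).1) fun q hq => (hjt q hq).2
    _ = decayConst p c * m * (p : ℝ) ^ (-(N : ℤ)) := by
        rw [decayConst, ← hS, zpow_neg, zpow_natCast]
        field_simp
        ring

end FourierDecay

section BallCounting

theorem card_le_one_add_inv_of_separated {ι : Type*} {S : Finset ι} {f : ι → ℝ} {δ : ℝ}
    (hδ : 0 < δ) (h01 : ∀ i ∈ S, 0 ≤ f i ∧ f i ≤ 1)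
    (hsep : ∀ i ∈ S, ∀ j ∈ S, i ≠ j → δ ≤ |f i - f j|) : (S.card : ℝ) ≤ 1 + 1 / δ := by
  have hmaps : Set.MapsTo (fun i => ⌊f i / δ⌋₊) S (Finset.range (⌊1 / δ⌋₊ + 1)) := fun i hi => by
    rw [Finset.mem_coe, Finset.mem_range, Nat.lt_succ_iff]
    exact Nat.floor_le_floor (div_le_div_of_nonneg_right (h01 i hi).2 hδ.le)
  have hinj : Set.InjOn (fun i => ⌊f i / δ⌋₊) S := fun i hi j hj hij => by
    by_contra hne
    have hlt : |f i / δ - f j / δ| < 1 := Int.abs_sub_lt_one_of_floor_eq_floor <| by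
      rw [← Int.natCast_floor_eq_floor (div_nonneg (h01 i hi).1 hδ.le),
        ← Int.natCast_floor_eq_floor (div_nonneg (h01 j hj).1 hδ.le)]
      exact congrArg Nat.cast hij
    rw [← sub_div, abs_div, abs_of_pos hδ, div_lt_one hδ] at hlt
    exact (hsep i hi j hj hne).not_gt hlt
  have hcard := Finset.card_le_card_of_injOn _ hmaps hinj
  rw [Finset.card_range] at hcard
  have hfloor := Nat.floor_le (one_div_pos.2 hδ).le
  have : (S.card : ℝ) ≤ ⌊1 / δ⌋₊ + 1 := mod_cast hcard
  linarith

theorem prod_ext_of_mul_eq_mul_of_mem_window {p N q q' r r' : ℕ} (hq : q ∈ window p N)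
    (hq' : q' ∈ window p N) (hr : 0 < r) (hrq : r < q) (h : r * q' = r' * q) :
    (q, r) = (q', r') := by
  have hpq := (mem_window.1 hq).2
  obtain hdvd | hdvd := hpq.dvd_mul.1 (Dvd.intro_left r' h.symm)
  · exact absurd (Nat.le_of_dvd hr hdvd) (by omega)
  · obtain rfl := (Nat.prime_dvd_prime_iff_eq hpq (mem_window.1 hq').2).1 hdvd
    rw [Nat.eq_of_mul_eq_mul_right hpq.pos h]

theorem inv_le_abs_div_sub_div {q q' r r' b Q : ℕ} (hq : 0 < q) (hq' : 0 < q') (hqQ : q ≤ Q)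
    (hqQ' : q' ≤ Q) (hne : r * q' ≠ r' * q) (hdvd : (b : ℤ) ∣ r * q' - r' * q) :
    (b : ℝ) / Q ^ 2 ≤ |(r : ℝ) / q - r' / q'| := by
  have hsub : (r * q' - r' * q : ℤ) ≠ 0 := sub_ne_zero.2 (mod_cast hne)
  have hge : (b : ℝ) ≤ |(r * q' - r' * q : ℝ)| := by
    have h := Int.le_of_dvd (abs_pos.2 hsub) ((dvd_abs _ _).2 hdvd)
    exact_mod_cast h
  have hqr : (0 : ℝ) < q := mod_cast hq
  have hqr' : (0 : ℝ) < q' := mod_cast hq'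
  have heq : (r : ℝ) / q - r' / q' = (r * q' - r' * q) / (q * q') := by field_simp
  rw [heq, abs_div, abs_of_pos (mul_pos hqr hqr'), sq]
  gcongr

-- Two such fractions in one `p`-adic ball have `p ^ m` dividing the numerator of their difference,
-- so they are far apart in `[0, 1]` for the real absolute value.
theorem card_pairs_le {N m : ℕ} (hN : 1 ≤ N) {x : ℚ_[p]} {F : Finset (ℕ × ℕ)}
    (hF : ∀ z ∈ F, z.1 ∈ window p N ∧ 0 < z.2 ∧ z.2 < z.1 ∧
      ‖(z.2 : ℚ_[p]) / z.1 - x‖ ≤ (p : ℝ) ^ (-(m : ℤ))) :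
    (F.card : ℝ) ≤ 1 + ((p : ℝ) ^ (N + 4)) ^ 2 / (p : ℝ) ^ m := by
  have hpp := prime_real_pos p
  rw [← one_div_div]
  refine card_le_one_add_inv_of_separated (f := fun z => (z.2 : ℝ) / z.1) (by positivity) ?_ ?_
  · intro z hz
    obtain ⟨-, -, hlt, -⟩ := hF z hz
    exact ⟨by positivity, div_le_one_of_le₀ (mod_cast hlt.le) (Nat.cast_nonneg _)⟩
  · rintro ⟨q, r⟩ hz ⟨q', r'⟩ hz' hne
    obtain ⟨hq, hr, hrq, hx⟩ := hF _ hz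
    obtain ⟨hq', -, -, hx'⟩ := hF _ hz'
    have hdvd : (p : ℤ) ^ m ∣ r * q' - r' * q := by
      have hq0 := natCast_window_ne_zero hq
      have hq0' := natCast_window_ne_zero hq'
      have heq : (r : ℚ_[p]) / q - x - (r' / q' - x) = (r * q' - r' * q : ℤ) / (q * q') := by
        push_cast; field_simp; ring
      have hdist := norm_sub_le_of_le hx hx'
      rwa [heq, norm_div, norm_mul, norm_natCast_window hN hq, norm_natCast_window hN hq', mul_one,
        div_one, Padic.norm_int_le_pow_iff_dvd] at hdist
    exact_mod_cast inv_le_abs_div_sub_div (mem_window.1 hq).2.pos (mem_window.1 hq').2.pos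
      (mem_window.1 hq).1.2 (mem_window.1 hq').1.2
      (fun h => hne (prod_ext_of_mul_eq_mul_of_mem_window hq hq' hr hrq h)) (mod_cast hdvd)

open Classical in
theorem card_filter_ratPoint_mem_closedBall_le {N : ℕ} (hN : 1 ≤ N) (x : ℚ_[p]) (m : ℕ) :
    ({z ∈ triples p N | ratPoint p z ∈ Metric.closedBall x ((p : ℝ) ^ (-(m : ℤ)))}.card : ℝ) ≤
      (p : ℝ) ^ N * (1 + ((p : ℝ) ^ (N + 4)) ^ 2 / (p : ℝ) ^ m) := by
  set T := {z ∈ triples p N | ratPoint p z ∈ Metric.closedBall x ((p : ℝ) ^ (-(m : ℤ)))}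
  set g : ℕ × ℕ × ℕ → ℕ × ℕ := fun z => (z.1, 1 + z.2.1 + z.2.2)
  have hfibre : T.card ≤ p ^ N * (T.image g).card := by
    refine Finset.card_le_mul_card_image _ _ fun y _ => ?_
    rw [← Finset.card_range (p ^ N)]
    refine Finset.card_le_card_of_injOn (fun z => z.2.1) (fun z hz => ?_) ?_
    · have hz' := Finset.mem_filter.1 (Finset.mem_filter.1 (Finset.mem_coe.1 hz)).1
      exact Finset.mem_coe.2 (Finset.mem_range.2 (mem_triples.1 hz'.1).2.1)
    · rintro ⟨q, a, b⟩ hz ⟨q', a', b'⟩ hz' haa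
      have hgg := (Finset.mem_filter.1 hz).2.trans (Finset.mem_filter.1 hz').2.symm
      simp only [g, Prod.mk.injEq] at hgg haa ⊢
      omega
  have hpairs : ((T.image g).card : ℝ) ≤ 1 + ((p : ℝ) ^ (N + 4)) ^ 2 / (p : ℝ) ^ m := by
    refine card_pairs_le hN (x := x) fun y hy => ?_
    obtain ⟨z, hz, rfl⟩ := Finset.mem_image.1 hy
    obtain ⟨hzt, hzx⟩ := Finset.mem_filter.1 hz
    have hz1 := mem_triples.1 hzt
    have hz2 := mem_window.1 hz1.1
    exact ⟨hz1.1, by simp only [g]; omega, by simp only [g]; omega, mem_closedBall_iff_norm.1 hzx⟩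
  calc (T.card : ℝ) ≤ (p : ℝ) ^ N * (T.image g).card := mod_cast hfibre
    _ ≤ _ := by gcongr

theorem approxMeasure_closedBall_le {N : ℕ} (hN : 1 ≤ N) {c : ℝ} (hc : 0 < c)
    (hw : c * (p : ℝ) ^ N / N ≤ (window p N).card) (x : ℚ_[p]) (m : ℕ) :
    (approxMeasure p N).real (Metric.closedBall x ((p : ℝ) ^ (-(m : ℤ)))) ≤
      (p : ℝ) ^ 8 / c * N * (((p : ℝ) ^ (2 * N))⁻¹ + ((p : ℝ) ^ m)⁻¹) := by
  classical
  have hpp := prime_real_pos p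
  have : (0 : ℝ) < N := mod_cast hN
  have hp8 : (1 : ℝ) ≤ (p : ℝ) ^ 8 := one_le_pow₀ (one_lt_prime_real p).le
  rw [approxMeasure_real_apply N measurableSet_closedBall, card_triples]
  push_cast
  calc _ ≤ (c * (p : ℝ) ^ N / N * ((p : ℝ) ^ N * (p : ℝ) ^ N))⁻¹ *
        ((p : ℝ) ^ N * ((p : ℝ) ^ 8 + ((p : ℝ) ^ (N + 4)) ^ 2 / (p : ℝ) ^ m)) := by
        gcongr
        exact (card_filter_ratPoint_mem_closedBall_le hN x m).trans (by gcongr)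
    _ = _ := by
        field_simp
        ring

end BallCounting

section FourierMeasure

theorem integrable_stdChar_comp {α : Type*} [MeasurableSpace α] (ν : Measure α)
    [IsFiniteMeasure ν] {g : α → ℚ_[p]} (hg : Measurable g) :
    Integrable (fun a => stdChar (g a)) ν :=
  Integrable.of_bound (continuous_stdChar.measurable.comp hg).aestronglyMeasurable 1
    (.of_forall fun _ => (norm_stdChar _).le)

theorem norm_fourierMeasure_le (ν : Measure ℚ_[p]) [IsFiniteMeasure ν] (s : ℚ_[p]) :
    ‖fourierMeasure ν s‖ ≤ ν.real Set.univ :=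
  (norm_integral_le_of_norm_le_const (.of_forall fun _ => (norm_stdChar _).le)).trans_eq
    (one_mul _)

theorem norm_fourierMeasure_le_one (ν : Measure ℚ_[p]) [IsProbabilityMeasure ν] (s : ℚ_[p]) :
    ‖fourierMeasure ν s‖ ≤ 1 := by
  simpa using norm_fourierMeasure_le ν s

theorem continuous_fourierMeasure (ν : Measure ℚ_[p]) [IsFiniteMeasure ν] :
    Continuous (fourierMeasure ν) :=
  continuous_of_dominated (bound := fun _ => 1)
    (fun s => (continuous_stdChar.comp (continuous_mul_const s)).aestronglyMeasurable)
    (fun _ => .of_forall fun _ => (norm_stdChar _).le) (integrable_const _)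
    (.of_forall fun x => continuous_stdChar.comp (continuous_const_mul x))

theorem fourierMeasure_conv (μ ν : Measure ℚ_[p]) [IsFiniteMeasure μ] [IsFiniteMeasure ν]
    (s : ℚ_[p]) :
    fourierMeasure (μ ∗ ν) s = fourierMeasure μ s * fourierMeasure ν s := by
  rw [fourierMeasure, integral_conv (integrable_stdChar_comp _ (measurable_mul_const s))]
  simp only [add_mul, stdChar_add, integral_const_mul, integral_mul_const, fourierMeasure]

instance isFiniteMeasure_haar_restrict_closedBall (x : ℚ_[p]) (r : ℝ) :
    IsFiniteMeasure ((haar p).restrict (Metric.closedBall x r)) :=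
  isFiniteMeasure_restrict.2 (isCompact_closedBall x r).measure_lt_top.ne

theorem setIntegral_closedBall_stdChar_sub_mul (x y : ℚ_[p]) (k : ℤ) :
    ∫ t in Metric.closedBall 0 ((p : ℝ) ^ k), stdChar ((y - x) * t) ∂haar p =
      (Metric.closedBall x ((p : ℝ) ^ (-k))).indicator (fun _ => ((p : ℝ) ^ k : ℂ)) y := by
  by_cases hy : y ∈ Metric.closedBall x ((p : ℝ) ^ (-k))
  · rw [Set.indicator_of_mem hy,
      setIntegral_closedBall_stdChar_of_le (mem_closedBall_iff_norm.1 hy)]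
  · rw [Set.indicator_of_notMem hy, setIntegral_closedBall_stdChar_of_lt]
    rwa [mem_closedBall_iff_norm, not_le] at hy

theorem setIntegral_closedBall_stdChar_neg_mul_fourierMeasure (ν : Measure ℚ_[p])
    [IsFiniteMeasure ν] (x : ℚ_[p]) (k : ℤ) :
    ∫ t in Metric.closedBall 0 ((p : ℝ) ^ k), stdChar (-(x * t)) * fourierMeasure ν t ∂haar p =
      ((p : ℝ) ^ k * ν.real (Metric.closedBall x ((p : ℝ) ^ (-k))) : ℝ) := by
  calc ∫ t in Metric.closedBall 0 ((p : ℝ) ^ k), stdChar (-(x * t)) * fourierMeasure ν t ∂haar p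
      = ∫ t in Metric.closedBall 0 ((p : ℝ) ^ k), ∫ y, stdChar ((y - x) * t) ∂ν ∂haar p := by
        refine integral_congr_ae (.of_forall fun t => ?_)
        change _ * ∫ y, _ ∂ν = _
        rw [← integral_const_mul]
        congr with y
        rw [← stdChar_add]
        ring_nf
    _ = ∫ y, (Metric.closedBall x ((p : ℝ) ^ (-k))).indicator
          (fun _ => ((p : ℝ) ^ k : ℂ)) y ∂ν := by
        rw [integral_integral_swap (integrable_stdChar_comp _ (by fun_prop))]
        simp only [setIntegral_closedBall_stdChar_sub_mul]
    _ = _ := by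
        rw [integral_indicator_const _ measurableSet_closedBall, Complex.real_smul]
        push_cast
        ring

theorem conj_fourierMeasure (ν : Measure ℚ_[p]) (s : ℚ_[p]) :
    starRingEnd ℂ (fourierMeasure ν s) = ∫ x, stdChar (-(x * s)) ∂ν := by
  rw [fourierMeasure, ← integral_conj]
  simp only [stdChar_neg]

theorem setIntegral_closedBall_norm_sq_fourierMeasure (ν : Measure ℚ_[p]) [IsFiniteMeasure ν]
    (k : ℤ) :
    ∫ t in Metric.closedBall 0 ((p : ℝ) ^ k), ‖fourierMeasure ν t‖ ^ 2 ∂haar p =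
      (p : ℝ) ^ k * ∫ x, ν.real (Metric.closedBall x ((p : ℝ) ^ (-k))) ∂ν := by
  rw [← Complex.ofReal_inj, ← integral_const_mul, ← integral_complex_ofReal,
    ← integral_complex_ofReal]
  simp only [← setIntegral_closedBall_stdChar_neg_mul_fourierMeasure]
  have hint : Integrable (fun z : ℚ_[p] × ℚ_[p] => stdChar (-(z.1 * z.2)) * fourierMeasure ν z.2)
      (ν.prod ((haar p).restrict (Metric.closedBall 0 ((p : ℝ) ^ k)))) :=
    (integrable_stdChar_comp (g := fun z : ℚ_[p] × ℚ_[p] => -(z.1 * z.2)) _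
      (by fun_prop)).mul_bdd (c := ν.real Set.univ)
      ((continuous_fourierMeasure ν).comp continuous_snd).aestronglyMeasurable
      (.of_forall fun z => norm_fourierMeasure_le ν z.2)
  rw [integral_integral_swap hint]
  refine integral_congr_ae (.of_forall fun t => ?_)
  beta_reduce
  rw [integral_mul_const, ← conj_fourierMeasure, Complex.conj_mul']
  push_cast
  rfl

end FourierMeasure

section BallAverage

variable {E : Type*} [NormedAddCommGroup E]

/-- The average of `ν` over balls of radius `p ^ (-n)`: its convolution with normalised Haar
measure on the subgroup `p ^ n ℤ_p`. -/
noncomputable def ballAverage (ν : Measure ℚ_[p]) (n : ℕ) : Measure ℚ_[p] :=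
  ν ∗ ProbabilityTheory.cond (haar p) (Metric.closedBall 0 ((p : ℝ) ^ (-(n : ℤ))))

instance isProbabilityMeasure_cond_closedBall (n : ℕ) : IsProbabilityMeasure
    (ProbabilityTheory.cond (haar p) (Metric.closedBall 0 ((p : ℝ) ^ (-(n : ℤ))))) :=
  ProbabilityTheory.cond_isProbabilityMeasure_of_finite
    (Metric.measure_closedBall_pos _ _ (zpow_pos (prime_real_pos p) _)).ne'
    (isCompact_closedBall _ _).measure_lt_top.ne

instance isFiniteMeasure_ballAverage (ν : Measure ℚ_[p]) [IsFiniteMeasure ν] (n : ℕ) :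
    IsFiniteMeasure (ballAverage ν n) := by
  unfold ballAverage
  infer_instance

theorem ae_cond_closedBall_mem (n : ℕ) : ∀ᵐ y ∂ProbabilityTheory.cond (haar p)
    (Metric.closedBall 0 ((p : ℝ) ^ (-(n : ℤ)))), ‖y‖ ≤ (p : ℝ) ^ (-(n : ℤ)) := by
  filter_upwards [ProbabilityTheory.ae_cond_mem measurableSet_closedBall] with y hy
  rwa [mem_closedBall_zero_iff] at hy

theorem fourierMeasure_cond_closedBall (n : ℕ) (s : ℚ_[p]) :
    fourierMeasure (ProbabilityTheory.cond (haar p)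
      (Metric.closedBall 0 ((p : ℝ) ^ (-(n : ℤ))))) s =
      (Metric.closedBall 0 ((p : ℝ) ^ n)).indicator 1 s := by
  have hp := (prime_real_pos p).ne'
  have h := setIntegral_closedBall_stdChar_sub_mul (0 : ℚ_[p]) s (-(n : ℤ))
  rw [sub_zero, neg_neg, zpow_natCast] at h
  rw [fourierMeasure, ProbabilityTheory.cond, integral_smul_measure, haar_closedBall]
  simp only [mul_comm _ s, h]
  rw [ENNReal.toReal_inv, ENNReal.toReal_ofReal (by positivity), zpow_neg, inv_inv]
  by_cases hs : s ∈ Metric.closedBall (0 : ℚ_[p]) ((p : ℝ) ^ n)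
  · rw [Set.indicator_of_mem hs, Set.indicator_of_mem hs, Complex.real_smul, Pi.one_apply,
      ← Complex.ofReal_zpow, ← Complex.ofReal_mul, zpow_neg, zpow_natCast,
      mul_inv_cancel₀ (pow_ne_zero n hp), Complex.ofReal_one]
  · rw [Set.indicator_of_notMem hs, Set.indicator_of_notMem hs, smul_zero]

theorem fourierMeasure_ballAverage (ν : Measure ℚ_[p]) [IsFiniteMeasure ν] (n : ℕ) (s : ℚ_[p]) :
    fourierMeasure (ballAverage ν n) s =
      (Metric.closedBall 0 ((p : ℝ) ^ n)).indicator (fourierMeasure ν) s := by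
  rw [ballAverage, fourierMeasure_conv, fourierMeasure_cond_closedBall]
  by_cases hs : s ∈ Metric.closedBall (0 : ℚ_[p]) ((p : ℝ) ^ n)
  · rw [Set.indicator_of_mem hs, Set.indicator_of_mem hs, Pi.one_apply, mul_one]
  · rw [Set.indicator_of_notMem hs, Set.indicator_of_notMem hs, mul_zero]

theorem constOnBalls_real_closedBall (ν : Measure ℚ_[p]) (n : ℕ) :
    ConstOnBalls n (fun x => ν.real (Metric.closedBall x ((p : ℝ) ^ (-(n : ℤ))))) :=
  fun _ _ hxy => congrArg ν.real
    (IsUltrametricDist.closedBall_eq_of_mem (mem_closedBall_iff_norm.2 hxy)).symm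

theorem constOnBalls_measure_closedBall (ν : Measure ℚ_[p]) (n : ℕ) :
    ConstOnBalls n (fun x => ν (Metric.closedBall x ((p : ℝ) ^ (-(n : ℤ))))) :=
  fun _ _ hxy => congrArg ν
    (IsUltrametricDist.closedBall_eq_of_mem (mem_closedBall_iff_norm.2 hxy)).symm

theorem lintegral_add_cond_closedBall (n : ℕ) (G : ℚ_[p] → ℝ≥0∞) (x : ℚ_[p]) :
    ∫⁻ y, G (x + y) ∂ProbabilityTheory.cond (haar p)
      (Metric.closedBall 0 ((p : ℝ) ^ (-(n : ℤ)))) =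
      (p : ℝ≥0∞) ^ n * ∫⁻ t, (Metric.closedBall t ((p : ℝ) ^ (-(n : ℤ)))).indicator
        (fun _ => G t) x ∂haar p := by
  have hpn : (haar p (Metric.closedBall 0 ((p : ℝ) ^ (-(n : ℤ)))))⁻¹ = (p : ℝ≥0∞) ^ n := by
    rw [haar_closedBall, zpow_neg, zpow_natCast, ENNReal.ofReal_inv_of_pos
      (pow_pos (prime_real_pos p) n), inv_inv, ENNReal.ofReal_pow (prime_real_pos p).le,
      ENNReal.ofReal_natCast]
  rw [ProbabilityTheory.cond, lintegral_smul_measure, hpn,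
    ← lintegral_indicator measurableSet_closedBall, ← lintegral_add_left_eq_self
    (fun t => (Metric.closedBall t ((p : ℝ) ^ (-(n : ℤ)))).indicator (fun _ => G t) x) x]
  refine congrArg _ (lintegral_congr fun y => ?_)
  simp only [Set.indicator, mem_closedBall_iff_norm, sub_zero, sub_add_cancel_left, norm_neg]

theorem ballAverage_eq_withDensity (ν : Measure ℚ_[p]) [IsFiniteMeasure ν] (n : ℕ) :
    ballAverage ν n = (haar p).withDensity
      fun x => (p : ℝ≥0∞) ^ n * ν (Metric.closedBall x ((p : ℝ) ^ (-(n : ℤ)))) := by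
  refine Measure.ext_of_lintegral _ fun G hG => ?_
  have hdens := (constOnBalls_measure_closedBall ν n).continuous.measurable.const_mul
    ((p : ℝ≥0∞) ^ n)
  have hjoint : Measurable fun z : ℚ_[p] × ℚ_[p] =>
      (Metric.closedBall z.2 ((p : ℝ) ^ (-(n : ℤ)))).indicator (fun _ => G z.2) z.1 :=
    (hG.comp measurable_snd).indicator
      (measurableSet_le (measurable_fst.dist measurable_snd) measurable_const)
  rw [ballAverage, Measure.lintegral_conv hG, lintegral_withDensity_eq_lintegral_mul _ hdens hG]
  simp only [lintegral_add_cond_closedBall, Pi.mul_apply]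
  rw [lintegral_const_mul _ hjoint.lintegral_prod_right', lintegral_lintegral_swap
    hjoint.aemeasurable, ← lintegral_const_mul _ hjoint.lintegral_prod_left']
  refine lintegral_congr fun t => ?_
  simp only [lintegral_indicator_const measurableSet_closedBall]
  ring

variable [NormedSpace ℝ E]

theorem ConstOnBalls.integral_smoothing [CompleteSpace E] (ν : Measure ℚ_[p]) [IsFiniteMeasure ν]
    {n : ℕ} {φ : ℚ_[p] → E} (h : ConstOnBalls n φ) (hν : Integrable φ ν) :
    ∫ x, ((p : ℝ) ^ n * ν.real (Metric.closedBall x ((p : ℝ) ^ (-(n : ℤ))))) • φ x ∂haar p =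
      ∫ x, φ x ∂ν := by
  have hshift (x : ℚ_[p]) : ∀ᵐ y ∂ProbabilityTheory.cond (haar p)
      (Metric.closedBall 0 ((p : ℝ) ^ (-(n : ℤ)))), φ (x + y) = φ x := by
    filter_upwards [ae_cond_closedBall_mem n] with y hy
    exact h x (x + y) (by rwa [add_sub_cancel_left])
  have hnorm (x : ℚ_[p]) : ∫ y, ‖φ (x + y)‖ ∂ProbabilityTheory.cond (haar p)
      (Metric.closedBall 0 ((p : ℝ) ^ (-(n : ℤ)))) = ‖φ x‖ := by
    rw [integral_congr_ae ((hshift x).mono fun y hy => congrArg norm hy), integral_const,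
      probReal_univ, one_smul]
  have hint : Integrable φ (ballAverage ν n) := by
    refine (integrable_conv_iff h.continuous.aestronglyMeasurable).2 ⟨.of_forall fun x => ?_, ?_⟩
    · exact (integrable_const (φ x)).congr ((hshift x).mono fun _ hy => hy.symm)
    · simpa only [hnorm] using hν.norm
  calc ∫ x, ((p : ℝ) ^ n * ν.real (Metric.closedBall x ((p : ℝ) ^ (-(n : ℤ))))) • φ x ∂haar p
      = ∫ x, φ x ∂ballAverage ν n := by
        rw [ballAverage_eq_withDensity, integral_withDensity_eq_integral_toReal_smul
          ((constOnBalls_measure_closedBall ν n).continuous.measurable.const_mul _)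
          (.of_forall fun x => ENNReal.mul_lt_top (by simp) (measure_lt_top _ _))]
        simp [Measure.real]
    _ = ∫ x, φ x ∂ν := by
        rw [ballAverage, integral_conv hint]
        refine integral_congr_ae (.of_forall fun x => ?_)
        beta_reduce
        rw [integral_congr_ae (hshift x), integral_const, probReal_univ, one_smul]

end BallAverage

section ConstOnBalls

variable {E : Type*} [NormedAddCommGroup E]

theorem ConstOnBalls.smul [NormedSpace ℝ E] {n : ℕ} {h : ℚ_[p] → ℝ} {φ : ℚ_[p] → E}
    (hh : ConstOnBalls n h) (hφ : ConstOnBalls n φ) : ConstOnBalls n fun x => h x • φ x :=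
  fun x y hxy => by beta_reduce; rw [hh x y hxy, hφ x y hxy]

theorem ConstOnBalls.indicator_const {n : ℕ} {A : Set ℚ_[p]} (hA : ConstOnBalls n (· ∈ A)) (b : E) :
    ConstOnBalls n (A.indicator fun _ => b) := fun x y hxy =>
  Set.indicator_const_eq_indicator_const (iff_of_eq (hA x y hxy))

theorem ConstOnBalls.isClopen {n : ℕ} {A : Set ℚ_[p]} (hA : ConstOnBalls n (· ∈ A)) :
    IsClopen A :=
  have hcompl : ConstOnBalls n (· ∈ Aᶜ) := fun x y hxy => congrArg Not (hA x y hxy)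
  ⟨isOpen_compl_iff.1 (isOpen_iff_continuous_mem.2 hcompl.continuous),
    isOpen_iff_continuous_mem.2 hA.continuous⟩

theorem ConstOnBalls.measurableSet {n : ℕ} {A : Set ℚ_[p]} (hA : ConstOnBalls n (· ∈ A)) :
    MeasurableSet A := hA.isClopen.isOpen.measurableSet

theorem constOnBalls_mem_closedBall {m n : ℕ} (hmn : m ≤ n) (x : ℚ_[p]) :
    ConstOnBalls n (· ∈ Metric.closedBall x ((p : ℝ) ^ (-(m : ℤ)))) := by
  refine ConstOnBalls.mono (fun y z hyz => propext ?_) hmn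
  simp only [mem_closedBall_iff_norm]
  constructor <;> intro h
  · simpa using norm_sub_le_of_le h hyz
  · simpa using norm_add_le_of_le h hyz

theorem integrable_approxMeasure {N : ℕ} (hw : (window p N).Nonempty) (φ : ℚ_[p] → E) :
    Integrable φ (approxMeasure p N) := by
  have hcard : ((triples p N).card : ℝ≥0∞) ≠ 0 := by
    have := (Fact.out : p.Prime).ne_zero
    rw [card_triples]
    exact mod_cast mul_ne_zero hw.card_pos.ne' (by positivity)
  exact (integrable_finsetSum_measure.2 fun _ _ => integrable_dirac enorm_lt_top).smul_measure
    (ENNReal.inv_ne_top.2 hcard)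

end ConstOnBalls

/-- A probability density on `ℤ_p`, bounded by `bound` and constant on the balls of radius
`p ^ (-scale)`: an approximation of the Salem measure at a finite level. -/
structure Stage (p : ℕ) [Fact p.Prime] where
  scale : ℕ
  density : ℚ_[p] → ℝ
  bound : ℝ
  const : ConstOnBalls scale density
  nonneg : ∀ x, 0 ≤ density x
  le_bound : ∀ x, density x ≤ bound
  eq_zero : ∀ x, 1 < ‖x‖ → density x = 0
  integral_eq : ∫ x, density x ∂haar p = 1

namespace Stage

/-- The probability measure of a stage. -/
noncomputable def measure (S : Stage p) : Measure ℚ_[p] :=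
  (haar p).withDensity fun x => ENNReal.ofReal (S.density x)

theorem bound_nonneg (S : Stage p) : 0 ≤ S.bound := (S.nonneg 0).trans (S.le_bound 0)

theorem integrable (S : Stage p) : Integrable S.density (haar p) :=
  not_imp_comm.1 integral_undef (by rw [S.integral_eq]; exact one_ne_zero)

instance isProbabilityMeasure_measure (S : Stage p) : IsProbabilityMeasure S.measure := by
  refine ⟨?_⟩
  rw [measure, withDensity_apply _ MeasurableSet.univ, Measure.restrict_univ,
    ← ofReal_integral_eq_lintegral_ofReal S.integrable (.of_forall S.nonneg), S.integral_eq,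
    ENNReal.ofReal_one]

theorem measure_compl_closedBall (S : Stage p) : S.measure (Metric.closedBall 0 1)ᶜ = 0 := by
  rw [measure, withDensity_apply _ measurableSet_closedBall.compl]
  refine setLIntegral_eq_zero measurableSet_closedBall.compl fun x hx => ?_
  rw [S.eq_zero x (by simpa using hx), ENNReal.ofReal_zero, Pi.zero_apply]

theorem measureReal_closedBall (S : Stage p) {m : ℕ} (hm : S.scale ≤ m) (x : ℚ_[p]) :
    S.measure.real (Metric.closedBall x ((p : ℝ) ^ (-(m : ℤ)))) =
      S.density x * (p : ℝ) ^ (-(m : ℤ)) := by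
  rw [Measure.real, measure, withDensity_apply _ measurableSet_closedBall,
    setLIntegral_congr_fun (g := fun _ => ENNReal.ofReal (S.density x)) measurableSet_closedBall
      fun y hy => by rw [(S.const.mono hm) x y (mem_closedBall_iff_norm.1 hy)],
    setLIntegral_const, ENNReal.toReal_mul, ENNReal.toReal_ofReal (S.nonneg x), ← Measure.real,
    haar_real_closedBall]

section Integral

variable {E : Type*} [NormedAddCommGroup E] [NormedSpace ℝ E]

theorem integral_measure (S : Stage p) (φ : ℚ_[p] → E) :
    ∫ x, φ x ∂S.measure = ∫ x, S.density x • φ x ∂haar p := by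
  rw [measure, integral_withDensity_eq_integral_toReal_smul
    S.const.continuous.measurable.ennreal_ofReal (.of_forall fun _ => ENNReal.ofReal_lt_top)]
  simp only [ENNReal.toReal_ofReal (S.nonneg _)]

theorem setIntegral_closedBall_smul (S : Stage p) (φ : ℚ_[p] → E) :
    ∫ x in Metric.closedBall 0 1, S.density x • φ x ∂haar p = ∫ x, φ x ∂S.measure := by
  rw [S.integral_measure]
  refine setIntegral_eq_integral_of_forall_compl_eq_zero fun x hx => ?_
  rw [S.eq_zero x (by simpa using hx), zero_smul]

end Integral

/-- Haar measure on `ℤ_p`, as a stage. -/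
noncomputable def init (p : ℕ) [Fact p.Prime] : Stage p where
  scale := 0
  density := (Metric.closedBall (0 : ℚ_[p]) 1).indicator fun _ => 1
  bound := 1
  const := by
    simpa using (constOnBalls_mem_closedBall (p := p) (le_refl 0) 0).indicator_const (1 : ℝ)
  nonneg := Set.indicator_nonneg fun _ _ => zero_le_one
  le_bound := Set.indicator_le' (fun _ _ => le_rfl) fun _ _ => zero_le_one
  eq_zero _ hx := Set.indicator_of_notMem (by simpa using hx) _
  integral_eq := by
    rw [integral_indicator_const _ measurableSet_closedBall, Measure.real, haar_closedBall_one,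
      ENNReal.toReal_one, one_smul]

/-- The index `N` of the measure `approxMeasure p N` used to refine a stage. It is taken so large
that it absorbs the losses `bound` and `p ^ scale` of the previous stages. -/
noncomputable def freq (N₀ : ℕ) (S : Stage p) : ℕ :=
  p ^ S.scale + ⌈S.bound⌉₊ + S.scale + N₀ + 1

/-- The scale of the refinement of a stage, so fine that points within `p ^ (-nextScale)` of the
support of `approxMeasure p freq` are approximable to order `τ`. -/
noncomputable def nextScale (N₀ : ℕ) (τ : ℝ) (S : Stage p) : ℕ :=
  max (S.freq N₀) ⌈τ * (S.freq N₀ + 4)⌉₊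

/-- The density of the refinement of a stage. -/
noncomputable def nextDensity (N₀ : ℕ) (τ : ℝ) (S : Stage p) (x : ℚ_[p]) : ℝ :=
  S.density x * ((p : ℝ) ^ (S.nextScale N₀ τ) * (approxMeasure p (S.freq N₀)).real
    (Metric.closedBall x ((p : ℝ) ^ (-(S.nextScale N₀ τ : ℤ)))))

theorem lt_freq (N₀ : ℕ) (S : Stage p) : N₀ < S.freq N₀ := by unfold freq; omega

theorem one_le_freq (N₀ : ℕ) (S : Stage p) : 1 ≤ S.freq N₀ :=
  (Nat.zero_le N₀).trans_lt (S.lt_freq N₀)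

theorem scale_lt_freq (N₀ : ℕ) (S : Stage p) : S.scale < S.freq N₀ := by unfold freq; omega

theorem bound_le_freq (N₀ : ℕ) (S : Stage p) : S.bound ≤ S.freq N₀ :=
  (Nat.le_ceil _).trans (Nat.cast_le.2 (by unfold freq; omega))

theorem pow_scale_le_freq (N₀ : ℕ) (S : Stage p) : (p : ℝ) ^ S.scale ≤ S.freq N₀ := by
  rw [← Nat.cast_pow]
  exact Nat.cast_le.2 (by unfold freq; omega)

theorem freq_le_nextScale (N₀ : ℕ) (τ : ℝ) (S : Stage p) : S.freq N₀ ≤ S.nextScale N₀ τ :=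
  le_max_left _ _

theorem scale_lt_nextScale (N₀ : ℕ) (τ : ℝ) (S : Stage p) : S.scale < S.nextScale N₀ τ :=
  (S.scale_lt_freq N₀).trans_le (S.freq_le_nextScale N₀ τ)

section Refine

variable {E : Type*} [NormedAddCommGroup E] [NormedSpace ℝ E] [CompleteSpace E] {N₀ : ℕ}

theorem integral_nextDensity (hN₀ : ∀ N > N₀, (window p N).Nonempty) (τ : ℝ) (S : Stage p)
    {φ : ℚ_[p] → E} (hφ : ConstOnBalls (S.nextScale N₀ τ) φ) :
    ∫ x, S.nextDensity N₀ τ x • φ x ∂haar p =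
      ∫ x, S.density x • φ x ∂approxMeasure p (S.freq N₀) := by
  have hw := hN₀ _ (S.lt_freq N₀)
  have := isProbabilityMeasure_approxMeasure hw
  rw [← ((S.const.mono (S.scale_lt_nextScale N₀ τ).le).smul hφ).integral_smoothing _
    (integrable_approxMeasure hw _)]
  refine integral_congr_ae (.of_forall fun x => ?_)
  simp only [nextDensity, smul_smul, mul_comm]

theorem integral_approxMeasure_eq (hN₀ : ∀ N > N₀, (window p N).Nonempty) (S : Stage p)
    {φ : ℚ_[p] → E} (hφ : ConstOnBalls (S.freq N₀) φ) :
    ∫ x, S.density x • φ x ∂approxMeasure p (S.freq N₀) = ∫ x, φ x ∂S.measure := by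
  rw [((S.const.mono (S.scale_lt_freq N₀).le).smul hφ).integral_approxMeasure_eq
    (S.one_le_freq N₀) (hN₀ _ (S.lt_freq N₀)), S.setIntegral_closedBall_smul]

/-- The refinement of a stage by the measure `approxMeasure p (S.freq N₀)`. -/
noncomputable def next (hN₀ : ∀ N > N₀, (window p N).Nonempty) (τ : ℝ) (S : Stage p) : Stage p where
  scale := S.nextScale N₀ τ
  density := S.nextDensity N₀ τ
  bound := S.bound * (p : ℝ) ^ (S.nextScale N₀ τ)
  const := (S.const.mono (S.scale_lt_nextScale N₀ τ).le).smul fun x y hxy =>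
    congrArg _ (constOnBalls_real_closedBall _ _ x y hxy)
  nonneg x := mul_nonneg (S.nonneg x) (by positivity)
  le_bound x := by
    have := isProbabilityMeasure_approxMeasure (hN₀ _ (S.lt_freq N₀))
    exact mul_le_mul (S.le_bound x) (mul_le_of_le_one_right (by positivity) measureReal_le_one)
      (by positivity) S.bound_nonneg
  eq_zero x hx := by rw [nextDensity, S.eq_zero x hx, zero_mul]
  integral_eq := by
    have hone : ConstOnBalls (S.freq N₀) fun _ : ℚ_[p] => (1 : ℝ) := fun _ _ _ => rfl
    have h := S.integral_nextDensity hN₀ τ (hone.mono (S.freq_le_nextScale N₀ τ))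
    rw [S.integral_approxMeasure_eq hN₀ hone] at h
    simpa using h

end Refine

end Stage

section Stages

variable {E : Type*} [NormedAddCommGroup E] [NormedSpace ℝ E] [CompleteSpace E] {N₀ : ℕ}
  (hN₀ : ∀ N > N₀, (window p N).Nonempty) (τ : ℝ)

/-- The sequence of stages whose measures converge to the Salem measure. -/
noncomputable def stages : ℕ → Stage p
  | 0 => Stage.init p
  | k + 1 => (stages k).next hN₀ τ

theorem integral_measure_stages_succ (k : ℕ) {φ : ℚ_[p] → E}
    (hφ : ConstOnBalls (stages hN₀ τ (k + 1)).scale φ) :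
    ∫ x, φ x ∂(stages hN₀ τ (k + 1)).measure =
      ∫ x, (stages hN₀ τ k).density x • φ x ∂approxMeasure p ((stages hN₀ τ k).freq N₀) := by
  rw [Stage.integral_measure]
  exact (stages hN₀ τ k).integral_nextDensity hN₀ τ hφ

theorem integral_measure_stages_succ_eq (k : ℕ) {φ : ℚ_[p] → E}
    (hφ : ConstOnBalls ((stages hN₀ τ k).freq N₀) φ) :
    ∫ x, φ x ∂(stages hN₀ τ (k + 1)).measure = ∫ x, φ x ∂(stages hN₀ τ k).measure := by
  rw [integral_measure_stages_succ hN₀ τ k (hφ.mono (Stage.freq_le_nextScale N₀ τ _)),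
    Stage.integral_approxMeasure_eq hN₀ _ hφ]

theorem stages_scale_strictMono : StrictMono fun k => (stages hN₀ τ k).scale :=
  strictMono_nat_of_lt_succ fun k => (stages hN₀ τ k).scale_lt_nextScale N₀ τ

theorem integral_measure_stages_eq_of_le {k l : ℕ} (hkl : k ≤ l) {φ : ℚ_[p] → E}
    (hφ : ConstOnBalls (stages hN₀ τ k).scale φ) :
    ∫ x, φ x ∂(stages hN₀ τ l).measure = ∫ x, φ x ∂(stages hN₀ τ k).measure := by
  induction l, hkl using Nat.le_induction with
  | base => rfl
  | succ l hkl ih =>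
    have hscale := (stages_scale_strictMono hN₀ τ).monotone hkl
    rw [integral_measure_stages_succ_eq hN₀ τ l
      (hφ.mono (hscale.trans (Stage.scale_lt_freq _ _).le)), ih]

theorem exists_stages_scale_lt_le {m : ℕ} (hm : m ≠ 0) :
    ∃ k, (stages hN₀ τ k).scale < m ∧ m ≤ (stages hN₀ τ (k + 1)).scale := by
  have hex : ∃ k, m ≤ (stages hN₀ τ k).scale := ⟨m, (stages_scale_strictMono hN₀ τ).le_apply⟩
  classical
  have hfind : Nat.find hex ≠ 0 := fun h =>
    hm (Nat.le_zero.1 ((Nat.find_eq_zero hex).1 h))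
  obtain ⟨k, hk⟩ := Nat.exists_eq_succ_of_ne_zero hfind
  have hspec := Nat.find_spec hex
  rw [hk] at hspec
  exact ⟨k, not_le.1 (Nat.find_min hex (by omega)), hspec⟩

end Stages

section Limit

variable {N₀ : ℕ}

/-- A measure is a limit of the stages if it agrees with the `k`-th stage on all bounded functions
which the `k`-th stage can resolve. -/
def IsLimit (hN₀ : ∀ N > N₀, (window p N).Nonempty) (τ : ℝ) (μ : Measure ℚ_[p]) : Prop :=
  ∀ (k : ℕ) (φ : ℚ_[p] → ℂ) (C : ℝ), (∀ x, ‖φ x‖ ≤ C) → ConstOnBalls (stages hN₀ τ k).scale φ →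
    ∫ x, φ x ∂μ = ∫ x, φ x ∂(stages hN₀ τ k).measure

open Filter Topology in
theorem exists_isLimit (hN₀ : ∀ N > N₀, (window p N).Nonempty) (τ : ℝ) :
    ∃ μ : Measure ℚ_[p], IsProbabilityMeasure μ ∧ IsLimit hN₀ τ μ := by
  let M (k : ℕ) : ProbabilityMeasure ℚ_[p] := ⟨(stages hN₀ τ k).measure, inferInstance⟩
  have hcompact := isCompact_setOfPred_probabilityMeasure_mass_eq_compl_isCompact_le
    (u := fun _ => 0) (K := fun _ => Metric.closedBall (0 : ℚ_[p]) 1)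
    tendsto_const_nhds (fun _ => isCompact_closedBall _ _) (Or.inl inferInstance)
  have hmem (k n : ℕ) : M k (Metric.closedBall 0 1)ᶜ ≤ (fun _ : ℕ => (0 : ℝ≥0)) n := by
    have h := (stages hN₀ τ k).measure_compl_closedBall
    rw [← ENNReal.coe_le_coe, ProbabilityMeasure.ennreal_coeFn_eq_coeFn_toMeasure]
    exact h.le
  obtain ⟨μ, -, hlim : Tendsto M (hyperfilter ℕ) (𝓝 μ)⟩ :=
    hcompact.ultrafilter_le_nhds ((hyperfilter ℕ).map M)
      (le_principal_iff.2 (mem_map.2 (univ_mem' hmem)))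
  refine ⟨μ, inferInstance, fun k φ C hC hφ => ?_⟩
  rw [ProbabilityMeasure.tendsto_iff_forall_integral_rclike_tendsto ℂ] at hlim
  refine tendsto_nhds_unique
    (hlim (BoundedContinuousFunction.ofNormedAddCommGroup φ hφ.continuous C hC))
    (tendsto_const_nhds.congr' ?_)
  filter_upwards [Nat.hyperfilter_le_atTop (eventually_ge_atTop k)] with l hl
  exact (integral_measure_stages_eq_of_le hN₀ τ hl hφ).symm

end Limit

section Decay

theorem Stage.density_eq_setIntegral (S : Stage p) (x : ℚ_[p]) :
    (S.density x : ℂ) = ∫ t in Metric.closedBall 0 ((p : ℝ) ^ (S.scale : ℤ)),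
      stdChar (-(x * t)) * fourierMeasure S.measure t ∂haar p := by
  rw [setIntegral_closedBall_stdChar_neg_mul_fourierMeasure, S.measureReal_closedBall le_rfl,
    mul_left_comm, ← zpow_add₀ (prime_real_pos p).ne', add_neg_cancel, zpow_zero, mul_one]

theorem Stage.integral_smul_stdChar (S : Stage p) (ν : Measure ℚ_[p]) [IsFiniteMeasure ν]
    (s : ℚ_[p]) :
    ∫ x, S.density x • stdChar (x * s) ∂ν =
      ∫ t in Metric.closedBall 0 ((p : ℝ) ^ (S.scale : ℤ)),
        fourierMeasure S.measure t * fourierMeasure ν (s - t) ∂haar p := by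
  have hexpand (x : ℚ_[p]) : S.density x • stdChar (x * s) =
      ∫ t in Metric.closedBall 0 ((p : ℝ) ^ (S.scale : ℤ)),
        fourierMeasure S.measure t * stdChar (x * (s - t)) ∂haar p := by
    rw [Complex.real_smul, S.density_eq_setIntegral, ← integral_mul_const]
    refine integral_congr_ae (.of_forall fun t => ?_)
    beta_reduce
    rw [mul_right_comm, ← stdChar_add, mul_comm, mul_sub, neg_add_eq_sub]
  have hint : Integrable (fun z : ℚ_[p] × ℚ_[p] =>
      fourierMeasure S.measure z.2 * stdChar (z.1 * (s - z.2)))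
      (ν.prod ((haar p).restrict (Metric.closedBall 0 ((p : ℝ) ^ (S.scale : ℤ))))) := by
    refine (integrable_stdChar_comp _ (by fun_prop)).bdd_mul (c := 1)
      ((continuous_fourierMeasure _).comp continuous_snd).aestronglyMeasurable
      (.of_forall fun z => ?_)
    exact norm_fourierMeasure_le_one S.measure z.2
  simp only [hexpand]
  rw [integral_integral_swap hint]
  refine integral_congr_ae (.of_forall fun t => ?_)
  exact integral_const_mul _ _

theorem Stage.norm_integral_smul_stdChar_le (S : Stage p) (ν : Measure ℚ_[p]) [IsFiniteMeasure ν]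
    (s : ℚ_[p]) {A : ℝ}
    (hA : ∀ t : ℚ_[p], ‖t‖ ≤ (p : ℝ) ^ S.scale → ‖fourierMeasure ν (s - t)‖ ≤ A) :
    ‖∫ x, S.density x • stdChar (x * s) ∂ν‖ ≤ (p : ℝ) ^ S.scale * A := by
  rw [S.integral_smul_stdChar]
  have h := norm_setIntegral_le_of_norm_le_const (μ := haar p) (C := A)
    (f := fun t => fourierMeasure S.measure t * fourierMeasure ν (s - t))
    (s := Metric.closedBall (0 : ℚ_[p]) ((p : ℝ) ^ (S.scale : ℤ)))
    (isCompact_closedBall _ _).measure_lt_top fun t ht => ?_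
  · rwa [haar_real_closedBall, zpow_natCast, mul_comm] at h
  · rw [norm_mul]
    exact mul_le_of_le_one_left (norm_nonneg _) (norm_fourierMeasure_le_one _ _) |>.trans
      (hA t (by simpa using ht))

theorem Stage.inv_pow_freq_le {N₀ : ℕ} {τ : ℝ} (hτ : 1 ≤ τ) (S : Stage p) {m : ℕ}
    (hm : m ≤ S.nextScale N₀ τ) :
    ((p : ℝ) ^ S.freq N₀)⁻¹ ≤ (p : ℝ) ^ 5 * (p : ℝ) ^ (-((m : ℝ) / τ)) := by
  have hτ0 : 0 < τ := one_pos.trans_le hτ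
  have hceil := (Nat.ceil_lt_add_one (a := τ * (S.freq N₀ + 4)) (by positivity)).le
  have hscale : (S.nextScale N₀ τ : ℝ) ≤ (S.freq N₀ + 5) * τ := by
    rw [nextScale, Nat.cast_max]
    refine max_le ?_ (by linarith)
    nlinarith [(Nat.cast_nonneg (S.freq N₀) : (0 : ℝ) ≤ _)]
  have hdiv : (m : ℝ) / τ ≤ S.freq N₀ + 5 :=
    (div_le_iff₀ hτ0).2 ((Nat.cast_le.2 hm).trans hscale)
  rw [← Real.rpow_natCast, ← Real.rpow_natCast, ← Real.rpow_neg (prime_real_pos p).le,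
    ← Real.rpow_add (prime_real_pos p)]
  refine Real.rpow_le_rpow_of_exponent_le (one_lt_prime_real p).le ?_
  push_cast
  linarith

theorem decayConst_nonneg (p : ℕ) {c : ℝ} (hc : 0 ≤ c) : 0 ≤ decayConst p c := by
  have : 0 ≤ ∑' t : ℤ, 1 / (1 + (t : ℝ) ^ 2) := tsum_nonneg fun t => by positivity
  unfold decayConst
  positivity

variable {N₀ : ℕ} {hN₀ : ∀ N > N₀, (window p N).Nonempty} {τ : ℝ} {μ : Measure ℚ_[p]}

theorem IsLimit.fourierMeasure_eq (hμ : IsLimit hN₀ τ μ) {k m : ℕ}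
    (hm : m ≤ (stages hN₀ τ (k + 1)).scale) {s : ℚ_[p]} (hs : ‖s‖ = (p : ℝ) ^ m) :
    fourierMeasure μ s = ∫ x, (stages hN₀ τ k).density x • stdChar (x * s)
      ∂approxMeasure p ((stages hN₀ τ k).freq N₀) := by
  have hconst := (constOnBalls_stdChar hs.le).mono hm
  rw [fourierMeasure, hμ (k + 1) _ 1 (fun x => (norm_stdChar _).le) hconst,
    integral_measure_stages_succ hN₀ τ k hconst]

theorem IsLimit.norm_fourierMeasure_le (hμ : IsLimit hN₀ τ μ) (hτ : 1 ≤ τ) {c : ℝ} (hc : 0 < c)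
    (hw : ∀ N > N₀, c * (p : ℝ) ^ N / N ≤ (window p N).card) {m : ℕ} (hm : m ≠ 0) {s : ℚ_[p]}
    (hs : ‖s‖ = (p : ℝ) ^ m) :
    ‖fourierMeasure μ s‖ ≤ decayConst p c * (p : ℝ) ^ 5 * (m : ℝ) ^ 2 *
      (p : ℝ) ^ (-((m : ℝ) / τ)) := by
  have hp1 := one_lt_prime_real p
  have hD := decayConst_nonneg p hc.le
  obtain ⟨k, hk, hmk⟩ := exists_stages_scale_lt_le hN₀ τ hm
  rw [hμ.fourierMeasure_eq hmk hs]
  set S := stages hN₀ τ k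
  have hN := S.lt_freq N₀
  have := isProbabilityMeasure_approxMeasure (hN₀ _ hN)
  have hst (t : ℚ_[p]) (ht : ‖t‖ ≤ (p : ℝ) ^ S.scale) : ‖s - t‖ = (p : ℝ) ^ m := by
    have hlt : ‖-t‖ < ‖s‖ := by
      rw [norm_neg, hs]
      exact ht.trans_lt (pow_lt_pow_right₀ hp1 hk)
    rw [sub_eq_add_neg, Padic.add_eq_max_of_ne hlt.ne', max_eq_left hlt.le, hs]
  rcases le_or_gt m (S.freq N₀) with hmN | hmN
  · refine (S.norm_integral_smul_stdChar_le _ s (A := 0) fun t ht => ?_).trans ?_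
    · rw [fourierMeasure_approxMeasure_eq_zero (S.one_le_freq N₀) (hN₀ _ hN), norm_zero]
      · rw [hst t ht]
        exact one_lt_pow₀ hp1 hm
      · rw [hst t ht]
        exact pow_le_pow_right₀ hp1.le hmN
    · rw [mul_zero]
      positivity
  · refine (S.norm_integral_smul_stdChar_le _ s fun t ht =>
      norm_fourierMeasure_approxMeasure_le (S.one_le_freq N₀) hc (hw _ hN) hmN (hst t ht)).trans ?_
    have hscale : (p : ℝ) ^ S.scale ≤ m :=
      (S.pow_scale_le_freq N₀).trans (Nat.cast_le.2 hmN.le)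
    rw [zpow_neg, zpow_natCast]
    calc (p : ℝ) ^ S.scale * (decayConst p c * m * ((p : ℝ) ^ S.freq N₀)⁻¹)
        ≤ m * (decayConst p c * m * ((p : ℝ) ^ 5 * (p : ℝ) ^ (-((m : ℝ) / τ)))) := by
          gcongr
          exact S.inv_pow_freq_le hτ hmk
      _ = _ := by ring

end Decay

section BallMeasure

variable {N₀ : ℕ} {hN₀ : ∀ N > N₀, (window p N).Nonempty} {τ : ℝ} {μ : Measure ℚ_[p]}

theorem IsLimit.measureReal_eq (hμ : IsLimit hN₀ τ μ) {k : ℕ} {A : Set ℚ_[p]}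
    (hA : ConstOnBalls (stages hN₀ τ k).scale (· ∈ A)) :
    μ.real A = (stages hN₀ τ k).measure.real A := by
  have h := hμ k (A.indicator fun _ => 1) 1
    (fun x => (norm_indicator_le_norm_self _ _).trans norm_one.le) (hA.indicator_const (1 : ℂ))
  rw [integral_indicator_const _ hA.measurableSet, integral_indicator_const _ hA.measurableSet] at h
  simpa using h

theorem measureReal_stages_succ (k : ℕ) {A : Set ℚ_[p]}
    (hA : ConstOnBalls (stages hN₀ τ (k + 1)).scale (· ∈ A)) :
    (stages hN₀ τ (k + 1)).measure.real A =
      ∫ x in A, (stages hN₀ τ k).density x ∂approxMeasure p ((stages hN₀ τ k).freq N₀) := by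
  have h := integral_measure_stages_succ hN₀ τ k (hA.indicator_const (1 : ℝ))
  rw [integral_indicator_const _ hA.measurableSet, smul_eq_mul, mul_one] at h
  rw [h, ← integral_indicator hA.measurableSet]
  simp only [smul_eq_mul, ← Set.indicator_mul_right, mul_one]

theorem IsLimit.measureReal_closedBall_eq_mul (hμ : IsLimit hN₀ τ μ) {k m : ℕ}
    (hkm : (stages hN₀ τ k).scale ≤ m) (hm : m ≤ (stages hN₀ τ k).freq N₀) (x : ℚ_[p]) :
    μ.real (Metric.closedBall x ((p : ℝ) ^ (-(m : ℤ)))) =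
      μ.real (Metric.closedBall x ((p : ℝ) ^ (-((stages hN₀ τ k).scale : ℤ)))) *
        (p : ℝ) ^ (-((m - (stages hN₀ τ k).scale : ℕ) : ℤ)) := by
  have hball := constOnBalls_mem_closedBall (p := p) hm x
  have hnext := hball.mono (Stage.freq_le_nextScale N₀ τ _)
  have hstep := integral_measure_stages_succ_eq hN₀ τ k (hball.indicator_const (1 : ℝ))
  rw [integral_indicator_const _ measurableSet_closedBall,
    integral_indicator_const _ measurableSet_closedBall, smul_eq_mul, smul_eq_mul, mul_one,
    mul_one] at hstep
  rw [hμ.measureReal_eq (k := k + 1) hnext, hstep,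
    hμ.measureReal_eq (constOnBalls_mem_closedBall le_rfl x), Stage.measureReal_closedBall _ hkm,
    Stage.measureReal_closedBall _ le_rfl, mul_assoc, ← zpow_add₀ (prime_real_pos p).ne']
  congr 2
  omega

theorem zpow_neg_le_rpow_of_two_le (hτ : 2 ≤ τ) (d : ℕ) :
    (p : ℝ) ^ (-(d : ℤ)) ≤ (p : ℝ) ^ (-(2 * (d : ℝ) / τ)) := by
  rw [← Real.rpow_intCast]
  refine Real.rpow_le_rpow_of_exponent_le (one_lt_prime_real p).le ?_
  push_cast
  rw [neg_le_neg_iff, div_le_iff₀ (by linarith), mul_comm]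
  gcongr

theorem Stage.bound_mul_approxMeasure_closedBall_le (hτ : 2 ≤ τ) {c : ℝ} (hc : 0 < c)
    (hw : ∀ N > N₀, c * (p : ℝ) ^ N / N ≤ (window p N).card) (S : Stage p) (x : ℚ_[p]) {m : ℕ}
    (hm : S.freq N₀ < m) (hm' : m ≤ S.nextScale N₀ τ) :
    S.bound * (approxMeasure p (S.freq N₀)).real (Metric.closedBall x ((p : ℝ) ^ (-(m : ℤ)))) ≤
      (p : ℝ) ^ 8 / c * ((p : ℝ) ^ 10 + 1) * (m : ℝ) ^ 2 * (p : ℝ) ^ (-(2 * (m : ℝ) / τ)) := by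
  have hfreq : ((p : ℝ) ^ (2 * S.freq N₀))⁻¹ ≤
      (p : ℝ) ^ 10 * (p : ℝ) ^ (-(2 * (m : ℝ) / τ)) := by
    calc ((p : ℝ) ^ (2 * S.freq N₀))⁻¹ = (((p : ℝ) ^ S.freq N₀)⁻¹) ^ 2 := by
          rw [inv_pow, ← pow_mul, mul_comm]
      _ ≤ ((p : ℝ) ^ 5 * (p : ℝ) ^ (-((m : ℝ) / τ))) ^ 2 := by
          gcongr
          exact S.inv_pow_freq_le (by linarith) hm'
      _ = _ := by
          rw [mul_pow, ← pow_mul, ← Real.rpow_mul_natCast (prime_real_pos p).le]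
          congr 2
          push_cast
          ring
  have hball : ((p : ℝ) ^ m)⁻¹ ≤ (p : ℝ) ^ (-(2 * (m : ℝ) / τ)) := by
    simpa only [zpow_neg, zpow_natCast] using zpow_neg_le_rpow_of_two_le (p := p) hτ m
  have hNm : (S.freq N₀ : ℝ) ≤ m := Nat.cast_le.2 hm.le
  have hbound : S.bound ≤ m := (S.bound_le_freq N₀).trans hNm
  calc S.bound * (approxMeasure p (S.freq N₀)).real (Metric.closedBall x ((p : ℝ) ^ (-(m : ℤ))))
      ≤ m * ((p : ℝ) ^ 8 / c * S.freq N₀ *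
          (((p : ℝ) ^ (2 * S.freq N₀))⁻¹ + ((p : ℝ) ^ m)⁻¹)) :=
        mul_le_mul hbound
          (approxMeasure_closedBall_le (S.one_le_freq N₀) hc (hw _ (S.lt_freq N₀)) x m)
          measureReal_nonneg (Nat.cast_nonneg m)
    _ ≤ m * ((p : ℝ) ^ 8 / c * m * ((p : ℝ) ^ 10 * (p : ℝ) ^ (-(2 * (m : ℝ) / τ)) +
          (p : ℝ) ^ (-(2 * (m : ℝ) / τ)))) := by gcongr
    _ = _ := by ring

theorem Stage.setIntegral_density_le (S : Stage p) (ν : Measure ℚ_[p]) [IsFiniteMeasure ν]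
    (A : Set ℚ_[p]) : ∫ x in A, S.density x ∂ν ≤ S.bound * ν.real A := by
  have h := norm_setIntegral_le_of_norm_le_const (μ := ν) (s := A) (f := S.density)
    (measure_lt_top ν A) fun x _ => (Real.norm_of_nonneg (S.nonneg x)).trans_le (S.le_bound x)
  exact (Real.le_norm_self _).trans h

/-- The constant in the ball condition satisfied by the limit measure. -/
noncomputable def ballConst (p : ℕ) (c : ℝ) : ℝ := 1 + (p : ℝ) ^ 8 / c * ((p : ℝ) ^ 10 + 1)

theorem one_le_ballConst (p : ℕ) {c : ℝ} (hc : 0 ≤ c) : 1 ≤ ballConst p c :=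
  le_add_of_nonneg_right (by positivity)

theorem IsLimit.measureReal_closedBall_le [IsProbabilityMeasure μ] (hμ : IsLimit hN₀ τ μ)
    (hτ : 2 ≤ τ) {c : ℝ} (hc : 0 < c) (hw : ∀ N > N₀, c * (p : ℝ) ^ N / N ≤ (window p N).card)
    (x : ℚ_[p]) (m : ℕ) :
    μ.real (Metric.closedBall x ((p : ℝ) ^ (-(m : ℤ)))) ≤
      ballConst p c * (m + 1 : ℝ) ^ 2 * (p : ℝ) ^ (-(2 * (m : ℝ) / τ)) := by
  have hK := one_le_ballConst p hc.le
  induction m using Nat.strong_induction_on with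
  | _ m ih =>
    rcases eq_or_ne m 0 with rfl | hm
    · exact measureReal_le_one.trans (by simpa using hK)
    obtain ⟨k, hk, hmk⟩ := exists_stages_scale_lt_le hN₀ τ hm
    rcases le_or_gt m ((stages hN₀ τ k).freq N₀) with hmN | hmN
    · rw [hμ.measureReal_closedBall_eq_mul hk.le hmN]
      have hscale := ih _ hk
      obtain ⟨d, rfl⟩ := Nat.exists_eq_add_of_lt hk
      set n := (stages hN₀ τ k).scale
      rw [add_assoc, Nat.add_sub_cancel_left]
      calc μ.real (Metric.closedBall x ((p : ℝ) ^ (-(n : ℤ)))) * (p : ℝ) ^ (-((d + 1 : ℕ) : ℤ))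
          ≤ ballConst p c * (n + 1 : ℝ) ^ 2 * (p : ℝ) ^ (-(2 * (n : ℝ) / τ)) *
            (p : ℝ) ^ (-(2 * ((d + 1 : ℕ) : ℝ) / τ)) := by
            gcongr
            exact zpow_neg_le_rpow_of_two_le hτ _
        _ = ballConst p c * (n + 1 : ℝ) ^ 2 *
            (p : ℝ) ^ (-(2 * ((n + (d + 1) : ℕ) : ℝ) / τ)) := by
            rw [mul_assoc, ← Real.rpow_add (prime_real_pos p)]
            congr 2
            push_cast
            ring
        _ ≤ _ := by
            gcongr
            omega
    · rw [hμ.measureReal_eq ((constOnBalls_mem_closedBall le_rfl x).mono hmk),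
        measureReal_stages_succ k ((constOnBalls_mem_closedBall le_rfl x).mono hmk)]
      have := isProbabilityMeasure_approxMeasure (hN₀ _ ((stages hN₀ τ k).lt_freq N₀))
      refine ((Stage.setIntegral_density_le _ _ _).trans
        (Stage.bound_mul_approxMeasure_closedBall_le hτ hc hw _ x hmN hmk)).trans ?_
      unfold ballConst
      gcongr <;> linarith

end BallMeasure

section Support

theorem ae_approxMeasure {N : ℕ} {P : ℚ_[p] → Prop} (h : ∀ z ∈ triples p N, P (ratPoint p z)) :
    ∀ᵐ x ∂approxMeasure p N, P x := by
  refine Measure.ae_smul_measure (ae_finsetSum_measure_iff.2 fun z hz => ?_) _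
  rw [ae_dirac_eq]
  exact h z hz

/-- The neighbourhood of the support of `approxMeasure p (S.freq N₀)` in which the refinement of
the stage `S` is supported. -/
def Stage.target (N₀ : ℕ) (τ : ℝ) (S : Stage p) : Set ℚ_[p] :=
  {x | ∃ z ∈ triples p (S.freq N₀), ‖x - ratPoint p z‖ ≤ (p : ℝ) ^ (-(S.nextScale N₀ τ : ℤ))}

theorem Stage.constOnBalls_mem_target (N₀ : ℕ) (τ : ℝ) (S : Stage p) :
    ConstOnBalls (S.nextScale N₀ τ) (· ∈ S.target N₀ τ) := by
  have hmem {x y : ℚ_[p]} (hxy : ‖y - x‖ ≤ (p : ℝ) ^ (-(S.nextScale N₀ τ : ℤ)))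
      (hx : x ∈ S.target N₀ τ) : y ∈ S.target N₀ τ := by
    obtain ⟨z, hz, hxz⟩ := hx
    exact ⟨z, hz, by simpa using norm_add_le_of_le hxy hxz⟩
  exact fun x y hxy => propext ⟨hmem (by rwa [norm_sub_rev]), hmem hxy⟩

variable {N₀ : ℕ} {hN₀ : ∀ N > N₀, (window p N).Nonempty} {τ : ℝ} {μ : Measure ℚ_[p]}
  [IsProbabilityMeasure μ]

theorem IsLimit.support_subset (hμ : IsLimit hN₀ τ μ) {k : ℕ} {A : Set ℚ_[p]}
    (hA : ConstOnBalls (stages hN₀ τ k).scale (· ∈ A))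
    (hone : (stages hN₀ τ k).measure.real A = 1) : μ.support ⊆ A := by
  rw [← hμ.measureReal_eq hA, measureReal_def, ENNReal.toReal_eq_one_iff] at hone
  refine Measure.support_subset_of_isClosed hA.isClopen.isClosed ?_
  rwa [mem_ae_iff, prob_compl_eq_zero_iff hA.measurableSet]

theorem IsLimit.support_subset_target (hμ : IsLimit hN₀ τ μ) (k : ℕ) :
    μ.support ⊆ (stages hN₀ τ k).target N₀ τ := by
  have hconst := (stages hN₀ τ k).constOnBalls_mem_target N₀ τ
  have hone : ConstOnBalls ((stages hN₀ τ k).freq N₀) fun _ : ℚ_[p] => (1 : ℝ) := fun _ _ _ => rfl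
  have hint := Stage.integral_approxMeasure_eq hN₀ _ hone
  refine hμ.support_subset (k := k + 1) hconst ?_
  rw [measureReal_stages_succ k hconst, Measure.restrict_eq_self_of_ae_mem]
  · simpa using hint
  · exact ae_approxMeasure fun z hz => ⟨z, hz, by simp⟩

theorem IsLimit.support_subset_closedBall (hμ : IsLimit hN₀ τ μ) :
    μ.support ⊆ Metric.closedBall 0 1 := by
  have hconst := constOnBalls_mem_closedBall (p := p) (le_refl 0) 0
  simp only [Nat.cast_zero, neg_zero, zpow_zero] at hconst
  refine hμ.support_subset (k := 0) hconst ?_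
  rw [measureReal_def, (prob_compl_eq_zero_iff measurableSet_closedBall).1
    (stages hN₀ τ 0).measure_compl_closedBall, ENNReal.toReal_one]

theorem Stage.exists_approx_of_mem_target (hτ : 0 ≤ τ) (S : Stage p) {x : ℚ_[p]}
    (hx : x ∈ S.target N₀ τ) : ∃ q r : ℕ, S.freq N₀ < q ∧
      ‖x * ((q : ℤ) : ℚ_[p]) - ((r : ℤ) : ℚ_[p])‖ ≤ ((max |(q : ℤ)| |(r : ℤ)| : ℤ) : ℝ) ^ (-τ) := by
  obtain ⟨⟨q, a, b⟩, hz, hxz⟩ := hx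
  obtain ⟨hqw, ha : a < p ^ _, hb : b < p ^ _⟩ := mem_triples.1 hz
  obtain ⟨⟨hlow, hhigh⟩, hprime⟩ := mem_window.1 hqw
  have hlt : S.freq N₀ < p ^ S.freq N₀ := Nat.lt_pow_self (Fact.out : p.Prime).one_lt
  refine ⟨q, 1 + a + b, by omega, ?_⟩
  have hmax : max |(q : ℤ)| |((1 + a + b : ℕ) : ℤ)| = q := by
    rw [Nat.abs_cast, Nat.abs_cast, ← Nat.cast_max, max_eq_left (by omega)]
  have hnorm : x * (q : ℚ_[p]) - ((1 + a + b : ℕ) : ℚ_[p]) =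
      (x - ratPoint p (q, a, b)) * (q : ℚ_[p]) := by
    rw [ratPoint, sub_mul, div_mul_cancel₀ _ (natCast_window_ne_zero hqw)]
  have hceil : τ * (S.freq N₀ + 4) ≤ S.nextScale N₀ τ :=
    (Nat.le_ceil _).trans (Nat.cast_le.2 (le_max_right _ _))
  have hq0 : (0 : ℝ) < q := Nat.cast_pos.2 hprime.pos
  rw [hmax, Int.cast_natCast, Int.cast_natCast, Int.cast_natCast, hnorm, norm_mul,
    norm_natCast_window (S.one_le_freq N₀) hqw, mul_one]
  calc ‖x - ratPoint p (q, a, b)‖ ≤ (p : ℝ) ^ (-(S.nextScale N₀ τ : ℤ)) := hxz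
    _ ≤ ((p : ℝ) ^ (S.freq N₀ + 4)) ^ (-τ) := by
        rw [← Real.rpow_intCast, ← Real.rpow_natCast, ← Real.rpow_mul (prime_real_pos p).le]
        refine Real.rpow_le_rpow_of_exponent_le (one_lt_prime_real p).le ?_
        push_cast
        linarith
    _ ≤ (q : ℝ) ^ (-τ) := Real.rpow_le_rpow_of_nonpos hq0 (mod_cast hhigh) (neg_nonpos.2 hτ)

theorem IsLimit.mem_probOn (hμ : IsLimit hN₀ τ μ) (hτ : 0 ≤ τ) : μ ∈ probOn (wellApprox p τ) := by
  refine ⟨inferInstance, (isCompact_closedBall 0 1).of_isClosed_subset Measure.isClosed_support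
    hμ.support_subset_closedBall, fun x hx => ⟨?_, fun hfin => ?_⟩⟩
  · simpa using hμ.support_subset_closedBall hx
  · obtain ⟨b, hb⟩ := (hfin.image Prod.fst).bddAbove
    obtain ⟨k, hk⟩ : ∃ k : ℕ, b ≤ k := ⟨b.toNat, Int.self_le_toNat b⟩
    obtain ⟨q, r, hq, hqr⟩ :=
      (stages hN₀ τ k).exists_approx_of_mem_target hτ (hμ.support_subset_target k hx)
    have hqb : (q : ℤ) ≤ b := hb ⟨((q : ℤ), (r : ℤ)), hqr, rfl⟩
    have hkscale : k ≤ (stages hN₀ τ k).scale := (stages_scale_strictMono hN₀ τ).le_apply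
    have hfreq := (stages hN₀ τ k).scale_lt_freq N₀
    omega

end Support

section LogBounds

theorem sq_add_two_le_log_sq {b t : ℝ} (hb : 2 ≤ b) {n : ℕ} (h : b ^ n ≤ t) :
    (n + 2 : ℝ) ^ 2 ≤ 9 / Real.log 2 ^ 2 * Real.log (1 + t) ^ 2 := by
  have hlog2 : 0 < Real.log 2 := Real.log_pos one_lt_two
  have hpow : (2 : ℝ) ^ n ≤ t := (pow_le_pow_left₀ zero_le_two hb n).trans h
  have ht : 1 ≤ t := (one_le_pow₀ one_le_two).trans hpow
  have hn : n * Real.log 2 ≤ Real.log (1 + t) := by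
    rw [← Real.log_pow]
    exact Real.log_le_log (by positivity) (by linarith)
  have hone : Real.log 2 ≤ Real.log (1 + t) := Real.log_le_log two_pos (by linarith)
  have hle : (n + 2 : ℝ) ≤ 3 * Real.log (1 + t) / Real.log 2 := by
    rw [le_div_iff₀ hlog2]
    linarith
  calc (n + 2 : ℝ) ^ 2 ≤ (3 * Real.log (1 + t) / Real.log 2) ^ 2 := by gcongr
    _ = 9 / Real.log 2 ^ 2 * Real.log (1 + t) ^ 2 := by ring

theorem exists_closedBall_eq_pow (p : ℕ) [Fact p.Prime] {r : ℝ} (hr0 : 0 < r) (hr1 : r ≤ 1) :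
    ∃ m : ℕ, (p : ℝ) ^ (-(m : ℤ)) ≤ r ∧ (p : ℝ) ^ (m - 1) ≤ r⁻¹ ∧
      ∀ x : ℚ_[p], Metric.closedBall x r = Metric.closedBall x ((p : ℝ) ^ (-(m : ℤ))) := by
  have hp1 := one_lt_prime_real p
  obtain ⟨n, hle, hlt⟩ := exists_mem_Ico_zpow hr0 hp1
  have hn : n ≤ 0 := not_lt.1 fun h => ((hle.trans hr1).trans_lt (one_lt_zpow₀ hp1 h)).false
  obtain ⟨m, rfl⟩ : ∃ m : ℕ, n = -(m : ℤ) := ⟨n.natAbs, by omega⟩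
  refine ⟨m, hle, ?_, fun x => (Metric.closedBall_subset_closedBall hle).antisymm' fun y hy => ?_⟩
  · obtain rfl | ⟨k, rfl⟩ := m.eq_zero_or_eq_succ_pred.imp_right fun h => (⟨_, h⟩ : ∃ k, m = k + 1)
    · simpa using (one_le_inv₀ hr0).2 hr1
    · have hinv : (p : ℝ) ^ (-((k + 1 : ℕ) : ℤ) + 1) = ((p : ℝ) ^ k)⁻¹ := by simp
      rw [Nat.succ_sub_one, le_inv_comm₀ (pow_pos (prime_real_pos p) k) hr0, ← hinv]
      exact hlt.le
  · rw [mem_closedBall_iff_norm] at hy ⊢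
    exact (Padic.norm_le_pow_iff_norm_lt_pow_add_one _ _).2 (hy.trans_lt hlt)

variable {N₀ : ℕ} {hN₀ : ∀ N > N₀, (window p N).Nonempty} {τ : ℝ} {μ : Measure ℚ_[p]}
  [IsProbabilityMeasure μ]

theorem IsLimit.norm_fourierMeasure_le_log (hμ : IsLimit hN₀ τ μ) (hτ : 1 ≤ τ) {c : ℝ}
    (hc : 0 < c) (hw : ∀ N > N₀, c * (p : ℝ) ^ N / N ≤ (window p N).card) {s : ℚ_[p]}
    (hs : 1 ≤ ‖s‖) :
    ‖fourierMeasure μ s‖ ≤ (1 + decayConst p c * (p : ℝ) ^ 5) * (9 / Real.log 2 ^ 2) *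
      (‖s‖ ^ (-1 / τ) * Real.log (1 + ‖s‖) ^ 2) := by
  have hD := decayConst_nonneg p hc.le
  obtain ⟨m, hm⟩ := exists_norm_eq_pow hs
  have hrpow : ‖s‖ ^ (-1 / τ) = (p : ℝ) ^ (-((m : ℝ) / τ)) := by
    rw [hm, ← Real.rpow_natCast, ← Real.rpow_mul (prime_real_pos p).le]
    congr 1
    ring
  have hsq := sq_add_two_le_log_sq (mod_cast (Fact.out : p.Prime).two_le) hm.ge
  have hbound : ‖fourierMeasure μ s‖ ≤
      (1 + decayConst p c * (p : ℝ) ^ 5) * (m + 2) ^ 2 * ‖s‖ ^ (-1 / τ) := by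
    obtain rfl | hm0 := eq_or_ne m 0
    · refine (norm_fourierMeasure_le_one μ s).trans ?_
      rw [hrpow]
      norm_num
      nlinarith [mul_nonneg hD (pow_nonneg (prime_real_pos p).le 5)]
    · refine (hμ.norm_fourierMeasure_le hτ hc hw hm0 hm).trans ?_
      rw [hrpow]
      gcongr <;> linarith
  calc ‖fourierMeasure μ s‖
      ≤ (1 + decayConst p c * (p : ℝ) ^ 5) * (m + 2) ^ 2 * ‖s‖ ^ (-1 / τ) := hbound
    _ ≤ (1 + decayConst p c * (p : ℝ) ^ 5) * (9 / Real.log 2 ^ 2 * Real.log (1 + ‖s‖) ^ 2) *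
        ‖s‖ ^ (-1 / τ) := by gcongr
    _ = _ := by ring

theorem IsLimit.measureReal_closedBall_le_log (hμ : IsLimit hN₀ τ μ) (hτ : 2 ≤ τ) {c : ℝ}
    (hc : 0 < c) (hw : ∀ N > N₀, c * (p : ℝ) ^ N / N ≤ (window p N).card) (x : ℚ_[p]) {r : ℝ}
    (hr0 : 0 < r) (hr1 : r ≤ 1) :
    μ.real (Metric.closedBall x r) ≤ ballConst p c * (9 / Real.log 2 ^ 2) *
      (r ^ (2 / τ) * Real.log (1 + r⁻¹) ^ 2) := by
  have hK : 0 ≤ ballConst p c := zero_le_one.trans (one_le_ballConst p hc.le)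
  obtain ⟨m, hmr, hrm, hball⟩ := exists_closedBall_eq_pow p hr0 hr1
  have hsq := sq_add_two_le_log_sq (mod_cast (Fact.out : p.Prime).two_le) hrm
  have hm : (m + 1 : ℝ) ≤ (m - 1 : ℕ) + 2 := mod_cast (by omega : m + 1 ≤ m - 1 + 2)
  have hrpow : (p : ℝ) ^ (-(2 * (m : ℝ) / τ)) ≤ r ^ (2 / τ) :=
    calc (p : ℝ) ^ (-(2 * (m : ℝ) / τ)) = ((p : ℝ) ^ (-(m : ℤ))) ^ (2 / τ) := by
          rw [← Real.rpow_intCast, ← Real.rpow_mul (prime_real_pos p).le]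
          push_cast
          congr 1
          ring
      _ ≤ r ^ (2 / τ) := by gcongr
  calc μ.real (Metric.closedBall x r)
      ≤ ballConst p c * (m + 1 : ℝ) ^ 2 * (p : ℝ) ^ (-(2 * (m : ℝ) / τ)) := by
        rw [hball]
        exact hμ.measureReal_closedBall_le hτ hc hw x m
    _ ≤ ballConst p c * (9 / Real.log 2 ^ 2 * Real.log (1 + r⁻¹) ^ 2) * r ^ (2 / τ) := by
        gcongr
        exact (pow_le_pow_left₀ (by positivity) hm 2).trans hsq
    _ = _ := by ring

theorem exists_salem_measure (p : ℕ) [Fact p.Prime] :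
    ∃ C : ℝ, 0 < C ∧ ∀ τ : ℝ, 2 < τ → ∃ μ ∈ probOn (wellApprox p τ),
      (∀ ξ : ℚ_[p], 1 ≤ ‖ξ‖ →
        ‖fourierMeasure μ ξ‖ ≤ C * (‖ξ‖ ^ (-1 / τ) * Real.log (1 + ‖ξ‖) ^ 2)) ∧
      (∀ (x : ℚ_[p]) (r : ℝ), 0 < r → r ≤ 1 →
        μ.real (Metric.closedBall x r) ≤ C * (r ^ (2 / τ) * Real.log (1 + r⁻¹) ^ 2)) := by
  obtain ⟨c, hc, hev⟩ := exists_le_card_window p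
  obtain ⟨N₀, hN⟩ := Filter.eventually_atTop.1 hev
  have hw : ∀ N > N₀, c * (p : ℝ) ^ N / N ≤ (window p N).card := fun N h => hN N h.le
  have hN₀ : ∀ N > N₀, (window p N).Nonempty := fun N h => by
    have hN' : (0 : ℝ) < N := Nat.cast_pos.2 (by omega)
    have := prime_real_pos p
    exact Finset.card_pos.1 (Nat.cast_pos.1 (lt_of_lt_of_le (by positivity) (hw N h)))
  have : 0 < Real.log 2 := Real.log_pos one_lt_two
  have hD := decayConst_nonneg p hc.le
  have := one_le_ballConst p hc.le
  refine ⟨max (1 + decayConst p c * (p : ℝ) ^ 5) (ballConst p c) * (9 / Real.log 2 ^ 2),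
    by positivity, fun τ hτ => ?_⟩
  obtain ⟨μ, _, hμ⟩ := exists_isLimit hN₀ τ
  refine ⟨μ, hμ.mem_probOn (by linarith), fun ξ hξ => ?_, fun x r hr0 hr1 => ?_⟩
  · refine (hμ.norm_fourierMeasure_le_log (by linarith) hc hw hξ).trans ?_
    gcongr
    exact le_max_left _ _
  · refine (hμ.measureReal_closedBall_le_log hτ.le hc hw x hr0 hr1).trans ?_
    gcongr
    exact le_max_right _ _

end LogBounds

section UpperBound

open Filter Topology

theorem hausdorffMeasure_infinite_mem_eq_zero {X ι : Type*} [EMetricSpace X] [MeasurableSpace X]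
    [BorelSpace X] [Countable ι] {E : ι → Set X} {s : ℝ} (hs : 0 < s)
    (hsum : ∑' i, Metric.ediam (E i) ^ s ≠ ∞) :
    Measure.hausdorffMeasure s {x | {i | x ∈ E i}.Infinite} = 0 := by
  have htail := ENNReal.tendsto_tsum_compl_atTop_zero hsum
  have hdiam (S : Finset ι) (i : {i // i ∉ S}) :
      Metric.ediam (E i) ≤ (∑' j : {j // j ∉ S}, Metric.ediam (E j) ^ s) ^ s⁻¹ := by
    rw [ENNReal.le_rpow_inv_iff hs]
    exact ENNReal.le_tsum i
  have hzero : Tendsto (fun S : Finset ι => (∑' j : {j // j ∉ S}, Metric.ediam (E j) ^ s) ^ s⁻¹)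
      atTop (𝓝 0) := by
    simpa [hs] using htail.ennrpow_const s⁻¹
  refine le_antisymm ?_ zero_le
  refine (Measure.hausdorffMeasure_le_liminf_tsum s _ _ hzero (fun S (i : {i // i ∉ S}) => E i)
    (.of_forall hdiam) (.of_forall fun S x hx => ?_)).trans htail.liminf_eq.le
  obtain ⟨i, hi, hiS⟩ := hx.exists_notMem_finset S
  exact Set.mem_iUnion.2 ⟨⟨i, hiS⟩, hi⟩

theorem ediam_closedBall_le (x : ℚ_[p]) (r : ℝ) :
    Metric.ediam (Metric.closedBall x r) ≤ ENNReal.ofReal r := by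
  refine Metric.ediam_le fun y hy z hz => ?_
  rw [mem_closedBall_iff_norm] at hy hz
  rw [edist_dist, dist_eq_norm]
  exact ENNReal.ofReal_le_ofReal (by simpa using norm_sub_le_of_le hy hz)

/-- The height of the fraction `z.2 / z.1`. -/
def height (z : ℤ × ℤ) : ℝ := (max |z.1| |z.2| : ℤ)

theorem abs_fst_le_height (z : ℤ × ℤ) : |(z.1 : ℝ)| ≤ height z := by
  rw [height, ← Int.cast_abs, Int.cast_le]
  exact le_max_left _ _

theorem abs_snd_le_height (z : ℤ × ℤ) : |(z.2 : ℝ)| ≤ height z := by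
  rw [height, ← Int.cast_abs, Int.cast_le]
  exact le_max_right _ _

theorem height_nonneg (z : ℤ × ℤ) : 0 ≤ height z := (abs_nonneg _).trans (abs_fst_le_height z)

theorem height_smul (n : ℤ) (z : ℤ × ℤ) : height (n • z) = |(n : ℝ)| * height z := by
  simp only [height, Prod.smul_fst, Prod.smul_snd, smul_eq_mul, abs_mul, Int.cast_max,
    Int.cast_mul, Int.cast_abs]
  exact (mul_max_of_nonneg _ _ (abs_nonneg _)).symm

theorem finite_height_lt (B : ℝ) : {z | height z < B}.Finite := by
  obtain ⟨n, hn⟩ := exists_int_gt B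
  refine (Set.finite_Icc ((-n, -n) : ℤ × ℤ) (n, n)).subset fun z hz => ?_
  have hmax : max |z.1| |z.2| < n := Int.cast_lt.1 (lt_trans hz hn)
  obtain ⟨h₁, h₂⟩ := max_lt_iff.1 hmax
  exact ⟨⟨(abs_lt.1 h₁).1.le, (abs_lt.1 h₂).1.le⟩, ⟨(abs_lt.1 h₁).2.le, (abs_lt.1 h₂).2.le⟩⟩

theorem summable_height_rpow {k : ℝ} (hk : 2 < k) :
    Summable fun z : ℤ × ℤ => height z ^ (-k) := by
  have h := EisensteinSeries.summable_one_div_norm_rpow hk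
  rw [← (finTwoArrowEquiv ℤ).symm.summable_iff] at h
  refine h.congr fun z => ?_
  simp only [Function.comp, finTwoArrowEquiv_symm_apply, EisensteinSeries.norm_eq_max_natAbs]
  simp [height]

/-- The points with infinitely many approximations by fractions with denominator prime to `p`. -/
def primApprox (p : ℕ) [Fact p.Prime] (τ : ℝ) : Set ℚ_[p] :=
  {x | {z : ℤ × ℤ | ¬ (p : ℤ) ∣ z.1 ∧
    ‖x * (z.1 : ℚ_[p]) - (z.2 : ℚ_[p])‖ ≤ height z ^ (-τ)}.Infinite}

theorem norm_intCast_eq_one_of_not_dvd {q : ℤ} (h : ¬ (p : ℤ) ∣ q) : ‖(q : ℚ_[p])‖ = 1 := by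
  rw [Padic.norm_intCast_eq_one_iff, isCoprime_comm]
  exact (Prime.coprime_iff_not_dvd (Nat.prime_iff_prime_int.1 Fact.out)).2 h

theorem mem_closedBall_div_of_not_dvd {x : ℚ_[p]} {q r : ℤ} {ε : ℝ} (hq : ¬ (p : ℤ) ∣ q)
    (h : ‖x * (q : ℚ_[p]) - (r : ℚ_[p])‖ ≤ ε) :
    x ∈ Metric.closedBall ((r : ℚ_[p]) / (q : ℚ_[p])) ε := by
  have hnorm := norm_intCast_eq_one_of_not_dvd hq
  have hq0 : (q : ℚ_[p]) ≠ 0 := norm_ne_zero_iff.1 (by simp [hnorm])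
  have hdiv : x - (r : ℚ_[p]) / (q : ℚ_[p]) = (x * (q : ℚ_[p]) - (r : ℚ_[p])) / (q : ℚ_[p]) := by
    field_simp
  rwa [mem_closedBall_iff_norm, hdiv, norm_div, hnorm, div_one]

theorem hausdorffMeasure_primApprox_eq_zero {τ s : ℝ} (hτ : 0 < τ) (hs : 2 / τ < s) :
    Measure.hausdorffMeasure s (primApprox p τ) = 0 := by
  have hs0 : 0 < s := (div_pos two_pos hτ).trans hs
  have hsub : primApprox p τ ⊆ {x | {z : ℤ × ℤ |
      x ∈ Metric.closedBall ((z.2 : ℚ_[p]) / (z.1 : ℚ_[p])) (height z ^ (-τ))}.Infinite} :=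
    fun x (hx : Set.Infinite _) => hx.mono fun z hz => mem_closedBall_div_of_not_dvd hz.1 hz.2
  refine measure_mono_null hsub (hausdorffMeasure_infinite_mem_eq_zero hs0 ?_)
  refine ne_top_of_le_ne_top (summable_height_rpow ((div_lt_iff₀' hτ).1 hs)).tsum_ofReal_ne_top
    (ENNReal.tsum_le_tsum fun z => ?_)
  calc Metric.ediam (Metric.closedBall ((z.2 : ℚ_[p]) / (z.1 : ℚ_[p])) (height z ^ (-τ))) ^ s
      ≤ ENNReal.ofReal (height z ^ (-τ)) ^ s := by
        gcongr
        exact ediam_closedBall_le _ _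
    _ = ENNReal.ofReal (height z ^ (-(τ * s))) := by
        rw [ENNReal.ofReal_rpow_of_nonneg (Real.rpow_nonneg (height_nonneg z) _) hs0.le,
          ← Real.rpow_mul (height_nonneg z), neg_mul]

theorem inv_abs_le_norm_intCast {r : ℤ} (hr : r ≠ 0) : |(r : ℝ)|⁻¹ ≤ ‖(r : ℚ_[p])‖ := by
  have hdvd : (p : ℤ) ^ padicValInt p r ∣ r := padicValInt_dvd r
  have hle : (p : ℝ) ^ padicValInt p r ≤ |(r : ℝ)| :=
    mod_cast Int.le_of_dvd (abs_pos.2 hr) ((dvd_abs _ _).2 hdvd)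
  rw [Padic.norm_eq_zpow_neg_valuation (mod_cast hr), Padic.valuation_intCast, zpow_neg,
    zpow_natCast]
  exact inv_anti₀ (pow_pos (prime_real_pos p) _) hle

theorem height_rpow_neg_lt_norm_snd {τ : ℝ} (hτ : 1 < τ) {z : ℤ × ℤ} (hz : 1 < height z)
    (hz2 : z.2 ≠ 0) : height z ^ (-τ) < ‖(z.2 : ℚ_[p])‖ :=
  calc height z ^ (-τ) < (height z)⁻¹ := by
        rw [← Real.rpow_neg_one]
        exact Real.rpow_lt_rpow_of_exponent_lt hz (neg_lt_neg hτ)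
    _ ≤ |(z.2 : ℝ)|⁻¹ := inv_anti₀ (abs_pos.2 (mod_cast hz2)) (abs_snd_le_height z)
    _ ≤ ‖(z.2 : ℚ_[p])‖ := inv_abs_le_norm_intCast hz2

theorem norm_snd_le_norm_fst_of_approx {τ : ℝ} (hτ : 1 < τ) {x : ℚ_[p]} (hx : ‖x‖ ≤ 1)
    {z : ℤ × ℤ} (hz : 1 < height z)
    (hxz : ‖x * (z.1 : ℚ_[p]) - (z.2 : ℚ_[p])‖ ≤ height z ^ (-τ)) :
    ‖(z.2 : ℚ_[p])‖ ≤ ‖(z.1 : ℚ_[p])‖ := by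
  by_contra! hlt
  have hxlt : ‖x * (z.1 : ℚ_[p])‖ < ‖(z.2 : ℚ_[p])‖ := by
    rw [norm_mul]
    exact (mul_le_of_le_one_left (norm_nonneg _) hx).trans_lt hlt
  have hne : z.2 ≠ 0 := fun h => by simp [h, (norm_nonneg _).not_gt] at hlt
  have heq : ‖x * (z.1 : ℚ_[p]) - (z.2 : ℚ_[p])‖ = ‖(z.2 : ℚ_[p])‖ := by
    rw [sub_eq_add_neg, Padic.add_eq_max_of_ne (by simpa using hxlt.ne), norm_neg,
      max_eq_right hxlt.le]
  exact ((height_rpow_neg_lt_norm_snd hτ hz hne).trans_le heq.ge).not_ge hxz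

theorem exists_eq_pow_smul_of_approx {τ : ℝ} (hτ : 1 < τ) {x : ℚ_[p]} (hx : ‖x‖ ≤ 1)
    {z : ℤ × ℤ} (hz : 1 < height z)
    (hxz : ‖x * (z.1 : ℚ_[p]) - (z.2 : ℚ_[p])‖ ≤ height z ^ (-τ)) :
    ∃ (a : ℕ) (w : ℤ × ℤ), z = (p : ℤ) ^ a • w ∧ ¬ (p : ℤ) ∣ w.1 := by
  have hnorm := norm_snd_le_norm_fst_of_approx hτ hx hz hxz
  have hfst : z.1 ≠ 0 := fun h₁ => by
    have h₂ : z.2 = 0 := by simpa [h₁] using hnorm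
    exact hz.not_ge (by simp [height, h₁, h₂])
  have hfin : FiniteMultiplicity (p : ℤ) z.1 :=
    Int.finiteMultiplicity_iff.2 ⟨by simpa using (Fact.out : p.Prime).ne_one, hfst⟩
  obtain ⟨q, hq, hpq⟩ := hfin.exists_eq_pow_mul_and_not_dvd
  have hdvd : (p : ℤ) ^ multiplicity (p : ℤ) z.1 ∣ z.2 := by
    rw [← Padic.norm_int_le_pow_iff_dvd]
    exact hnorm.trans ((Padic.norm_int_le_pow_iff_dvd _ _).2 (Dvd.intro q hq.symm))
  obtain ⟨r, hr⟩ := hdvd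
  exact ⟨_, (q, r), Prod.ext hq hr, hpq⟩

theorem norm_approx_le_of_pow_smul {τ : ℝ} (hτ : 2 ≤ τ) (x : ℚ_[p]) (a : ℕ) (w : ℤ × ℤ)
    (h : ‖x * (((p : ℤ) ^ a • w).1 : ℚ_[p]) - (((p : ℤ) ^ a • w).2 : ℚ_[p])‖ ≤
      height ((p : ℤ) ^ a • w) ^ (-τ)) :
    ‖x * (w.1 : ℚ_[p]) - (w.2 : ℚ_[p])‖ ≤ ((p : ℝ) ^ a)⁻¹ * height w ^ (-τ) := by
  have hpa : 0 < (p : ℝ) ^ a := pow_pos (prime_real_pos p) a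
  have hnorm : ‖x * (((p : ℤ) ^ a • w).1 : ℚ_[p]) - (((p : ℤ) ^ a • w).2 : ℚ_[p])‖ =
      ((p : ℝ) ^ a)⁻¹ * ‖x * (w.1 : ℚ_[p]) - (w.2 : ℚ_[p])‖ := by
    rw [← zpow_natCast, ← zpow_neg, ← Padic.norm_p_pow, ← norm_mul]
    congr 1
    push_cast [Prod.smul_fst, Prod.smul_snd, smul_eq_mul]
    ring
  have hheight : height ((p : ℤ) ^ a • w) ^ (-τ) ≤ ((p : ℝ) ^ a)⁻¹ ^ 2 * height w ^ (-τ) := by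
    rw [height_smul, Real.mul_rpow (abs_nonneg _) (height_nonneg w)]
    push_cast
    rw [abs_of_pos hpa, ← Real.rpow_neg_one, ← Real.rpow_natCast (_ ^ (-1 : ℝ)),
      ← Real.rpow_mul hpa.le]
    have := height_nonneg w
    gcongr
    · exact one_le_pow₀ (one_lt_prime_real p).le
    · push_cast
      linarith
  rw [hnorm, inv_mul_le_iff₀ hpa] at h
  calc ‖x * (w.1 : ℚ_[p]) - (w.2 : ℚ_[p])‖
      ≤ (p : ℝ) ^ a * (((p : ℝ) ^ a)⁻¹ ^ 2 * height w ^ (-τ)) := h.trans (by gcongr)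
    _ = ((p : ℝ) ^ a)⁻¹ * height w ^ (-τ) := by field_simp

theorem one_le_height {w : ℤ × ℤ} (hw : w.1 ≠ 0) : 1 ≤ height w :=
  le_trans (mod_cast Int.one_le_abs hw) (abs_fst_le_height w)

theorem finite_pow_le_inv {b t : ℝ} (hb : 1 < b) (ht : 0 < t) : {a : ℕ | t ≤ (b ^ a)⁻¹}.Finite := by
  obtain ⟨n, hn⟩ := pow_unbounded_of_one_lt t⁻¹ hb
  refine (Set.finite_lt_nat n).subset fun a ha => (pow_lt_pow_iff_right₀ hb).1 ?_
  exact ((le_inv_comm₀ ht (pow_pos (by linarith) _)).1 ha).trans_lt hn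

-- An irrational point admits, for each fraction `w`, finitely many multiples `p ^ a • w` that
-- approximate it well, so it needs infinitely many `w`.
theorem wellApprox_subset {τ : ℝ} (hτ : 2 ≤ τ) :
    wellApprox p τ ⊆ Set.range (fun r : ℚ => (r : ℚ_[p])) ∪ primApprox p τ := by
  rintro x ⟨hx, hinf⟩
  refine or_iff_not_imp_left.2 fun hrat hfin => hinf ?_
  have hmultiples (w : ℤ × ℤ) (hw : ¬ (p : ℤ) ∣ w.1) :
      {a : ℕ | ‖x * (w.1 : ℚ_[p]) - (w.2 : ℚ_[p])‖ ≤ ((p : ℝ) ^ a)⁻¹}.Finite := by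
    refine finite_pow_le_inv (one_lt_prime_real p) (norm_pos_iff.2 fun h0 => hrat ⟨w.2 / w.1, ?_⟩)
    have hw0 : (w.1 : ℚ_[p]) ≠ 0 :=
      norm_ne_zero_iff.1 (by simp [norm_intCast_eq_one_of_not_dvd hw])
    push_cast
    rw [div_eq_iff hw0]
    exact (sub_eq_zero.1 h0).symm
  refine ((finite_height_lt 2).union (hfin.biUnion fun w hw =>
    (hmultiples w hw.1).image fun a => (p : ℤ) ^ a • w)).subset fun z hz => ?_
  rcases lt_or_ge (height z) 2 with hlt | hge
  · exact Or.inl hlt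
  obtain ⟨a, w, rfl, hw⟩ := exists_eq_pow_smul_of_approx (by linarith) hx (by linarith) hz
  have hle := norm_approx_le_of_pow_smul hτ x a w hz
  have hpa : ((p : ℝ) ^ a)⁻¹ ≤ 1 := inv_le_one_of_one_le₀ (one_le_pow₀ (one_lt_prime_real p).le)
  have hone : height w ^ (-τ) ≤ 1 :=
    Real.rpow_le_one_of_one_le_of_nonpos (one_le_height fun h => hw (h ▸ dvd_zero _)) (by linarith)
  refine Or.inr (Set.mem_biUnion ⟨hw, hle.trans ?_⟩ ⟨a, hle.trans ?_, rfl⟩)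
  · exact mul_le_of_le_one_left (Real.rpow_nonneg (height_nonneg w) _) hpa
  · exact mul_le_of_le_one_right (inv_nonneg.2 (pow_nonneg (prime_real_pos p).le a)) hone

theorem dimH_wellApprox_le {τ : ℝ} (hτ : 2 ≤ τ) :
    dimH (wellApprox p τ) ≤ ENNReal.ofReal (2 / τ) := by
  refine (dimH_mono (wellApprox_subset hτ)).trans ?_
  rw [dimH_union, dimH_countable (Set.countable_range _)]
  refine max_le zero_le (dimH_le fun d hd => ?_)
  by_contra! hlt
  rw [← ENNReal.ofReal_coe_nnreal, ENNReal.ofReal_lt_ofReal_iff_of_nonneg (by positivity)] at hlt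
  rw [hausdorffMeasure_primApprox_eq_zero (by linarith) hlt] at hd
  exact ENNReal.zero_ne_top hd

end UpperBound

section MassDistribution

open Filter Topology

theorem measure_inter_le_of_measureReal_closedBall_le {X : Type*} [MetricSpace X]
    [MeasurableSpace X] {μ : Measure X} [IsFiniteMeasure μ] {A : Set X} {s : ℝ} (hs : 0 ≤ s)
    {K : ℝ} (hK : 0 ≤ K)
    (h : ∀ x ∈ A, ∀ r, 0 < r → r ≤ 1 → μ.real (Metric.closedBall x r) ≤ K * r ^ s)
    {E : Set X} (hE : Metric.ediam E ≤ 1 / 2) :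
    μ (E ∩ A) ≤ ENNReal.ofReal K * Metric.ediam E ^ s := by
  obtain hempty | ⟨x, hxE, hxA⟩ := (E ∩ A).eq_empty_or_nonempty
  · simp [hempty]
  have hfin : Metric.ediam E ≠ ∞ := ne_top_of_le_ne_top (by simp) hE
  set d := (Metric.ediam E).toReal
  have hd1 : d < 1 := by
    have : d ≤ 1 / 2 := by simpa using ENNReal.toReal_mono (by simp) hE
    linarith
  have hball (r : ℝ) (hr : r ∈ Set.Ioo d 1) : μ (E ∩ A) ≤ ENNReal.ofReal (K * r ^ s) := by
    refine le_trans (measure_mono fun y hy => ?_) (ENNReal.le_ofReal_iff_toReal_le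
      (measure_ne_top μ _) (by have := ENNReal.toReal_nonneg.trans_lt hr.1; positivity) |>.2
      (h x hxA r (ENNReal.toReal_nonneg.trans_lt hr.1) hr.2.le))
    rw [Metric.mem_closedBall, dist_edist]
    exact (ENNReal.toReal_mono hfin (Metric.edist_le_ediam_of_mem hy.1 hxE)).trans hr.1.le
  have hlim : Tendsto (fun r : ℝ => ENNReal.ofReal (K * r ^ s)) (𝓝[>] d)
      (𝓝 (ENNReal.ofReal (K * d ^ s))) :=
    (ENNReal.tendsto_ofReal (((Real.continuousAt_rpow_const d s (Or.inr hs)).tendsto).const_mul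
      K)).mono_left nhdsWithin_le_nhds
  calc μ (E ∩ A) ≤ ENNReal.ofReal (K * d ^ s) :=
        ge_of_tendsto hlim (by filter_upwards [Ioo_mem_nhdsGT hd1] with r hr using hball r hr)
    _ = ENNReal.ofReal K * Metric.ediam E ^ s := by
        rw [ENNReal.ofReal_mul hK, ← ENNReal.ofReal_rpow_of_nonneg ENNReal.toReal_nonneg hs,
          ENNReal.ofReal_toReal hfin]

theorem le_dimH_of_measureReal_closedBall_le {X : Type*} [MetricSpace X] [MeasurableSpace X]
    [BorelSpace X] {μ : Measure X} [IsFiniteMeasure μ] {A : Set X} (hA : MeasurableSet A)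
    (hμA : μ A ≠ 0) {s : ℝ≥0} {K : ℝ} (hK : 0 < K)
    (h : ∀ x ∈ A, ∀ r, 0 < r → r ≤ 1 → μ.real (Metric.closedBall x r) ≤ K * r ^ (s : ℝ)) :
    (s : ℝ≥0∞) ≤ dimH A := by
  have hK0 : ENNReal.ofReal K ≠ 0 := by simpa using hK
  have hle : (ENNReal.ofReal K)⁻¹ • μ.restrict A ≤ Measure.hausdorffMeasure (s : ℝ) := by
    refine Measure.le_hausdorffMeasure _ _ (1 / 2) (by simp) fun E hE => ?_
    rw [Measure.smul_apply, Measure.restrict_apply' hA, smul_eq_mul,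
      ENNReal.inv_mul_le_iff hK0 ENNReal.ofReal_ne_top]
    exact measure_inter_le_of_measureReal_closedBall_le s.coe_nonneg hK.le h hE
  refine le_dimH_of_hausdorffMeasure_ne_zero fun hzero => ?_
  have hAle := hle A
  rw [hzero, Measure.smul_apply, Measure.restrict_apply_self, smul_eq_mul, nonpos_iff_eq_zero,
    mul_eq_zero, ENNReal.inv_eq_zero] at hAle
  exact hAle.elim ENNReal.ofReal_ne_top hμA

theorem exists_measure_forall_le_ne_zero {X : Type*} [MeasurableSpace X] {μ : Measure X}
    [NeZero μ] {g : ℕ → X → ℝ≥0∞} (hg : ∀ m, Measurable (g m)) (h : ∑' m, ∫⁻ x, g m x ∂μ ≠ ∞) :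
    ∃ K : ℕ, μ {x | ∀ m, g m x ≤ K} ≠ 0 := by
  rw [← lintegral_tsum fun m => (hg m).aemeasurable] at h
  by_contra! hzero
  have hcover : ∀ᵐ x ∂μ, x ∈ ⋃ K : ℕ, {x | ∀ m, g m x ≤ K} := by
    filter_upwards [ae_lt_top (Measurable.tsum hg) h] with x hx
    obtain ⟨K, hK⟩ := ENNReal.exists_nat_gt hx.ne
    exact Set.mem_iUnion.2 ⟨K, fun m => (ENNReal.le_tsum m).trans hK.le⟩
  have hfalse : ∀ᵐ _ ∂μ, False := by
    filter_upwards [hcover, measure_eq_zero_iff_ae_notMem.1 (measure_iUnion_null hzero)] with x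
      hx hx' using hx' hx
  exact NeZero.ne μ (by simpa using hfalse)

end MassDistribution

section Energy

theorem norm_eq_pow_of_mem_closedBall_diff {t : ℚ_[p]} {m : ℕ}
    (ht : t ∈ Metric.closedBall 0 ((p : ℝ) ^ ((m + 1 : ℕ) : ℤ)) \
      Metric.closedBall 0 ((p : ℝ) ^ (m : ℤ))) : ‖t‖ = (p : ℝ) ^ (m + 1) := by
  obtain ⟨hle, hgt⟩ := ht
  rw [mem_closedBall_zero_iff] at hle hgt
  rw [Padic.norm_le_pow_iff_norm_lt_pow_add_one, not_lt] at hgt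
  exact le_antisymm (mod_cast hle) (mod_cast hgt)

theorem setIntegral_closedBall_diff_le_of_decay {g : ℚ_[p] → ℝ} {β C : ℝ}
    (h : ∀ t : ℚ_[p], t ≠ 0 → ‖g t‖ * ‖t‖ ^ β ≤ C) (m : ℕ) :
    ∫ t in Metric.closedBall 0 ((p : ℝ) ^ ((m + 1 : ℕ) : ℤ)) \
      Metric.closedBall 0 ((p : ℝ) ^ (m : ℤ)), g t ∂haar p ≤
      C * ((p : ℝ) ^ (m + 1)) ^ (1 - β) := by
  have hC : 0 ≤ C := (by positivity : (0 : ℝ) ≤ _).trans (h 1 one_ne_zero)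
  set X := (p : ℝ) ^ (m + 1)
  have hX : 0 < X := pow_pos (prime_real_pos p) _
  have hfin := (isCompact_closedBall (0 : ℚ_[p]) ((p : ℝ) ^ ((m + 1 : ℕ) : ℤ))).measure_lt_top
    (μ := haar p)
  set S := Metric.closedBall (0 : ℚ_[p]) ((p : ℝ) ^ ((m + 1 : ℕ) : ℤ)) \
    Metric.closedBall 0 ((p : ℝ) ^ (m : ℤ))
  have hbound (t) (ht : t ∈ S) : ‖g t‖ ≤ C * X ^ (-β) := by
    have hnorm := norm_eq_pow_of_mem_closedBall_diff ht
    have hdecay := h t (norm_ne_zero_iff.1 (hnorm.trans_ne hX.ne'))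
    rwa [hnorm, ← le_div_iff₀ (by positivity), div_eq_mul_inv, ← Real.rpow_neg hX.le] at hdecay
  calc ∫ t in S, g t ∂haar p ≤ C * X ^ (-β) * (haar p).real S :=
        (Real.le_norm_self _).trans (norm_setIntegral_le_of_norm_le_const
          ((measure_mono Set.sdiff_subset).trans_lt hfin) hbound)
    _ ≤ C * X ^ (-β) * X := by
        gcongr
        exact (measureReal_mono Set.sdiff_subset hfin.ne).trans_eq
          (by rw [haar_real_closedBall, zpow_natCast])
    _ = C * X ^ (1 - β) := by rw [mul_assoc, ← Real.rpow_add_one hX.ne', neg_add_eq_sub]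

theorem setIntegral_closedBall_le_of_decay {g : ℚ_[p] → ℝ} (hg : Continuous g)
    (hg1 : ∀ t, ‖g t‖ ≤ 1) {β C : ℝ} (hβ1 : β ≤ 1)
    (h : ∀ t : ℚ_[p], t ≠ 0 → ‖g t‖ * ‖t‖ ^ β ≤ C) (m : ℕ) :
    ∫ t in Metric.closedBall 0 ((p : ℝ) ^ (m : ℤ)), g t ∂haar p ≤
      (1 + C * m) * ((p : ℝ) ^ m) ^ (1 - β) := by
  have hC : 0 ≤ C := (by positivity : (0 : ℝ) ≤ _).trans (h 1 one_ne_zero)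
  induction m with
  | zero =>
    have hint := norm_setIntegral_le_of_norm_le_const (μ := haar p)
      (isCompact_closedBall (0 : ℚ_[p]) 1).measure_lt_top fun t _ => hg1 t
    rw [Measure.real, haar_closedBall_one] at hint
    simpa using (Real.le_norm_self _).trans hint
  | succ m ih =>
    have hsub : Metric.closedBall (0 : ℚ_[p]) ((p : ℝ) ^ (m : ℤ)) ⊆
        Metric.closedBall 0 ((p : ℝ) ^ ((m + 1 : ℕ) : ℤ)) :=
      Metric.closedBall_subset_closedBall
        (zpow_le_zpow_right₀ (one_lt_prime_real p).le (by lia))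
    have hmono : ((p : ℝ) ^ m) ^ (1 - β) ≤ ((p : ℝ) ^ (m + 1)) ^ (1 - β) :=
      Real.rpow_le_rpow (by positivity)
        (pow_le_pow_right₀ (one_lt_prime_real p).le m.le_succ) (by linarith)
    rw [← Set.sdiff_union_of_subset hsub, setIntegral_union Set.disjoint_sdiff_left
      measurableSet_closedBall ((integrableOn_closedBall hg _ _).mono_set Set.sdiff_subset)
      (integrableOn_closedBall hg _ _)]
    calc _ ≤ C * ((p : ℝ) ^ (m + 1)) ^ (1 - β) + (1 + C * m) * ((p : ℝ) ^ m) ^ (1 - β) :=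
          add_le_add (setIntegral_closedBall_diff_le_of_decay h m) ih
      _ ≤ C * ((p : ℝ) ^ (m + 1)) ^ (1 - β) + (1 + C * m) * ((p : ℝ) ^ (m + 1)) ^ (1 - β) := by
          gcongr
      _ = (1 + C * (m + 1 : ℕ)) * ((p : ℝ) ^ (m + 1)) ^ (1 - β) := by
          push_cast
          ring

theorem integral_measureReal_closedBall_le_of_decay (μ : Measure ℚ_[p]) [IsProbabilityMeasure μ]
    {β C : ℝ} (hβ1 : β ≤ 1)
    (h : ∀ ξ : ℚ_[p], ξ ≠ 0 → ‖fourierMeasure μ ξ‖ ^ 2 * ‖ξ‖ ^ β ≤ C) (m : ℕ) :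
    ∫ x, μ.real (Metric.closedBall x ((p : ℝ) ^ (-(m : ℤ)))) ∂μ ≤
      (1 + C * m) * ((p : ℝ) ^ m) ^ (-β) := by
  have hX : 0 < (p : ℝ) ^ m := pow_pos (prime_real_pos p) m
  have hint := setIntegral_closedBall_le_of_decay (g := fun t => ‖fourierMeasure μ t‖ ^ 2)
    ((continuous_fourierMeasure μ).norm.pow 2)
    (fun t => by simpa using norm_fourierMeasure_le_one μ t) hβ1 (by simpa using h) m
  rw [setIntegral_closedBall_norm_sq_fourierMeasure, zpow_natCast, sub_eq_neg_add,
    Real.rpow_add_one hX.ne', ← mul_assoc, mul_comm ((p : ℝ) ^ m)] at hint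
  exact le_of_mul_le_mul_right hint hX

theorem tsum_lintegral_measure_closedBall_ne_top_of_decay {μ : Measure ℚ_[p]}
    [IsProbabilityMeasure μ] {β C t : ℝ} (hβ1 : β ≤ 1) (ht : t < β)
    (h : ∀ ξ : ℚ_[p], ξ ≠ 0 → ‖fourierMeasure μ ξ‖ ^ 2 * ‖ξ‖ ^ β ≤ C) :
    ∑' m : ℕ, ∫⁻ x, ENNReal.ofReal (((p : ℝ) ^ m) ^ t *
      μ.real (Metric.closedBall x ((p : ℝ) ^ (-(m : ℤ))))) ∂μ ≠ ∞ := by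
  have hρ : ‖(p : ℝ) ^ (t - β)‖ < 1 := by
    rw [Real.norm_of_nonneg (by positivity)]
    exact Real.rpow_lt_one_of_one_lt_of_neg (one_lt_prime_real p) (sub_neg.2 ht)
  have hsum : Summable fun m : ℕ => (1 + C * m) * ((p : ℝ) ^ (t - β)) ^ m := by
    refine ((summable_geometric_of_norm_lt_one hρ).add
      ((summable_pow_mul_geometric_of_norm_lt_one 1 hρ).mul_left C)).congr fun m => ?_
    ring
  refine ne_top_of_le_ne_top hsum.tsum_ofReal_ne_top (ENNReal.tsum_le_tsum fun m => ?_)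
  have hX : 0 < (p : ℝ) ^ m := pow_pos (prime_real_pos p) m
  have hint : Integrable (fun x => μ.real (Metric.closedBall x ((p : ℝ) ^ (-(m : ℤ))))) μ :=
    .of_bound (C := 1) (constOnBalls_real_closedBall μ m).continuous.aestronglyMeasurable
      (.of_forall fun x => (Real.norm_of_nonneg measureReal_nonneg).trans_le measureReal_le_one)
  rw [← ofReal_integral_eq_lintegral_ofReal (hint.const_mul _) (.of_forall fun x => by positivity),
    integral_const_mul]
  refine ENNReal.ofReal_le_ofReal ?_
  calc ((p : ℝ) ^ m) ^ t * ∫ x, μ.real (Metric.closedBall x ((p : ℝ) ^ (-(m : ℤ)))) ∂μ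
      ≤ ((p : ℝ) ^ m) ^ t * ((1 + C * m) * ((p : ℝ) ^ m) ^ (-β)) := by
        gcongr
        exact integral_measureReal_closedBall_le_of_decay μ hβ1 h m
    _ = (1 + C * m) * ((p : ℝ) ^ (t - β)) ^ m := by
        rw [mul_left_comm, ← Real.rpow_add hX, ← sub_eq_add_neg, ← Real.rpow_natCast,
          ← Real.rpow_natCast, ← Real.rpow_mul p.cast_nonneg, ← Real.rpow_mul p.cast_nonneg,
          mul_comm (m : ℝ) (t - β)]

theorem ofReal_le_dimH_of_fourier_decay {A : Set ℚ_[p]} {μ : Measure ℚ_[p]} (hμ : μ ∈ probOn A)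
    {β C : ℝ} (hβ1 : β ≤ 1)
    (h : ∀ ξ : ℚ_[p], ξ ≠ 0 → ‖fourierMeasure μ ξ‖ ^ 2 * ‖ξ‖ ^ β ≤ C) :
    ENNReal.ofReal β ≤ dimH A := by
  obtain ⟨hprob, -, hsub⟩ := hμ
  refine ENNReal.le_of_forall_nnreal_lt fun t ht => ?_
  rw [ENNReal.coe_lt_ofReal] at ht
  set g : ℕ → ℚ_[p] → ℝ≥0∞ := fun m x => ENNReal.ofReal
    (((p : ℝ) ^ m) ^ (t : ℝ) * μ.real (Metric.closedBall x ((p : ℝ) ^ (-(m : ℤ)))))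
  have hg (m) : Measurable (g m) :=
    (continuous_const.mul (constOnBalls_real_closedBall μ m).continuous).measurable.ennreal_ofReal
  obtain ⟨K, hK⟩ := exists_measure_forall_le_ne_zero hg
    (tsum_lintegral_measure_closedBall_ne_top_of_decay hβ1 ht h)
  set F := {x | ∀ m, g m x ≤ K}
  have hFmeas : MeasurableSet F := by
    simpa only [F, Set.ofPred_forall] using
      MeasurableSet.iInter fun m => measurableSet_le (hg m) measurable_const
  rw [← measure_inter_conull (t := μ.support) Measure.measure_compl_support] at hK
  refine le_trans ?_ (dimH_mono (Set.inter_subset_right.trans hsub : F ∩ μ.support ⊆ A))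
  refine le_dimH_of_measureReal_closedBall_le
    (hFmeas.inter Measure.isClosed_support.measurableSet) hK (K := K + 1) (by positivity)
    fun x hx r hr0 hr1 => ?_
  obtain ⟨m, hmr, -, hball⟩ := exists_closedBall_eq_pow p hr0 hr1
  have hX : 0 < (p : ℝ) ^ m := pow_pos (prime_real_pos p) m
  have hgK : ((p : ℝ) ^ m) ^ (t : ℝ) * μ.real (Metric.closedBall x r) ≤ K := by
    rw [hball, ← ENNReal.ofReal_le_ofReal_iff K.cast_nonneg, ENNReal.ofReal_natCast]
    exact hx.1 m
  calc μ.real (Metric.closedBall x r) ≤ K * ((p : ℝ) ^ (-(m : ℤ))) ^ (t : ℝ) := by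
        rw [zpow_neg, zpow_natCast, Real.inv_rpow hX.le, ← div_eq_mul_inv,
          le_div_iff₀' (by positivity)]
        exact hgK
    _ ≤ (K + 1) * r ^ (t : ℝ) := by
        gcongr
        linarith

end Energy

section Salem

theorem exists_rpow_mul_log_sq_le {a b : ℝ} (hab : a < b) :
    ∃ K : ℝ, 0 < K ∧ ∀ y : ℝ, 1 ≤ y → y ^ a * Real.log (1 + y) ^ 2 ≤ K * y ^ b := by
  have hε := sub_pos.2 hab
  set ε := b - a
  refine ⟨2 ^ ε * (4 / ε ^ 2), by positivity, fun y hy => ?_⟩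
  have hlog : Real.log (1 + y) ≤ (1 + y) ^ (ε / 2) / (ε / 2) :=
    Real.log_le_rpow_div (by linarith) (by positivity)
  have hlog0 : 0 ≤ Real.log (1 + y) := Real.log_nonneg (by linarith)
  calc y ^ a * Real.log (1 + y) ^ 2 ≤ y ^ a * ((1 + y) ^ (ε / 2) / (ε / 2)) ^ 2 := by gcongr
    _ = y ^ a * ((1 + y) ^ ε * (4 / ε ^ 2)) := by
        rw [div_pow, ← Real.rpow_natCast, ← Real.rpow_mul (by linarith)]
        field_simp
        norm_num [mul_comm]
    _ ≤ y ^ a * ((2 * y) ^ ε * (4 / ε ^ 2)) := by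
        gcongr
        linarith
    _ = 2 ^ ε * (4 / ε ^ 2) * y ^ b := by
        rw [Real.mul_rpow zero_le_two (by linarith), ← add_sub_cancel a b,
          Real.rpow_add (by linarith)]
        ring

theorem exists_norm_fourierMeasure_le_rpow {μ : Measure ℚ_[p]} {a b C : ℝ} (hab : a < b)
    (hC : 0 < C) (h : ∀ ξ : ℚ_[p], 1 ≤ ‖ξ‖ →
      ‖fourierMeasure μ ξ‖ ≤ C * (‖ξ‖ ^ a * Real.log (1 + ‖ξ‖) ^ 2)) :
    ∃ K : ℝ, 0 < K ∧ ∀ ξ : ℚ_[p], 1 ≤ ‖ξ‖ → ‖fourierMeasure μ ξ‖ ≤ K * ‖ξ‖ ^ b := by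
  obtain ⟨L, hL, hle⟩ := exists_rpow_mul_log_sq_le hab
  refine ⟨C * L, by positivity, fun ξ hξ => (h ξ hξ).trans ?_⟩
  rw [mul_assoc]
  exact mul_le_mul_of_nonneg_left (hle _ hξ) hC.le

theorem exists_measureReal_closedBall_le_rpow {μ : Measure ℚ_[p]} {a b C : ℝ} (hab : b < a)
    (hC : 0 < C) (h : ∀ (x : ℚ_[p]) (r : ℝ), 0 < r → r ≤ 1 →
      μ.real (Metric.closedBall x r) ≤ C * (r ^ a * Real.log (1 + r⁻¹) ^ 2)) :
    ∃ K : ℝ, 0 < K ∧ ∀ (x : ℚ_[p]) (r : ℝ), 0 < r → r ≤ 1 →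
      μ.real (Metric.closedBall x r) ≤ K * r ^ b := by
  obtain ⟨L, hL, hle⟩ := exists_rpow_mul_log_sq_le (neg_lt_neg hab)
  refine ⟨C * L, by positivity, fun x r hr0 hr1 => (h x r hr0 hr1).trans ?_⟩
  have hlog := hle _ ((one_le_inv₀ hr0).2 hr1)
  rw [Real.inv_rpow hr0.le, Real.inv_rpow hr0.le, ← Real.rpow_neg hr0.le, ← Real.rpow_neg hr0.le,
    neg_neg, neg_neg] at hlog
  rw [mul_assoc]
  gcongr

theorem exists_norm_sq_fourierMeasure_mul_rpow_le {μ : Measure ℚ_[p]} [IsProbabilityMeasure μ]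
    {β K : ℝ} (hβ : 0 ≤ β)
    (h : ∀ ξ : ℚ_[p], 1 ≤ ‖ξ‖ → ‖fourierMeasure μ ξ‖ ≤ K * ‖ξ‖ ^ (-(β / 2))) :
    ∃ C : ℝ, ∀ ξ : ℚ_[p], ξ ≠ 0 → ‖fourierMeasure μ ξ‖ ^ 2 * ‖ξ‖ ^ β ≤ C := by
  refine ⟨max 1 (K ^ 2), fun ξ hξ => ?_⟩
  have hξ0 : 0 < ‖ξ‖ := norm_pos_iff.2 hξ
  obtain hle | hge := le_total ‖ξ‖ 1
  · exact le_max_of_le_left (mul_le_one₀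
      (pow_le_one₀ (norm_nonneg _) (norm_fourierMeasure_le_one μ ξ)) (by positivity)
      (Real.rpow_le_one hξ0.le hle hβ))
  · refine le_max_of_le_right ?_
    calc ‖fourierMeasure μ ξ‖ ^ 2 * ‖ξ‖ ^ β ≤ (K * ‖ξ‖ ^ (-(β / 2))) ^ 2 * ‖ξ‖ ^ β := by
          gcongr
          exact h ξ hge
      _ = K ^ 2 * ‖ξ‖ ^ (-(β / 2) + -(β / 2) + β) := by
          rw [Real.rpow_add hξ0, Real.rpow_add hξ0]
          ring
      _ = K ^ 2 := by ring_nf; simp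

theorem ofReal_fourierDim_le_dimH (A : Set ℚ_[p]) : ENNReal.ofReal (fourierDim A) ≤ dimH A := by
  obtain htop | htop := eq_or_ne (dimH A) ∞
  · simp [htop]
  refine (ENNReal.ofReal_le_iff_le_toReal htop).2 (Real.sSup_le ?_ ENNReal.toReal_nonneg)
  rintro β ⟨-, hβ1, μ, hμ, C, hC⟩
  exact (ENNReal.ofReal_le_iff_le_toReal htop).1 (ofReal_le_dimH_of_fourier_decay hμ hβ1 hC)

theorem le_fourierDim_of_fourier_decay {A : Set ℚ_[p]} {μ : Measure ℚ_[p]} (hμ : μ ∈ probOn A)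
    {b C : ℝ} (hb0 : 0 < b) (hb1 : b ≤ 1) (hC : 0 < C) (h : ∀ ξ : ℚ_[p], 1 ≤ ‖ξ‖ →
      ‖fourierMeasure μ ξ‖ ≤ C * (‖ξ‖ ^ (-(b / 2)) * Real.log (1 + ‖ξ‖) ^ 2)) :
    b ≤ fourierDim A := by
  have hprob : IsProbabilityMeasure μ := hμ.1
  refine le_of_forall_lt_imp_le_of_dense fun c hc => (le_max_left c 0).trans ?_
  set β := max c 0
  have hβb : β < b := max_lt hc hb0
  have hβ0 : 0 ≤ β := le_max_right c 0
  obtain ⟨K, -, hK⟩ := exists_norm_fourierMeasure_le_rpow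
    (show -(b / 2) < -(β / 2) by linarith) hC h
  exact le_csSup ⟨1, fun _ hx => hx.2.1⟩
    ⟨hβ0, hβb.le.trans hb1, μ, hμ, exists_norm_sq_fourierMeasure_mul_rpow_le hβ0 hK⟩

end Salem

section Plancherel

theorem integrable_stdChar_mul {f : ℚ_[p] → ℂ} (hf : Integrable f (haar p)) (s : ℚ_[p]) :
    Integrable (fun x => stdChar (x * s) * f x) (haar p) :=
  hf.bdd_mul (c := 1) (continuous_stdChar.comp (by fun_prop)).aestronglyMeasurable
    (.of_forall fun _ => (norm_stdChar _).le)

theorem norm_fourierFun_le (f : ℚ_[p] → ℂ) (s : ℚ_[p]) :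
    ‖fourierFun f s‖ ≤ ∫ x, ‖f x‖ ∂haar p :=
  (norm_integral_le_integral_norm _).trans_eq (by simp only [norm_mul, norm_stdChar, one_mul])

theorem continuous_fourierFun {f : ℚ_[p] → ℂ} (hf : Integrable f (haar p)) :
    Continuous (fourierFun f) :=
  continuous_of_dominated (fun s => (integrable_stdChar_mul hf s).aestronglyMeasurable)
    (fun s => .of_forall fun x => by rw [norm_mul, norm_stdChar, one_mul]) hf.norm
    (.of_forall fun x => (continuous_stdChar.comp (by fun_prop)).mul continuous_const)

theorem integrable_norm_sq_fourierFun {f : ℚ_[p] → ℂ} (hf : Integrable f (haar p))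
    (ν : Measure ℚ_[p]) [IsFiniteMeasure ν] : Integrable (fun t => ‖fourierFun f t‖ ^ 2) ν :=
  .of_bound ((continuous_fourierFun hf).norm.pow 2).aestronglyMeasurable
    ((∫ x, ‖f x‖ ∂haar p) ^ 2) (.of_forall fun t => by
      rw [norm_pow, norm_norm]
      exact pow_le_pow_left₀ (norm_nonneg _) (norm_fourierFun_le f t) 2)

theorem integrable_mul_conj_prod {f : ℚ_[p] → ℂ} (hf : Integrable f (haar p)) :
    Integrable (fun z : ℚ_[p] × ℚ_[p] => f z.1 * (starRingEnd ℂ) (f z.2))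
      ((haar p).prod (haar p)) :=
  hf.mul_prod ((Complex.conjCLE : ℂ →L[ℝ] ℂ).integrable_comp hf)

theorem integrable_fourierMeasure_sub_mul {f : ℚ_[p] → ℂ} (hf : Integrable f (haar p))
    (ν : Measure ℚ_[p]) [IsFiniteMeasure ν] :
    Integrable (fun z : ℚ_[p] × ℚ_[p] =>
      fourierMeasure ν (z.1 - z.2) * (f z.1 * (starRingEnd ℂ) (f z.2)))
      ((haar p).prod (haar p)) :=
  (integrable_mul_conj_prod hf).bdd_mul
    ((continuous_fourierMeasure ν).comp (by fun_prop)).aestronglyMeasurable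
    (.of_forall fun _ => norm_fourierMeasure_le ν _)

theorem norm_sq_fourierFun (f : ℚ_[p] → ℂ) (t : ℚ_[p]) :
    ((‖fourierFun f t‖ ^ 2 : ℝ) : ℂ) = ∫ z, stdChar (t * (z.1 - z.2)) *
      (f z.1 * (starRingEnd ℂ) (f z.2)) ∂(haar p).prod (haar p) := by
  have hconj : (starRingEnd ℂ) (fourierFun f t) =
      ∫ y, (starRingEnd ℂ) (stdChar (y * t) * f y) ∂haar p := integral_conj.symm
  rw [← Complex.normSq_eq_norm_sq, ← Complex.mul_conj, hconj, fourierFun, ← integral_prod_mul]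
  refine integral_congr_ae (.of_forall fun z => ?_)
  simp only [mul_comm t, sub_mul, stdChar_sub, map_mul]
  ring

theorem integral_norm_sq_fourierFun {f : ℚ_[p] → ℂ} (hf : Integrable f (haar p))
    (ν : Measure ℚ_[p]) [IsFiniteMeasure ν] :
    ((∫ t, ‖fourierFun f t‖ ^ 2 ∂ν : ℝ) : ℂ) =
      ∫ z, fourierMeasure ν (z.1 - z.2) * (f z.1 * (starRingEnd ℂ) (f z.2))
        ∂(haar p).prod (haar p) := by
  rw [← integral_complex_ofReal]
  simp only [norm_sq_fourierFun]
  rw [integral_integral_swap]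
  · simp only [integral_mul_const, fourierMeasure]
  · exact ((integrable_mul_conj_prod hf).comp_snd ν).bdd_mul (c := 1)
      (continuous_stdChar.comp (by fun_prop)).aestronglyMeasurable
      (.of_forall fun _ => (norm_stdChar _).le)

theorem ofReal_integral_norm_sq_fourierFun {f : ℚ_[p] → ℂ} (hf : Integrable f (haar p))
    (ν : Measure ℚ_[p]) [IsFiniteMeasure ν] :
    ENNReal.ofReal (∫ t, ‖fourierFun f t‖ ^ 2 ∂ν) = ∫⁻ t, ‖fourierFun f t‖ₑ ^ 2 ∂ν := by
  rw [ofReal_integral_eq_lintegral_ofReal (integrable_norm_sq_fourierFun hf ν)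
    (.of_forall fun t => by positivity)]
  simp only [ENNReal.ofReal_pow (norm_nonneg _), ofReal_norm]

theorem lintegral_enorm_sq_fourierFun_le {f : ℚ_[p] → ℂ} (hf : Integrable f (haar p))
    (μ ν : Measure ℚ_[p]) [IsFiniteMeasure μ] [IsFiniteMeasure ν] :
    ∫⁻ t, ‖fourierFun f t‖ₑ ^ 2 ∂μ ≤ ∫⁻ t, ‖fourierFun f t‖ₑ ^ 2 ∂ν +
      ∫⁻ z, ‖fourierMeasure μ (z.1 - z.2) - fourierMeasure ν (z.1 - z.2)‖ₑ *
        (‖f z.1‖ₑ * ‖f z.2‖ₑ) ∂(haar p).prod (haar p) := by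
  set I := ∫ t, ‖fourierFun f t‖ ^ 2 ∂μ
  set J := ∫ t, ‖fourierFun f t‖ ^ 2 ∂ν with hJ
  have hsub : ((I - J : ℝ) : ℂ) = ∫ z, (fourierMeasure μ (z.1 - z.2) -
      fourierMeasure ν (z.1 - z.2)) * (f z.1 * (starRingEnd ℂ) (f z.2))
        ∂(haar p).prod (haar p) := by
    rw [Complex.ofReal_sub, integral_norm_sq_fourierFun hf, integral_norm_sq_fourierFun hf,
      ← integral_sub (integrable_fourierMeasure_sub_mul hf μ)
        (integrable_fourierMeasure_sub_mul hf ν)]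
    simp only [sub_mul]
  calc ∫⁻ t, ‖fourierFun f t‖ₑ ^ 2 ∂μ = ENNReal.ofReal I :=
        (ofReal_integral_norm_sq_fourierFun hf μ).symm
    _ ≤ ENNReal.ofReal (J + ‖((I - J : ℝ) : ℂ)‖) := by
        rw [Complex.norm_real]
        exact ENNReal.ofReal_le_ofReal (by linarith [Real.le_norm_self (I - J)])
    _ = ∫⁻ t, ‖fourierFun f t‖ₑ ^ 2 ∂ν + ‖((I - J : ℝ) : ℂ)‖ₑ := by
        rw [ENNReal.ofReal_add (integral_nonneg fun t => by positivity) (norm_nonneg _), hJ,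
          ofReal_integral_norm_sq_fourierFun hf, ofReal_norm]
    _ ≤ _ := by
        rw [hsub]
        refine add_le_add_right ((enorm_integral_le_lintegral_enorm _).trans_eq ?_) _
        simp only [enorm_mul, RCLike.enorm_conj]

theorem mul_le_sq_add_sq (a b : ℝ≥0∞) : a * b ≤ a ^ 2 + b ^ 2 := by
  obtain h | h := le_total a b
  · exact (mul_le_mul_left h b).trans_eq (sq b).symm |>.trans le_add_self
  · exact (mul_le_mul_right h a).trans_eq (sq a).symm |>.trans le_self_add

theorem measurableSet_norm_sub_le_one :
    MeasurableSet {z : ℚ_[p] × ℚ_[p] | ‖z.1 - z.2‖ ≤ 1} :=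
  measurableSet_le (by fun_prop) measurable_const

theorem setLIntegral_norm_sub_le_one_fst {g : ℚ_[p] → ℝ≥0∞} (hg : AEMeasurable g (haar p)) :
    ∫⁻ z in {z : ℚ_[p] × ℚ_[p] | ‖z.1 - z.2‖ ≤ 1}, g z.1 ∂(haar p).prod (haar p) =
      ∫⁻ x, g x ∂haar p := by
  have hsection (x : ℚ_[p]) : (fun y => {z : ℚ_[p] × ℚ_[p] | ‖z.1 - z.2‖ ≤ 1}.indicator
      (fun z => g z.1) (x, y)) = (Metric.closedBall x 1).indicator fun _ => g x := by
    ext y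
    simp only [Set.indicator, Set.mem_ofPred_eq, mem_closedBall_iff_norm, norm_sub_rev x y]
  rw [← lintegral_indicator measurableSet_norm_sub_le_one,
    lintegral_prod _ (hg.comp_fst.indicator measurableSet_norm_sub_le_one)]
  simp only [hsection, lintegral_indicator_const measurableSet_closedBall, haar_closedBall_one,
    mul_one]

theorem setLIntegral_norm_sub_le_one_snd {g : ℚ_[p] → ℝ≥0∞} (hg : AEMeasurable g (haar p)) :
    ∫⁻ z in {z : ℚ_[p] × ℚ_[p] | ‖z.1 - z.2‖ ≤ 1}, g z.2 ∂(haar p).prod (haar p) =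
      ∫⁻ x, g x ∂haar p := by
  rw [← setLIntegral_norm_sub_le_one_fst hg,
    ← Measure.measurePreserving_swap.setLIntegral_comp_preimage_emb
      MeasurableEquiv.prodComm.measurableEmbedding]
  simp only [Prod.fst_swap, Set.preimage_ofPred_eq, Prod.snd_swap, norm_sub_rev]

theorem setLIntegral_enorm_sq_fourierFun_le {f : ℚ_[p] → ℂ} (hf : Integrable f (haar p)) :
    ∫⁻ t in Metric.closedBall 0 1, ‖fourierFun f t‖ₑ ^ 2 ∂haar p ≤
      2 * ∫⁻ x, ‖f x‖ₑ ^ 2 ∂haar p := by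
  set T := {z : ℚ_[p] × ℚ_[p] | ‖z.1 - z.2‖ ≤ 1}
  have hf2 : AEMeasurable (fun x => ‖f x‖ₑ ^ 2) (haar p) :=
    hf.aestronglyMeasurable.enorm.pow_const 2
  have hball (z : ℚ_[p] × ℚ_[p]) (w : ℝ≥0∞) :
      ‖fourierMeasure ((haar p).restrict (Metric.closedBall 0 1)) (z.1 - z.2) -
        fourierMeasure 0 (z.1 - z.2)‖ₑ * w = T.indicator (fun _ => w) z := by
    have h := setIntegral_closedBall_stdChar_sub_mul z.2 z.1 0
    simp only [zpow_zero, neg_zero] at h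
    simp only [fourierMeasure, integral_zero_measure, sub_zero, mul_comm _ (z.1 - z.2), h]
    by_cases hz : ‖z.1 - z.2‖ ≤ 1
    · rw [Set.indicator_of_mem (mem_closedBall_iff_norm.2 hz),
        Set.indicator_of_mem (show z ∈ T from hz)]
      simp
    · rw [Set.indicator_of_notMem (mt mem_closedBall_iff_norm.1 hz),
        Set.indicator_of_notMem (show z ∉ T from hz)]
      simp
  calc ∫⁻ t in Metric.closedBall 0 1, ‖fourierFun f t‖ₑ ^ 2 ∂haar p
      ≤ ∫⁻ z in T, ‖f z.1‖ₑ * ‖f z.2‖ₑ ∂(haar p).prod (haar p) := by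
        refine (lintegral_enorm_sq_fourierFun_le hf _ 0).trans_eq ?_
        rw [lintegral_zero_measure, zero_add, ← lintegral_indicator measurableSet_norm_sub_le_one]
        exact lintegral_congr fun z => hball z _
    _ ≤ ∫⁻ z in T, (‖f z.1‖ₑ ^ 2 + ‖f z.2‖ₑ ^ 2) ∂(haar p).prod (haar p) :=
        lintegral_mono fun z => mul_le_sq_add_sq _ _
    _ = 2 * ∫⁻ x, ‖f x‖ₑ ^ 2 ∂haar p := by
        rw [lintegral_add_left' hf2.comp_fst.restrict, setLIntegral_norm_sub_le_one_fst hf2,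
          setLIntegral_norm_sub_le_one_snd hf2, two_mul]

theorem lintegral_ballAverage_le {μ : Measure ℚ_[p]} [IsFiniteMeasure μ]
    (hμ : μ (Metric.closedBall 0 1)ᶜ = 0) {n : ℕ} {M : ℝ≥0∞}
    (hM : ∀ x, μ (Metric.closedBall x ((p : ℝ) ^ (-(n : ℤ)))) ≤ M) {G : ℚ_[p] → ℝ≥0∞}
    (hG : Measurable G) :
    ∫⁻ t, G t ∂ballAverage μ n ≤
      (p : ℝ≥0∞) ^ n * M * ∫⁻ t in Metric.closedBall 0 1, G t ∂haar p := by
  have hdens := (constOnBalls_measure_closedBall μ n).continuous.measurable.const_mul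
    ((p : ℝ≥0∞) ^ n)
  rw [ballAverage_eq_withDensity, lintegral_withDensity_eq_lintegral_mul _ hdens hG,
    ← lintegral_const_mul _ hG, ← lintegral_indicator measurableSet_closedBall]
  refine lintegral_mono fun t => ?_
  by_cases ht : t ∈ Metric.closedBall 0 1
  · rw [Set.indicator_of_mem ht, Pi.mul_apply]
    gcongr
    exact hM t
  · have hdisj : Metric.closedBall t ((p : ℝ) ^ (-(n : ℤ))) ⊆ (Metric.closedBall 0 1)ᶜ := by
      refine fun y hy hy1 => ht ?_
      rw [IsUltrametricDist.closedBall_eq_of_mem hy1, Metric.mem_closedBall']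
      exact (Metric.mem_closedBall.1 hy).trans
        (zpow_le_one_of_nonpos₀ (one_lt_prime_real p).le (by lia))
    simp only [Pi.mul_apply, measure_mono_null hdisj hμ, mul_zero, zero_mul, zero_le]

theorem lintegral_enorm_sq_fourierFun_le_of_scale {μ : Measure ℚ_[p]} [IsFiniteMeasure μ]
    (hμ : μ (Metric.closedBall 0 1)ᶜ = 0) {n : ℕ} {M A : ℝ≥0∞}
    (hM : ∀ x, μ (Metric.closedBall x ((p : ℝ) ^ (-(n : ℤ)))) ≤ M)
    (hA : ∀ s : ℚ_[p], (p : ℝ) ^ n < ‖s‖ → ‖fourierMeasure μ s‖ₑ ≤ A)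
    {f : ℚ_[p] → ℂ} (hf : Integrable f (haar p)) :
    ∫⁻ t, ‖fourierFun f t‖ₑ ^ 2 ∂μ ≤
      (p : ℝ≥0∞) ^ n * M * (2 * ∫⁻ x, ‖f x‖ₑ ^ 2 ∂haar p) +
        A * (∫⁻ x, ‖f x‖ₑ ∂haar p) ^ 2 := by
  have hfm := hf.aestronglyMeasurable.enorm
  refine (lintegral_enorm_sq_fourierFun_le hf μ (ballAverage μ n)).trans (add_le_add ?_ ?_)
  · refine (lintegral_ballAverage_le hμ hM
      ((continuous_fourierFun hf).measurable.enorm.pow_const 2)).trans ?_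
    gcongr
    exact setLIntegral_enorm_sq_fourierFun_le hf
  · have htail (s : ℚ_[p]) :
        ‖fourierMeasure μ s - fourierMeasure (ballAverage μ n) s‖ₑ ≤ A := by
      rw [fourierMeasure_ballAverage]
      by_cases hs : s ∈ Metric.closedBall 0 ((p : ℝ) ^ n)
      · simp [hs]
      · rw [Set.indicator_of_notMem hs, sub_zero]
        exact hA s (by rwa [mem_closedBall_zero_iff, not_le] at hs)
    calc _ ≤ ∫⁻ z, A * (‖f z.1‖ₑ * ‖f z.2‖ₑ) ∂(haar p).prod (haar p) :=
          lintegral_mono fun z => by gcongr; exact htail _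
      _ = _ := by
          rw [sq, ← lintegral_prod_mul hfm hfm]
          exact lintegral_const_mul'' A (hfm.comp_fst.mul hfm.comp_snd)

end Plancherel

section Dyadic

variable {E : Type*} [NormedAddCommGroup E]

/-- The dyadic shells of a normed group: the `0`-th is the complement of the open unit ball, the
`(j + 1)`-st is `2⁻⁽ʲ⁺¹⁾ ≤ ‖z‖ < 2⁻ʲ`. -/
def dyadicShell (E : Type*) [NormedAddCommGroup E] : ℕ → Set E :=
  disjointed fun j => {z | ((2 : ℝ) ^ j)⁻¹ ≤ ‖z‖}

/-- The truncation of a vector to the `j`-th dyadic shell. Composing it with a function `f`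
decomposes `f` according to the size of its values. -/
noncomputable def dyadicPart (j : ℕ) : E → E := (dyadicShell E j).indicator id

theorem one_le_norm_of_mem_dyadicShell_zero {z : E} (hz : z ∈ dyadicShell E 0) : 1 ≤ ‖z‖ := by
  simpa [dyadicShell] using hz

theorem norm_mem_Ico_of_mem_dyadicShell_succ {z : E} {j : ℕ} (hz : z ∈ dyadicShell E (j + 1)) :
    ‖z‖ ∈ Set.Ico ((2 : ℝ) ^ (j + 1))⁻¹ (2 ^ j)⁻¹ := by
  have hmono : Monotone fun j : ℕ => {z : E | ((2 : ℝ) ^ j)⁻¹ ≤ ‖z‖} := fun i j hij w hw => by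
    simp only [Set.mem_ofPred_eq] at hw ⊢
    exact (inv_anti₀ (by positivity) (pow_le_pow_right₀ one_le_two hij)).trans hw
  rw [dyadicShell, hmono.disjointed_add_one] at hz
  exact ⟨hz.1, not_le.1 hz.2⟩

theorem exists_mem_dyadicShell {z : E} (hz : z ≠ 0) : ∃ j, z ∈ dyadicShell E j := by
  obtain ⟨j, hj⟩ := exists_pow_lt_of_lt_one (norm_pos_iff.2 hz) (one_half_lt_one (α := ℝ))
  have : z ∈ ⋃ j, dyadicShell E j := by
    rw [dyadicShell, iUnion_disjointed]
    exact Set.mem_iUnion.2 ⟨j, by simpa using hj.le⟩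
  exact Set.mem_iUnion.1 this

theorem measurable_dyadicPart [MeasurableSpace E] [OpensMeasurableSpace E] (j : ℕ) :
    Measurable (dyadicPart j : E → E) :=
  measurable_id.indicator <|
    .disjointed (fun _ => measurableSet_le measurable_const measurable_norm) j

theorem dyadicPart_of_mem {z : E} {j : ℕ} (hz : z ∈ dyadicShell E j) : dyadicPart j z = z :=
  Set.indicator_of_mem hz _

theorem dyadicPart_of_notMem {z : E} {j : ℕ} (hz : z ∉ dyadicShell E j) : dyadicPart j z = 0 :=
  Set.indicator_of_notMem hz _

theorem hasSum_comp_dyadicPart {F : Type*} [AddCommMonoid F] [TopologicalSpace F] {g : E → F}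
    (hg : g 0 = 0) (z : E) : HasSum (fun j => g (dyadicPart j z)) (g z) := by
  rcases eq_or_ne z 0 with rfl | hz
  · have : ∀ j, dyadicPart j (0 : E) = 0 := fun j => by simp [dyadicPart]
    simpa only [this, hg] using hasSum_zero
  · obtain ⟨k, hk⟩ := exists_mem_dyadicShell hz
    have hne : ∀ j, j ≠ k → g (dyadicPart j z) = 0 := fun j hj => by
      rw [dyadicPart_of_notMem (Set.disjoint_right.1 (disjoint_disjointed _ hj) hk), hg]
    simpa only [dyadicPart_of_mem hk] using hasSum_single k hne

theorem enorm_dyadicPart_zero_le {q : ℝ} (hq : 1 ≤ q) (z : E) : ‖dyadicPart 0 z‖ₑ ≤ ‖z‖ₑ ^ q := by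
  by_cases hz : z ∈ dyadicShell E 0
  · have h1 : 1 ≤ ‖z‖ₑ := by
      rw [← ofReal_norm]
      exact ENNReal.one_le_ofReal.2 (one_le_norm_of_mem_dyadicShell_zero hz)
    simpa only [dyadicPart_of_mem hz, ENNReal.rpow_one] using
      ENNReal.rpow_le_rpow_of_exponent_le h1 hq
  · simp [dyadicPart_of_notMem hz]

theorem enorm_dyadicPart_succ_pow_le {q : ℝ} (hq : 0 ≤ q) {n : ℕ} (hn : n ≠ 0) (j : ℕ) (z : E) :
    ‖dyadicPart (j + 1) z‖ₑ ^ n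
      ≤ ENNReal.ofReal (2 ^ n * ((2 : ℝ) ^ (j + 1)) ^ (q - n)) * ‖z‖ₑ ^ q := by
  by_cases hz : z ∈ dyadicShell E (j + 1)
  · obtain ⟨hl, hu⟩ := norm_mem_Ico_of_mem_dyadicShell_succ hz
    have hz0 : 0 ≤ ‖z‖ := norm_nonneg z
    have hY : (0 : ℝ) < 2 ^ (j + 1) := by positivity
    have hlow : 1 ≤ ‖z‖ * 2 ^ (j + 1) := by rwa [← inv_le_iff_one_le_mul₀ hY]
    have hupp : ‖z‖ * 2 ^ (j + 1) ≤ 2 := by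
      have : ‖z‖ * 2 ^ j ≤ 1 := by
        simpa using (le_mul_inv_iff₀ (b := 1) (pow_pos two_pos j)).1 (by simpa using hu.le)
      rw [pow_succ, ← mul_assoc]
      exact mul_le_of_le_one_left two_pos.le this
    have key : ‖z‖ ^ n ≤ 2 ^ n * ((2 : ℝ) ^ (j + 1)) ^ (q - n) * ‖z‖ ^ q := by
      calc ‖z‖ ^ n = (‖z‖ * 2 ^ (j + 1)) ^ n * ((2 : ℝ) ^ (j + 1)) ^ (-n : ℝ) := by
            rw [mul_pow, Real.rpow_neg hY.le, Real.rpow_natCast,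
              mul_inv_cancel_right₀ (by positivity)]
        _ ≤ 2 ^ n * (‖z‖ * 2 ^ (j + 1)) ^ q * ((2 : ℝ) ^ (j + 1)) ^ (-n : ℝ) := by
            refine mul_le_mul_of_nonneg_right ?_ (by positivity)
            exact (pow_le_pow_left₀ (by positivity) hupp n).trans
              (le_mul_of_one_le_right (by positivity) (Real.one_le_rpow hlow hq))
        _ = _ := by rw [Real.mul_rpow hz0 hY.le, sub_eq_add_neg, Real.rpow_add hY]; ring
    rw [dyadicPart_of_mem hz, ← ofReal_norm, ← ENNReal.ofReal_pow hz0,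
      ENNReal.ofReal_rpow_of_nonneg hz0 hq, ← ENNReal.ofReal_mul (by positivity)]
    exact ENNReal.ofReal_le_ofReal key
  · simp [dyadicPart_of_notMem hz, hn]

end Dyadic

section Restriction

theorem eLpNorm_two_eq_lintegral {α E : Type*} [MeasurableSpace α] [NormedAddCommGroup E]
    (f : α → E) (μ : Measure α) : eLpNorm f 2 μ = (∫⁻ x, ‖f x‖ₑ ^ 2 ∂μ) ^ (1 / 2 : ℝ) := by
  simp [eLpNorm_eq_lintegral_rpow_enorm_toReal two_ne_zero ENNReal.ofNat_ne_top]

theorem eLpNorm_le_tsum_of_hasSum {α E : Type*} [MeasurableSpace α] [NormedAddCommGroup E]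
    {μ : Measure α} {r : ℝ≥0∞} (hr : 1 ≤ r) {f : ℕ → α → E} {g : α → E}
    (hf : ∀ j, AEStronglyMeasurable (f j) μ) (hfg : ∀ x, HasSum (fun j => f j x) (g x)) :
    eLpNorm g r μ ≤ ∑' j, eLpNorm (f j) r μ := by
  have hsum : ∀ n, AEStronglyMeasurable (∑ j ∈ Finset.range n, f j) μ := fun n =>
    Finset.aestronglyMeasurable_sum _ fun j _ => hf j
  refine (Lp.eLpNorm_lim_le_liminf_eLpNorm hsum g (.of_forall fun x => ?_)).trans ?_
  · simpa only [Finset.sum_apply] using (hfg x).tendsto_sum_nat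
  · exact Filter.liminf_le_of_frequently_le' <| .of_forall fun n =>
      (eLpNorm_sum_le (fun j _ => hf j) hr).trans (ENNReal.sum_le_tsum _)

theorem integrable_dyadicPart_comp {f : ℚ_[p] → ℂ} (hf : Integrable f (haar p)) (j : ℕ) :
    Integrable (dyadicPart j ∘ f) (haar p) :=
  hf.mono ((measurable_dyadicPart j).comp_aemeasurable hf.aemeasurable).aestronglyMeasurable
    (.of_forall fun _ => norm_indicator_le_norm_self _ _)

theorem hasSum_fourierFun_dyadicPart {f : ℚ_[p] → ℂ} (hf : Integrable f (haar p)) (s : ℚ_[p]) :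
    HasSum (fun j => fourierFun (dyadicPart j ∘ f) s) (fourierFun f s) := by
  have hnorm : ∀ z : ℂ, HasSum (fun j => ‖dyadicPart j z‖) ‖z‖ :=
    hasSum_comp_dyadicPart norm_zero
  refine hasSum_integral_of_dominated_convergence (fun j x => ‖dyadicPart j (f x)‖)
    (fun j => (integrable_stdChar_mul (integrable_dyadicPart_comp hf j) s).aestronglyMeasurable)
    (fun j => .of_forall fun x => by simp only [Function.comp_apply, norm_mul, norm_stdChar,
      one_mul, le_refl])
    (.of_forall fun x => (hnorm (f x)).summable) ?_ (.of_forall fun x => ?_)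
  · simpa only [(hnorm _).tsum_eq] using hf.norm
  · exact (hasSum_comp_dyadicPart (g := id) rfl (f x)).mul_left _

theorem exists_nat_pow_mul_rpow_le {x a b u v : ℝ} (hx : 1 < x) (ha : 0 < a) (hb : 0 < b)
    (hv : 0 ≤ v) (h : a * v < b * u) :
    ∃ δ > (0 : ℝ), ∃ K > (0 : ℝ), ∀ Y : ℝ, 1 ≤ Y → ∃ n : ℕ,
      (x ^ n) ^ a * Y ^ (-u) ≤ K * Y ^ (-δ) ∧ (x ^ n) ^ (-b) * Y ^ v ≤ K * Y ^ (-δ) := by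
  obtain ⟨γ, hvγ, hγu⟩ : ∃ γ, v / b < γ ∧ γ < u / a :=
    exists_between (by rw [div_lt_div_iff₀ hb ha]; linarith)
  rw [div_lt_iff₀ hb] at hvγ
  rw [lt_div_iff₀ ha] at hγu
  have hγ : 0 < γ := by nlinarith
  have hx0 : 0 < x := one_pos.trans hx
  have hxa : 1 ≤ x ^ a := Real.one_le_rpow hx.le ha.le
  refine ⟨min (u - γ * a) (γ * b - v), lt_min (by linarith) (by linarith), x ^ a, by positivity,
    fun Y hY => ?_⟩
  have hY0 : 0 < Y := one_pos.trans_le hY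
  obtain ⟨n, hn, hn'⟩ := exists_nat_pow_near (Real.one_le_rpow hY hγ.le) hx
  refine ⟨n + 1, ?_, ?_⟩
  · calc (x ^ (n + 1)) ^ a * Y ^ (-u) = x ^ a * (x ^ n) ^ a * Y ^ (-u) := by
          rw [pow_succ', Real.mul_rpow hx0.le (by positivity)]
      _ ≤ x ^ a * (Y ^ γ) ^ a * Y ^ (-u) := by gcongr
      _ = x ^ a * Y ^ (-(u - γ * a)) := by
          rw [← Real.rpow_mul hY0.le, mul_assoc, ← Real.rpow_add hY0]; ring_nf
      _ ≤ _ := by gcongr; exact min_le_left _ _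
  · calc (x ^ (n + 1)) ^ (-b) * Y ^ v ≤ (Y ^ γ) ^ (-b) * Y ^ v := by
          refine mul_le_mul_of_nonneg_right ?_ (by positivity)
          exact Real.rpow_le_rpow_of_nonpos (by positivity) hn'.le (by linarith)
      _ = Y ^ (-(γ * b - v)) := by
          rw [← Real.rpow_mul hY0.le, ← Real.rpow_add hY0]; ring_nf
      _ ≤ Y ^ (-min (u - γ * a) (γ * b - v)) := by gcongr; exact min_le_right _ _
      _ ≤ _ := le_mul_of_one_le_left (by positivity) hxa

theorem lintegral_enorm_sq_fourierFun_le_rpow {μ : Measure ℚ_[p]} [IsFiniteMeasure μ]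
    (hμ : μ (Metric.closedBall 0 1)ᶜ = 0) {a b C : ℝ} (hb : 0 ≤ b) (hC : 0 ≤ C)
    (hdecay : ∀ ξ : ℚ_[p], 1 ≤ ‖ξ‖ → ‖fourierMeasure μ ξ‖ ≤ C * ‖ξ‖ ^ (-b))
    (hball : ∀ (x : ℚ_[p]) (r : ℝ), 0 < r → r ≤ 1 →
      μ.real (Metric.closedBall x r) ≤ C * r ^ a)
    {f : ℚ_[p] → ℂ} (hf : Integrable f (haar p)) (n : ℕ) :
    ∫⁻ t, ‖fourierFun f t‖ₑ ^ 2 ∂μ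
      ≤ ENNReal.ofReal (2 * C * ((p : ℝ) ^ n) ^ (1 - a)) * ∫⁻ x, ‖f x‖ₑ ^ 2 ∂haar p
        + ENNReal.ofReal (C * ((p : ℝ) ^ n) ^ (-b)) * (∫⁻ x, ‖f x‖ₑ ∂haar p) ^ 2 := by
  have hp : 1 < (p : ℝ) := one_lt_prime_real p
  have hR0 : 0 < (p : ℝ) ^ n := by positivity
  have hR1 : 1 ≤ (p : ℝ) ^ n := one_le_pow₀ hp.le
  have hM : ∀ x : ℚ_[p], μ (Metric.closedBall x ((p : ℝ) ^ (-(n : ℤ))))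
      ≤ ENNReal.ofReal (C * ((p : ℝ) ^ n) ^ (-a)) := fun x => by
    rw [zpow_neg, zpow_natCast, Real.rpow_neg hR0.le, ← Real.inv_rpow hR0.le, ← ofReal_measureReal]
    exact ENNReal.ofReal_le_ofReal (hball x _ (by positivity) (inv_le_one_of_one_le₀ hR1))
  have hA : ∀ s : ℚ_[p], (p : ℝ) ^ n < ‖s‖ →
      ‖fourierMeasure μ s‖ₑ ≤ ENNReal.ofReal (C * ((p : ℝ) ^ n) ^ (-b)) := fun s hs => by
    rw [← ofReal_norm]
    refine ENNReal.ofReal_le_ofReal ((hdecay s (hR1.trans hs.le)).trans ?_)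
    exact mul_le_mul_of_nonneg_left
      (Real.rpow_le_rpow_of_nonpos hR0 hs.le (neg_nonpos.2 hb)) hC
  refine (lintegral_enorm_sq_fourierFun_le_of_scale hμ hM hA hf).trans_eq ?_
  congr 1
  rw [← ENNReal.ofReal_natCast p, ← ENNReal.ofReal_pow (by positivity), ← mul_assoc,
    ← ENNReal.ofReal_mul (by positivity), ← ENNReal.ofReal_ofNat 2,
    ← ENNReal.ofReal_mul (by positivity)]
  congr 2
  rw [sub_eq_add_neg, Real.rpow_add hR0, Real.rpow_one]
  ring

theorem exists_eLpNorm_fourierFun_le {μ : Measure ℚ_[p]} [IsFiniteMeasure μ]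
    (hμ : μ (Metric.closedBall 0 1)ᶜ = 0) {a b C q : ℝ} (ha : a < 1) (hb : 0 < b) (hC : 0 < C)
    (hdecay : ∀ ξ : ℚ_[p], 1 ≤ ‖ξ‖ → ‖fourierMeasure μ ξ‖ ≤ C * ‖ξ‖ ^ (-b))
    (hball : ∀ (x : ℚ_[p]) (r : ℝ), 0 < r → r ≤ 1 →
      μ.real (Metric.closedBall x r) ≤ C * r ^ a)
    (hq : 1 ≤ q) (habq : (1 - a) * (2 * q - 2) < b * (2 - q)) :
    ∃ δ > (0 : ℝ), ∃ K > (0 : ℝ), ∀ Y : ℝ, 1 ≤ Y → ∀ f : ℚ_[p] → ℂ, Integrable f (haar p) →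
      ∫⁻ x, ‖f x‖ₑ ∂haar p ≤ ENNReal.ofReal (2 * Y ^ (q - 1)) →
      ∫⁻ x, ‖f x‖ₑ ^ 2 ∂haar p ≤ ENNReal.ofReal (4 * Y ^ (q - 2)) →
      eLpNorm (fourierFun f) 2 μ ≤ ENNReal.ofReal (K * Y ^ (-δ)) := by
  obtain ⟨δ, hδ, K, hK, hYn⟩ := exists_nat_pow_mul_rpow_le (one_lt_prime_real p) (sub_pos.2 ha) hb
    (by linarith : 0 ≤ 2 * q - 2) habq
  refine ⟨δ / 2, by positivity, √(12 * C * K), by positivity, fun Y hY f hf h1 h2 => ?_⟩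
  have hY0 : 0 < Y := one_pos.trans_le hY
  obtain ⟨n, hn2, hn1⟩ := hYn Y hY
  rw [neg_sub] at hn2
  have hsq : (Y ^ (q - 1)) ^ 2 = Y ^ (2 * q - 2) := by
    rw [← Real.rpow_mul_natCast hY0.le]; push_cast; ring_nf
  have hbound : ∫⁻ t, ‖fourierFun f t‖ₑ ^ 2 ∂μ ≤ ENNReal.ofReal (12 * C * K * Y ^ (-δ)) := by
    refine (lintegral_enorm_sq_fourierFun_le_rpow hμ hb.le hC.le hdecay hball hf n).trans ?_
    refine (add_le_add (mul_le_mul_right h2 _)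
      (mul_le_mul_right (pow_le_pow_left₀ zero_le h1 2) _)).trans ?_
    rw [← ENNReal.ofReal_pow (by positivity), ← ENNReal.ofReal_mul (by positivity),
      ← ENNReal.ofReal_mul (by positivity), ← ENNReal.ofReal_add (by positivity) (by positivity)]
    refine ENNReal.ofReal_le_ofReal ?_
    rw [mul_pow, hsq]
    nlinarith
  rw [eLpNorm_two_eq_lintegral]
  refine (ENNReal.rpow_le_rpow hbound (by positivity)).trans_eq ?_
  rw [ENNReal.ofReal_rpow_of_nonneg (by positivity) (by positivity),
    Real.mul_rpow (by positivity) (by positivity), ← Real.rpow_mul hY0.le, Real.sqrt_eq_rpow]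
  ring_nf

theorem lintegral_enorm_dyadicPart_succ_pow_le {f : ℚ_[p] → ℂ} {q : ℝ} (hq : 0 ≤ q)
    (hf : ∫⁻ x, ‖f x‖ₑ ^ q ∂haar p ≤ 1) {n : ℕ} (hn : n ≠ 0) (j : ℕ) :
    ∫⁻ x, ‖dyadicPart (j + 1) (f x)‖ₑ ^ n ∂haar p
      ≤ ENNReal.ofReal (2 ^ n * ((2 : ℝ) ^ (j + 1)) ^ (q - n)) := by
  refine (lintegral_mono fun x => enorm_dyadicPart_succ_pow_le hq hn j (f x)).trans ?_
  rw [lintegral_const_mul' _ _ ENNReal.ofReal_ne_top]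
  exact mul_le_of_le_one_right' hf

theorem eLpNorm_fourierFun_dyadicPart_zero_le (μ : Measure ℚ_[p]) {f : ℚ_[p] → ℂ} {q : ℝ}
    (hq : 1 ≤ q) (hf : ∫⁻ x, ‖f x‖ₑ ^ q ∂haar p ≤ 1) (r : ℝ≥0∞) :
    eLpNorm (fourierFun (dyadicPart 0 ∘ f)) r μ ≤ μ Set.univ ^ r.toReal⁻¹ := by
  have hle : ∀ s, ‖fourierFun (dyadicPart 0 ∘ f) s‖ₑ ≤ 1 := fun s =>
    calc _ ≤ ∫⁻ x, ‖dyadicPart 0 (f x)‖ₑ ∂haar p :=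
          (enorm_integral_le_lintegral_enorm _).trans_eq
            (by simp [enorm_mul, ← ofReal_norm (stdChar _), norm_stdChar])
      _ ≤ ∫⁻ x, ‖f x‖ₑ ^ q ∂haar p := lintegral_mono fun x => enorm_dyadicPart_zero_le hq _
      _ ≤ 1 := hf
  simpa using eLpNorm_le_of_ae_enorm_bound (p := r) (μ := μ) (.of_forall hle)

theorem exists_eLpNorm_fourierFun_le_of_lintegral_le_one {μ : Measure ℚ_[p]} [IsFiniteMeasure μ]
    (hμ : μ (Metric.closedBall 0 1)ᶜ = 0) {a b C q : ℝ} (ha : a < 1) (hb : 0 < b) (hC : 0 < C)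
    (hdecay : ∀ ξ : ℚ_[p], 1 ≤ ‖ξ‖ → ‖fourierMeasure μ ξ‖ ≤ C * ‖ξ‖ ^ (-b))
    (hball : ∀ (x : ℚ_[p]) (r : ℝ), 0 < r → r ≤ 1 →
      μ.real (Metric.closedBall x r) ≤ C * r ^ a)
    (hq : 1 ≤ q) (habq : (1 - a) * (2 * q - 2) < b * (2 - q)) :
    ∃ K : ℝ≥0, ∀ f : ℚ_[p] → ℂ, Integrable f (haar p) → ∫⁻ x, ‖f x‖ₑ ^ q ∂haar p ≤ 1 →
      eLpNorm (fourierFun f) 2 μ ≤ K := by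
  have hq0 : 0 ≤ q := zero_le_one.trans hq
  obtain ⟨δ, hδ, K, _, hscale⟩ :=
    exists_eLpNorm_fourierFun_le hμ ha hb hC hdecay hball hq habq
  have hgeom : ∀ j : ℕ, ((2 : ℝ) ^ (j + 1)) ^ (-δ) = ((2 : ℝ) ^ (-δ)) ^ (j + 1) := fun j => by
    rw [← Real.rpow_natCast_mul two_pos.le, ← Real.rpow_mul_natCast two_pos.le, mul_comm]
  have hsum : Summable fun j : ℕ => K * ((2 : ℝ) ^ (j + 1)) ^ (-δ) := by
    simp only [hgeom]
    refine ((summable_nat_add_iff 1).2 (summable_geometric_of_lt_one (by positivity) ?_)).mul_left K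
    exact Real.rpow_lt_one_of_one_lt_of_neg one_lt_two (neg_lt_zero.2 hδ)
  set B : ℝ≥0∞ := μ Set.univ ^ (2 : ℝ≥0∞).toReal⁻¹
    + ∑' j : ℕ, ENNReal.ofReal (K * ((2 : ℝ) ^ (j + 1)) ^ (-δ))
  have hBtop : B ≠ ∞ := ENNReal.add_ne_top.2
    ⟨ENNReal.rpow_ne_top_of_nonneg (by positivity) (measure_ne_top _ _), hsum.tsum_ofReal_ne_top⟩
  refine ⟨B.toNNReal, fun f hf hfq => ?_⟩
  have hpart : ∀ j, Integrable (dyadicPart j ∘ f) (haar p) := integrable_dyadicPart_comp hf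
  have hsucc : ∀ j, eLpNorm (fourierFun (dyadicPart (j + 1) ∘ f)) 2 μ
      ≤ ENNReal.ofReal (K * ((2 : ℝ) ^ (j + 1)) ^ (-δ)) := fun j => by
    refine hscale _ (one_le_pow₀ one_le_two) _ (hpart (j + 1)) ?_ ?_
    · simpa using lintegral_enorm_dyadicPart_succ_pow_le hq0 hfq one_ne_zero j
    · convert lintegral_enorm_dyadicPart_succ_pow_le hq0 hfq two_ne_zero j using 3 <;> norm_num
  rw [ENNReal.coe_toNNReal hBtop]
  calc eLpNorm (fourierFun f) 2 μ ≤ ∑' j, eLpNorm (fourierFun (dyadicPart j ∘ f)) 2 μ :=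
        eLpNorm_le_tsum_of_hasSum one_le_two
          (fun j => (continuous_fourierFun (hpart j)).aestronglyMeasurable)
          (hasSum_fourierFun_dyadicPart hf)
    _ = eLpNorm (fourierFun (dyadicPart 0 ∘ f)) 2 μ
          + ∑' j, eLpNorm (fourierFun (dyadicPart (j + 1) ∘ f)) 2 μ :=
        tsum_eq_zero_add' ENNReal.summable
    _ ≤ B := add_le_add (eLpNorm_fourierFun_dyadicPart_zero_le μ hq hfq 2)
        (ENNReal.tsum_le_tsum hsucc)

theorem fourierFun_const_smul (c : ℂ) (f : ℚ_[p] → ℂ) : fourierFun (c • f) = c • fourierFun f := by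
  ext s
  simp only [fourierFun, Pi.smul_apply, smul_eq_mul, mul_left_comm _ c, integral_const_mul]

theorem eLpNorm_fourierFun_le_of_normalized {μ : Measure ℚ_[p]} {r : ℝ≥0∞} (hr : r ≠ 0) {K : ℝ≥0∞}
    (h : ∀ f : ℚ_[p] → ℂ, Integrable f (haar p) → eLpNorm f r (haar p) ≤ 1 →
      eLpNorm (fourierFun f) 2 μ ≤ K)
    {f : ℚ_[p] → ℂ} (hf : Integrable f (haar p)) (hfr : eLpNorm f r (haar p) ≠ ∞) :
    eLpNorm (fourierFun f) 2 μ ≤ K * eLpNorm f r (haar p) := by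
  set N := eLpNorm f r (haar p)
  rcases eq_or_ne N 0 with h0 | h0
  · have hf0 : f =ᵐ[haar p] 0 := (eLpNorm_eq_zero_iff hf.aestronglyMeasurable hr).1 h0
    have : fourierFun f = 0 := funext fun s => integral_eq_zero_of_ae <| by
      filter_upwards [hf0] with x hx
      simp [hx]
    simp [this]
  · have hc : ‖(N.toReal⁻¹ : ℂ)‖ₑ = N⁻¹ := by
      rw [enorm_inv (by simp [ENNReal.toReal_eq_zero_iff, h0, hfr]), ← ofReal_norm,
        Complex.norm_real, Real.norm_of_nonneg ENNReal.toReal_nonneg, ENNReal.ofReal_toReal hfr]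
    have key := h ((N.toReal⁻¹ : ℂ) • f) (hf.smul _)
      (by rw [eLpNorm_const_smul, hc, ENNReal.inv_mul_cancel h0 hfr])
    rwa [fourierFun_const_smul, eLpNorm_const_smul, hc, mul_comm, ← div_eq_mul_inv,
      ENNReal.div_le_iff h0 hfr] at key

theorem exists_eLpNorm_fourierFun_le_mul {μ : Measure ℚ_[p]} [IsFiniteMeasure μ]
    (hμ : μ (Metric.closedBall 0 1)ᶜ = 0) {a b C q : ℝ} (ha : a < 1) (hb : 0 < b) (hC : 0 < C)
    (hdecay : ∀ ξ : ℚ_[p], 1 ≤ ‖ξ‖ → ‖fourierMeasure μ ξ‖ ≤ C * ‖ξ‖ ^ (-b))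
    (hball : ∀ (x : ℚ_[p]) (r : ℝ), 0 < r → r ≤ 1 →
      μ.real (Metric.closedBall x r) ≤ C * r ^ a)
    (hq : 1 ≤ q) (habq : (1 - a) * (2 * q - 2) < b * (2 - q)) :
    ∃ K : ℝ≥0, ∀ f : ℚ_[p] → ℂ, MemLp f (ENNReal.ofReal q) (haar p) → Integrable f (haar p) →
      eLpNorm (fourierFun f) 2 μ ≤ K * eLpNorm f (ENNReal.ofReal q) (haar p) := by
  have hq0 : 0 < q := one_pos.trans_le hq
  have hr : ENNReal.ofReal q ≠ 0 := (ENNReal.ofReal_pos.2 hq0).ne'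
  obtain ⟨K, hK⟩ :=
    exists_eLpNorm_fourierFun_le_of_lintegral_le_one hμ ha hb hC hdecay hball hq habq
  refine ⟨K, fun f hfq hf => eLpNorm_fourierFun_le_of_normalized hr (fun g hg hg1 => hK g hg ?_) hf
    hfq.eLpNorm_ne_top⟩
  rw [eLpNorm_eq_lintegral_rpow_enorm_toReal hr ENNReal.ofReal_ne_top,
    ENNReal.toReal_ofReal hq0.le, one_div, ENNReal.rpow_inv_le_iff hq0, ENNReal.one_rpow] at hg1
  exact hg1

theorem exists_eLpNorm_fourierFun_le_mul_of_log {μ : Measure ℚ_[p]} [IsFiniteMeasure μ]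
    (hμ : μ (Metric.closedBall 0 1)ᶜ = 0) {a b C q : ℝ} (ha : a ≤ 1) (hb : 0 < b)
    (hC : 0 < C)
    (hdecay : ∀ ξ : ℚ_[p], 1 ≤ ‖ξ‖ →
      ‖fourierMeasure μ ξ‖ ≤ C * (‖ξ‖ ^ (-b) * Real.log (1 + ‖ξ‖) ^ 2))
    (hball : ∀ (x : ℚ_[p]) (r : ℝ), 0 < r → r ≤ 1 →
      μ.real (Metric.closedBall x r) ≤ C * (r ^ a * Real.log (1 + r⁻¹) ^ 2))
    (hq : 1 ≤ q) (habq : (1 - a) * (2 * q - 2) < b * (2 - q)) :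
    ∃ K : ℝ≥0, ∀ f : ℚ_[p] → ℂ, MemLp f (ENNReal.ofReal q) (haar p) → Integrable f (haar p) →
      eLpNorm (fourierFun f) 2 μ ≤ K * eLpNorm f (ENNReal.ofReal q) (haar p) := by
  obtain ⟨ε, hε0, hε⟩ : ∃ ε > 0, q * ε < b * (2 - q) - (1 - a) * (2 * q - 2) :=
    exists_pos_mul_lt (sub_pos.2 habq) q
  have hnonneg : 0 ≤ (1 - a) * (2 * q - 2) := mul_nonneg (by linarith) (by linarith)
  have hq2 : 0 < 2 - q := pos_of_mul_pos_right (hnonneg.trans_lt habq) hb.le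
  have hbε : 0 < b - ε := by
    refine pos_of_mul_pos_left (b := 2 - q) ?_ hq2.le
    nlinarith
  obtain ⟨K₁, _, hK₁⟩ :=
    exists_norm_fourierMeasure_le_rpow (neg_lt_neg (sub_lt_self b hε0)) hC hdecay
  obtain ⟨K₂, hK₂0, hK₂⟩ := exists_measureReal_closedBall_le_rpow (sub_lt_self a hε0) hC hball
  refine exists_eLpNorm_fourierFun_le_mul hμ (a := a - ε) (b := b - ε) (C := max K₁ K₂)
    (by linarith) hbε (lt_max_of_lt_right hK₂0) (fun ξ hξ => (hK₁ ξ hξ).trans ?_)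
    (fun x r hr0 hr1 => (hK₂ x r hr0 hr1).trans ?_) hq (by linarith)
  · gcongr
    exact le_max_left _ _
  · gcongr
    exact le_max_right _ _

theorem restriction_exponent_lt {τ q : ℝ} (hτ : 2 < τ) (hq : q < 1 + 1 / (2 * τ - 3)) :
    (1 - 2 / τ) * (2 * q - 2) < 1 / τ * (2 - q) := by
  have hτ0 : 0 < τ := by linarith
  have hq' : (q - 1) * (2 * τ - 3) < 1 := by
    rw [← lt_div_iff₀ (by linarith)]
    linarith
  field_simp
  linarith

theorem measure_compl_closedBall_eq_zero_of_mem_probOn {τ : ℝ} {μ : Measure ℚ_[p]}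
    (hμ : μ ∈ probOn (wellApprox p τ)) : μ (Metric.closedBall 0 1)ᶜ = 0 :=
  measure_mono_null (Set.compl_subset_compl.2 fun x hx => by simpa using (hμ.2.2 hx).1)
    (Measure.measure_compl_support)

theorem exists_restriction_estimate {τ q C : ℝ} (hτ : 2 < τ) (hC : 0 < C) {μ : Measure ℚ_[p]}
    (hμ : μ ∈ probOn (wellApprox p τ))
    (hdecay : ∀ ξ : ℚ_[p], 1 ≤ ‖ξ‖ →
      ‖fourierMeasure μ ξ‖ ≤ C * (‖ξ‖ ^ (-1 / τ) * Real.log (1 + ‖ξ‖) ^ 2))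
    (hball : ∀ (x : ℚ_[p]) (r : ℝ), 0 < r → r ≤ 1 →
      μ.real (Metric.closedBall x r) ≤ C * (r ^ (2 / τ) * Real.log (1 + r⁻¹) ^ 2))
    (hq1 : 1 ≤ q) (hq : q < 1 + 1 / (2 * τ - 3)) :
    ∃ K : ℝ≥0, ∀ f : ℚ_[p] → ℂ,
      MemLp f (ENNReal.ofReal q) (haar p) → MemLp f 1 (haar p) →
      (∫⁻ x, ‖fourierFun f x‖ₑ ^ 2 ∂μ) ^ (1 / 2 : ℝ) ≤
        K * eLpNorm f (ENNReal.ofReal q) (haar p) := by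
  have : IsProbabilityMeasure μ := hμ.1
  have hτ0 : 0 < τ := by linarith
  have hτ1 : 2 / τ ≤ 1 := (div_le_one hτ0).2 hτ.le
  simp only [neg_div] at hdecay
  obtain ⟨K, hK⟩ := exists_eLpNorm_fourierFun_le_mul_of_log
    (measure_compl_closedBall_eq_zero_of_mem_probOn hμ) hτ1 (by positivity) hC hdecay hball hq1
    (restriction_exponent_lt hτ hq)
  refine ⟨K, fun f hfq hf => ?_⟩
  rw [← eLpNorm_two_eq_lintegral]
  exact hK f hfq (memLp_one_iff_integrable.1 hf)

end Restriction

end PadicSalem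

open PadicSalem in
theorem theorem1 (p : ℕ) [Fact p.Prime] :
    ∃ C : ℝ, 0 < C ∧ ∀ τ : ℝ, 2 < τ →
      IsSalem (wellApprox p τ) ∧
      dimH (wellApprox p τ) = ENNReal.ofReal (2 / τ) ∧
      fourierDim (wellApprox p τ) = 2 / τ ∧
      ∃ μ ∈ probOn (wellApprox p τ),
        (∀ ξ : ℚ_[p], 1 ≤ ‖ξ‖ →
          ‖fourierMeasure μ ξ‖ ≤ C * (‖ξ‖ ^ (-1 / τ) * Real.log (1 + ‖ξ‖) ^ 2)) ∧
        (∀ (x : ℚ_[p]) (r : ℝ), 0 < r → r ≤ 1 →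
          μ.real (Metric.closedBall x r) ≤ C * (r ^ (2 / τ) * Real.log (1 + r⁻¹) ^ 2)) ∧
        (∀ q : ℝ, 1 ≤ q → q < 1 + 1 / (2 * τ - 3) →
          ∃ C' : ℝ≥0, ∀ f : ℚ_[p] → ℂ,
            MemLp f (ENNReal.ofReal q) (haar p) → MemLp f 1 (haar p) →
            (∫⁻ x, ‖fourierFun f x‖ₑ ^ 2 ∂μ) ^ (1 / 2 : ℝ) ≤
              C' * eLpNorm f (ENNReal.ofReal q) (haar p)) := by
  obtain ⟨C, hC, hsalem⟩ := exists_salem_measure p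
  refine ⟨C, hC, fun τ hτ => ?_⟩
  obtain ⟨μ, hμ, hdecay, hball⟩ := hsalem τ hτ
  have hτ0 : 0 < τ := by linarith
  have hτ1 : 2 / τ ≤ 1 := (div_le_one hτ0).2 hτ.le
  have hdimF : 2 / τ ≤ fourierDim (wellApprox p τ) :=
    le_fourierDim_of_fourier_decay hμ (by positivity) hτ1 hC
      (by rwa [show -(2 / τ / 2) = -1 / τ by ring])
  have hdimFH := ofReal_fourierDim_le_dimH (wellApprox p τ)
  have hdimH := dimH_wellApprox_le (p := p) hτ.le
  have hF : fourierDim (wellApprox p τ) = 2 / τ := hdimF.antisymm' <|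
    (ENNReal.ofReal_le_ofReal_iff (by positivity)).1 (hdimFH.trans hdimH)
  have hH : dimH (wellApprox p τ) = ENNReal.ofReal (2 / τ) := hdimH.antisymm (hF ▸ hdimFH)
  exact ⟨by rw [IsSalem, hH, hF], hH, hF, μ, hμ, hdecay, hball, fun q hq1 hq =>
    exists_restriction_estimate hτ hC hμ hdecay hball hq1 hq⟩
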